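/- **Setting.** All manifolds are smooth, Hausdorff, second countable and finite-dimensional. A graded manifold is $\mathbb Z$-graded (there is no additional fermionic degree): a manifold $M$ (its body) with a sheaf of graded-commutative algebras locally isomorphic to $C^\infty(V)[[\xi^1,\dots,\xi^r]]$, where the $\xi^i$ are graded-commuting coordinates of non-zero integer degrees. Vector fields of degree $k$ are graded derivations of degree $k$ of the algebra of functions, $[\cdot,\cdot]$ is the graded commutator, and $i_X$, $L_X=[i_X,d]$ are the usual graded contraction and Lie derivative, with $i_X d=L_X-(-1)^{|X|}d\,i_X$ and $[L_X,i_Y]=i_{[X,Y]}$. The degree of a form is the total degree of its coefficients and of the functions under $d$ (so $d$ has degree $0$). $X$ is a manifold of dimension $n$, $C^\infty(T[1]X)=\Omega(X)$, and $\mathrm d_X$ is the de Rham differential, a vector field of degree $1$ on $T[1]X$. Let $\pi:E\to B$ be a projection of graded manifolds and $\gamma$ a vector field of degree $1$ on $B$ with $\gamma^2=0$. Let $\mathcal I_B$ be the ideal of forms on $E$ generated by the forms $\pi^*\alpha$, $\alpha$ of positive form degree on $B$. A *presymplectic gPDE over the background* $(B,\gamma)$ (with zero distribution $\mathcal K_B=0$)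 consists of a vector field $Q$ of degree $1$ on $E$ with $Q\circ\pi^*=\pi^*\circ\gamma$, a two-form $\omega$ of degree $n-1$ and a function $\mathcal L$ of degree $n$ on $E$, with $$ d\omega=0,\qquad i_Q\omega+d\mathcal L\in\mathcal I_B,\qquad \tfrac12 i_Qi_Q\omega+Q\mathcal L=0 . $$ The last equation is the *presymplectic master equation*. For $(B,\gamma)=(T[1]X,\mathrm d_X)$ this is called a *presymplectic gPDE* $(E,Q,\omega,T[1]X)$, and $\mathcal I_B$ is written $\mathcal I$. For a presymplectic gPDE, $V$ is *vertical* if $V\circ\pi^*=0$, and $\mathcal K$ denotes the vertical vector fields $k$ with $i_k\omega\in\mathcal I$. An *internal symmetry* is a vertical vector field $V$, of any degree, with $L_V\omega\in\mathcal I$ and $[V,Q]\in\mathcal K$. A *conserved current associated to* $V$ is a function $J$ of degree $n-1+|V|$ with $i_V\omega+dJ\in\mathcal I$, $QJ=0$ and $\mathcal KJ=0$. **Theorem.** Let $X$ be a manifold of dimension $n$ whose de Rham cohomology vanishes in positive degrees, let $\pi:E\to T[1]X$ be a graded fibre bundle with non-empty connected fibres (more generally, a surjective submersion of graded manifolds with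 connected fibres), and let $(E,Q,\omega,T[1]X)$ with the function $\mathcal L$ be a presymplectic gPDE. Let $\mathfrak g$ be a finite-dimensional graded Lie algebra with homogeneous basis $e_\alpha$, $[e_\alpha,e_\beta]=U^\gamma_{\alpha\beta}e_\gamma$, and let $V_\alpha$ be internal symmetries with $|V_\alpha|=|e_\alpha|=:|\alpha|$ and $[V_\alpha,V_\beta]=U^\gamma_{\alpha\beta}V_\gamma$. Let $c^\alpha$, of degree $1-|\alpha|$, be the coordinates on $\mathfrak g[1]$; functions on $E\times\mathfrak g[1]$ and on $T[1]X\times\mathfrak g[1]$ are the formal power series in the $c^\alpha$ with coefficients in $C^\infty(E)$ and in $\Omega(X)$. 1. Suppose that the first cohomology of $E$ relative to $T[1]X$ vanishes, i.e. every one-form $\lambda$ on $E$ of definite degree with $d\lambda\in\mathcal I$ is of the form $\lambda\in dJ+\mathcal I$ for a function $J$ of the same degree, and that $|\alpha|\neq-n$ for all $\alpha$. Then every $V_\alpha$ has an associated conserved current. 2. Let $J_\alpha$ be conserved currents associated to the $V_\alpha$. There are $f_{\alpha\beta}\in\Omega^{\,n-1+|\alpha|+|\beta|}(X)$ with $$ \pi^*f_{\alpha\beta}=(-1)^{|\alpha|}V_\alpha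 J_\beta-U^\gamma_{\alpha\beta}J_\gamma, $$ a vector field $\gamma=\mathrm d_X+\mathrm d^0_{\mathfrak g}$ of degree $1$ on $B=T[1]X\times\mathfrak g[1]$, a vector field $\tilde Q=Q+\mathrm d_{\mathfrak g}$ of degree $1$ on $\tilde E=E\times\mathfrak g[1]$, where $\mathrm d_{\mathfrak g}=\mathrm d^0_{\mathfrak g}+c^\alpha V_\alpha$ and $$ \mathrm d^0_{\mathfrak g}c^\gamma=-\tfrac12\sum_{\alpha,\beta}(-1)^{|\alpha|(1+|\beta|)}U^\gamma_{\alpha\beta}\,c^\alpha c^\beta , $$ and a two-form $\tilde\omega$ on $\tilde E$, the pullback of $\omega$, such that for $\tilde{\mathcal L}=\mathcal L-\sum_\alpha(-1)^{|\alpha|}c^\alpha J_\alpha$ (which is $\mathcal L-c^\alpha J_\alpha$ for $\mathfrak g$ in degree $0$), for $\pi_B=\pi\times\mathrm{id}:\tilde E\to B$ and for $$ a=\tfrac12\sum_{\alpha,\beta}(-1)^{|\beta|(|\alpha|+1)}c^\alpha c^\beta f_{\alpha\beta}\in C^\infty(B) $$ (which is $\tfrac12c^\alpha c^\beta f_{\alpha\beta}$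 for $\mathfrak g$ in degree $0$) the following holds. * (a) $\gamma^2=0$, and $(\tilde E,\tilde Q,\tilde\omega,\tilde{\mathcal L})$ satisfies all conditions on a presymplectic gPDE over the background $(B,\gamma)$ except possibly the master equation, which holds up to a function pulled back from $B$: $$ \tfrac12 i_{\tilde Q}i_{\tilde Q}\tilde\omega+\tilde Q\tilde{\mathcal L}+\pi_B^*a=0 . $$ * (b) The anomaly $a$ is $\gamma$-closed, $\gamma a=0$. If $b\in C^\infty(B)$ has degree $n$ and $\gamma b=a$, then $(\tilde E,\tilde Q,\tilde\omega,\tilde{\mathcal L}+\pi_B^*b)$ is a presymplectic gPDE over the background $(B,\gamma)$; in particular this holds with $b=0$ if $a=0$. * (c) The anomaly vanishes on background solutions: if $S^*:C^\infty(B)\to\Omega(X)$ is a degree-preserving algebra homomorphism that is the identity on $\Omega(X)$ and satisfies $S^*\circ\gamma=\mathrm d_X\circ S^*$, then $S^*a=0$. Likewise, for all forms $A^\alpha\in\Omega^{1-|\alpha|}(X)$ satisfying the flatness equation $\mathrm d_XA^\gamma=-\frac12\sum_{\alpha,\beta}(-1)^{|\alpha|(1+|\beta|)}U^\gamma_{\alpha\beta}A^\alpha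 A^\beta$, the anomaly vanishes at $c^\alpha=A^\alpha$, and the pullback of $\tilde E$ to this background solution, that is $E$ with $Q_S=Q+\pi^*(A^\alpha)V_\alpha$, $\omega$ and $\mathcal L_S=\mathcal L-\sum_\alpha(-1)^{|\alpha|}\pi^*(A^\alpha)J_\alpha$, is a presymplectic gPDE over $T[1]X$. -/

import Mathlib

open scoped DirectSum Manifold ContDiff

universe u v w

noncomputable section

/-- The Koszul sign `(-1)^n`. -/
def sgn (n : ℤ) : ℤ := (Int.negOnePow n : ℤ)

theorem sgn_zero : sgn 0 = 1 := by simp [sgn]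
theorem sgn_add (m n : ℤ) : sgn (m + n) = sgn m * sgn n := by simp [sgn, Int.negOnePow_add]
theorem sgn_mul_self (m : ℤ) : sgn m * sgn m = 1 := by
  rw [← sgn_add]; simp [sgn, Int.negOnePow_even _ (Even.add_self m)]
theorem sgn_even {m : ℤ} (h : Even m) : sgn m = 1 := by simp [sgn, Int.negOnePow_even _ h]
theorem sgn_odd {m : ℤ} (h : Odd m) : sgn m = -1 := by simp [sgn, Int.negOnePow_odd _ h]
theorem sgn_congr {m n : ℤ} (h : Even (m - n)) : sgn m = sgn n := by
  have : m = (m - n) + n := by ring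
  rw [this, sgn_add, sgn_even h, one_mul]

/-- A `ℤ`-graded algebra over `ℝ`, graded-commutative: `a b = (-1)^(|a||b|) b a`. -/
structure GrAlg where
  carrier : Type u
  [ring : Ring carrier]
  [algebra : Algebra ℝ carrier]
  gr : ℤ → Submodule ℝ carrier
  one_mem : (1 : carrier) ∈ gr 0
  mul_mem : ∀ {i j : ℤ} {a b : carrier}, a ∈ gr i → b ∈ gr j → a * b ∈ gr (i + j)
  internal : DirectSum.IsInternal gr
  comm : ∀ {i j : ℤ} {a b : carrier}, a ∈ gr i → b ∈ gr j → a * b = sgn (i * j) • (b * a)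

namespace GrAlg

instance : CoeSort GrAlg.{u} (Type u) := ⟨carrier⟩
instance (A : GrAlg.{u}) : Ring A := A.ring
instance (A : GrAlg.{u}) : Algebra ℝ A := A.algebra

/-- Degree-preserving algebra homomorphisms. -/
structure Hom (A : GrAlg.{u}) (B : GrAlg.{v}) where
  toAlgHom : A →ₐ[ℝ] B
  map_gr : ∀ {i : ℤ} {a : A}, a ∈ A.gr i → toAlgHom a ∈ B.gr i

instance (A : GrAlg.{u}) (B : GrAlg.{v}) : CoeFun (Hom A B) (fun _ => A → B) := ⟨fun f => f.toAlgHom⟩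

theorem homogeneous_induction (A : GrAlg.{u}) {P : A → Prop} (h0 : P 0)
    (hadd : ∀ a b, P a → P b → P (a + b)) (hom : ∀ i, ∀ a ∈ A.gr i, P a) (a : A) : P a := by
  have h : a ∈ ⨆ i, A.gr i := by rw [A.internal.submodule_iSup_eq_top]; trivial
  exact Submodule.iSup_induction A.gr (motive := P) h hom h0 hadd

theorem bijective_coe (A : GrAlg.{u}) : Function.Bijective (DirectSum.coeLinearMap A.gr) := A.internal

/-- The linear map multiplying the component of degree `j` by `(-1)^(e j)`. -/
def twistLin (A : GrAlg.{u}) (e : ℤ) : A →ₗ[ℝ] A :=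
  (DirectSum.toModule ℝ ℤ A fun j => (sgn (e * j)) • (A.gr j).subtype) ∘ₗ
    (LinearEquiv.ofBijective (DirectSum.coeLinearMap A.gr) A.bijective_coe).symm.toLinearMap

theorem twistLin_of_mem (A : GrAlg.{u}) (e : ℤ) {j : ℤ} {a : A} (ha : a ∈ A.gr j) :
    A.twistLin e a = sgn (e * j) • a := by
  have h : (LinearEquiv.ofBijective (DirectSum.coeLinearMap A.gr) A.bijective_coe).symm a
      = DirectSum.lof ℝ ℤ (fun i => A.gr i) j ⟨a, ha⟩ := by
    rw [LinearEquiv.symm_apply_eq, LinearEquiv.ofBijective_apply, DirectSum.coeLinearMap_lof]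
  simp only [twistLin, LinearMap.comp_apply, LinearEquiv.coe_coe, h, DirectSum.toModule_lof]
  simp

/-- `twist e` multiplies the component of degree `j` by `(-1)^(e j)`: the sign that appears when
an element is moved past one of degree `e`. -/
def twist (A : GrAlg.{u}) (e : ℤ) : A →ₐ[ℝ] A :=
  AlgHom.ofLinearMap (A.twistLin e) (by rw [A.twistLin_of_mem e A.one_mem]; simp [sgn_zero]) (by
    intro x y
    refine A.homogeneous_induction (P := fun x => A.twistLin e (x * y) = A.twistLin e x * A.twistLin e y)
      (by simp) (fun a b ha hb => by simp only [add_mul, map_add, ha, hb]) (fun i a ha => ?_) x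
    refine A.homogeneous_induction (P := fun y => A.twistLin e (a * y) = A.twistLin e a * A.twistLin e y)
      (by simp) (fun a b ha hb => by simp only [mul_add, map_add, ha, hb]) (fun j b hb => ?_) y
    rw [A.twistLin_of_mem e ha, A.twistLin_of_mem e hb, A.twistLin_of_mem e (A.mul_mem ha hb),
      mul_add, sgn_add, smul_mul_smul_comm])

theorem twist_of_mem (A : GrAlg.{u}) (e : ℤ) {j : ℤ} {a : A} (ha : a ∈ A.gr j) :
    A.twist e a = sgn (e * j) • a := A.twistLin_of_mem e ha

theorem twist_zero (A : GrAlg.{u}) (a : A) : A.twist 0 a = a := by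
  refine A.homogeneous_induction (P := fun a => A.twist 0 a = a) (by simp)
    (fun a b ha hb => by simp only [map_add, ha, hb]) (fun i a ha => ?_) a
  rw [A.twist_of_mem 0 ha]; simp [sgn_zero]

theorem twist_twist (A : GrAlg.{u}) (e f : ℤ) (a : A) : A.twist e (A.twist f a) = A.twist (e + f) a := by
  refine A.homogeneous_induction (P := fun a => A.twist e (A.twist f a) = A.twist (e + f) a) (by simp)
    (fun a b ha hb => by simp only [map_add, ha, hb]) (fun i a ha => ?_) a
  rw [A.twist_of_mem f ha, map_zsmul, A.twist_of_mem e ha, A.twist_of_mem _ ha, smul_smul, add_mul,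
    sgn_add, mul_comm]

theorem twist_map {A : GrAlg.{u}} {B : GrAlg.{v}} (φ : Hom A B) (e : ℤ) (a : A) :
    φ (A.twist e a) = B.twist e (φ a) := by
  refine A.homogeneous_induction (P := fun a => φ (A.twist e a) = B.twist e (φ a)) (by simp)
    (fun a b ha hb => by simp only [map_add, ha, hb]) (fun i a ha => ?_) a
  rw [A.twist_of_mem e ha, map_zsmul, B.twist_of_mem e (φ.map_gr ha)]

/-- The graded algebra `⨁ gr k` inside an ambient algebra `R`. -/
def ofFamily (R : Type u) [Ring R] [Algebra ℝ R] (gr : ℤ → Submodule ℝ R)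
    (one_mem : (1 : R) ∈ gr 0)
    (mul_mem : ∀ {i j : ℤ} {a b : R}, a ∈ gr i → b ∈ gr j → a * b ∈ gr (i + j))
    (indep : iSupIndep gr)
    (comm : ∀ {i j : ℤ} {a b : R}, a ∈ gr i → b ∈ gr j → a * b = sgn (i * j) • (b * a)) :
    GrAlg.{u} :=
  let S : Subalgebra ℝ R := (⨆ i, gr i).toSubalgebra
    (Submodule.mem_iSup_of_mem 0 one_mem) (by
      intro x y hx hy
      refine Submodule.iSup_induction gr (motive := fun x => x * y ∈ ⨆ i, gr i) hx
        (fun i a ha => ?_) (by simp) (fun a b ha hb => by rw [add_mul]; exact add_mem ha hb)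
      refine Submodule.iSup_induction gr (motive := fun y => a * y ∈ ⨆ i, gr i) hy
        (fun j b hb => ?_) (by simp) (fun a b ha hb => by rw [mul_add]; exact add_mem ha hb)
      exact Submodule.mem_iSup_of_mem (i + j) (mul_mem ha hb))
  { carrier := S
    gr := fun k => (gr k).comap S.val.toLinearMap
    one_mem := one_mem
    mul_mem := fun ha hb => mul_mem ha hb
    internal := by
      have hle : ∀ k, gr k ≤ LinearMap.range S.val.toLinearMap := by
        intro k x hx
        exact ⟨⟨x, Submodule.mem_iSup_of_mem k hx⟩, rfl⟩
      have hmap : ∀ k, ((gr k).comap S.val.toLinearMap).map S.val.toLinearMap = gr k := by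
        intro k
        rw [Submodule.map_comap_eq, inf_eq_right]
        exact hle k
      have hinj : Function.Injective S.val.toLinearMap := Subtype.val_injective
      rw [DirectSum.isInternal_submodule_iff_iSupIndep_and_iSup_eq_top]
      constructor
      · intro k
        rw [Submodule.disjoint_def]
        intro x hx hx'
        have h1 := Submodule.disjoint_def.1 (indep k) x.1 hx
        apply hinj
        rw [map_zero]
        apply h1
        have := Submodule.mem_map_of_mem (f := S.val.toLinearMap) hx'
        simp only [Submodule.map_iSup, hmap] at this
        exact this
      · apply Submodule.map_injective_of_injective hinj
        simp only [Submodule.map_iSup, hmap]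
        rw [Submodule.map_top]
        ext x
        constructor
        · intro hx
          exact ⟨⟨x, hx⟩, rfl⟩
        · rintro ⟨y, rfl⟩
          exact y.2
    comm := fun ha hb => Subtype.ext (comm ha hb) }

/-- A commutative algebra as a graded algebra concentrated in degree `0`. -/
def ofComm (R : Type u) [CommRing R] [Algebra ℝ R] : GrAlg.{u} where
  carrier := R
  gr := fun k => if k = 0 then ⊤ else ⊥
  one_mem := by simp
  mul_mem := by
    intro i j a b ha hb
    by_cases hi : i = 0
    · by_cases hj : j = 0
      · simp [hi, hj]
      · simp [hj] at hb; simp [hb]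
    · simp [hi] at ha; simp [ha]
  internal := by
    rw [DirectSum.isInternal_submodule_iff_iSupIndep_and_iSup_eq_top]
    constructor
    · intro k
      rw [Submodule.disjoint_def]
      intro x hx hx'
      by_cases hk : k = 0
      · have : (⨆ j, ⨆ (_ : j ≠ k), if j = 0 then (⊤ : Submodule ℝ R) else ⊥) = ⊥ := by
          simp only [iSup_eq_bot]
          intro j hj
          rw [if_neg (by rwa [hk] at hj)]
        rw [this] at hx'
        simpa using hx'
      · simpa [hk] using hx
    · rw [eq_top_iff]
      exact le_trans (by simp) (le_iSup (fun k : ℤ => if k = 0 then (⊤ : Submodule ℝ R) else ⊥) 0)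
  comm := by
    intro i j a b ha hb
    by_cases hi : i = 0
    · simp [hi, sgn_zero, mul_comm]
    · simp [hi] at ha; simp [ha]

/-! ### Formal power series in graded variables -/

section Series

variable {r : ℕ}

/-- Degree of the monomial `ξ^K`. -/
def mdeg (d : Fin r → ℤ) (K : Fin r →₀ ℕ) : ℤ := ∑ i, (K i : ℤ) * d i

/-- Exponent of the sign in `ξ^K ξ^L = ± ξ^(K+L)` (variables are ordered increasingly). -/
def mswap (d : Fin r → ℤ) (K L : Fin r →₀ ℕ) : ℤ :=
  ∑ i, ∑ j ∈ Finset.univ.filter (fun j => j < i), (K i : ℤ) * (L j : ℤ) * (d i * d j)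

theorem mdeg_add (d : Fin r → ℤ) (K L : Fin r →₀ ℕ) : mdeg d (K + L) = mdeg d K + mdeg d L := by
  simp [mdeg, add_mul, Finset.sum_add_distrib]

theorem mdeg_zero (d : Fin r → ℤ) : mdeg d 0 = 0 := by simp [mdeg]

theorem mswap_add_left (d : Fin r → ℤ) (K L M : Fin r →₀ ℕ) :
    mswap d (K + L) M = mswap d K M + mswap d L M := by
  simp [mswap, add_mul, Finset.sum_add_distrib]

theorem mswap_add_right (d : Fin r → ℤ) (K L M : Fin r →₀ ℕ) :
    mswap d K (L + M) = mswap d K L + mswap d K M := by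
  simp [mswap, mul_add, add_mul, Finset.sum_add_distrib]

theorem mswap_zero_left (d : Fin r → ℤ) (K : Fin r →₀ ℕ) : mswap d 0 K = 0 := by simp [mswap]
theorem mswap_zero_right (d : Fin r → ℤ) (K : Fin r →₀ ℕ) : mswap d K 0 = 0 := by simp [mswap]

/-- The monomials: an odd variable occurs at most once. -/
def IsMono (d : Fin r → ℤ) (K : Fin r →₀ ℕ) : Prop := ∀ i, Odd (d i) → K i ≤ 1

theorem IsMono.left {d : Fin r → ℤ} {K L : Fin r →₀ ℕ} (h : IsMono d (K + L)) : IsMono d K :=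
  fun i hi => le_trans (by simp) (h i hi)

theorem IsMono.right {d : Fin r → ℤ} {K L : Fin r →₀ ℕ} (h : IsMono d (K + L)) : IsMono d L :=
  fun i hi => le_trans (by simp) (h i hi)

variable (A : GrAlg.{u}) (d : Fin r → ℤ)

/-- Auxiliary product: `(a ξ^K) (b ξ^L) = ± a b ξ^(K+L)`, with the sign from moving `ξ^K` past `b`
and from reordering `ξ^K ξ^L`. -/
def preMul (F G : (Fin r →₀ ℕ) → A) : (Fin r →₀ ℕ) → A := fun N =>
  ∑ p ∈ Finset.HasAntidiagonal.antidiagonal N, sgn (mswap d p.1 p.2) • (F p.1 * A.twist (mdeg d p.1) (G p.2))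

theorem preMul_assoc (F G H : (Fin r →₀ ℕ) → A) :
    preMul A d (preMul A d F G) H = preMul A d F (preMul A d G H) := by
  funext N
  simp only [preMul, Finset.sum_mul, Finset.smul_sum, map_sum, Finset.mul_sum, Finset.sum_sigma']
  refine Finset.sum_nbij' (fun x => ⟨(x.2.1, x.2.2 + x.1.2), (x.2.2, x.1.2)⟩)
    (fun x => ⟨(x.1.1 + x.2.1, x.2.2), (x.1.1, x.2.1)⟩) ?_ ?_ ?_ ?_ ?_
  · rintro ⟨⟨P, M⟩, ⟨K, L⟩⟩ h
    simp only [Finset.mem_sigma, Finset.HasAntidiagonal.mem_antidiagonal] at h ⊢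
    exact ⟨by rw [← add_assoc, h.2, h.1], trivial⟩
  · rintro ⟨⟨P, M⟩, ⟨K, L⟩⟩ h
    simp only [Finset.mem_sigma, Finset.HasAntidiagonal.mem_antidiagonal] at h ⊢
    exact ⟨by rw [add_assoc, h.2, h.1], trivial⟩
  · rintro ⟨⟨P, M⟩, ⟨K, L⟩⟩ h
    simp only [Finset.mem_sigma, Finset.HasAntidiagonal.mem_antidiagonal] at h
    obtain ⟨h1, h2⟩ := h
    subst h2
    rfl
  · rintro ⟨⟨P, M⟩, ⟨K, L⟩⟩ h
    simp only [Finset.mem_sigma, Finset.HasAntidiagonal.mem_antidiagonal] at h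
    obtain ⟨h1, h2⟩ := h
    subst h2
    rfl
  · rintro ⟨⟨P, M⟩, ⟨K, L⟩⟩ h
    simp only [Finset.mem_sigma, Finset.HasAntidiagonal.mem_antidiagonal] at h
    obtain ⟨h1, h2⟩ := h
    subst h2
    simp only [map_zsmul, map_mul, A.twist_twist, mswap_add_left, mswap_add_right, sgn_add, mdeg_add,
      smul_mul_assoc, mul_smul_comm, smul_smul, mul_assoc]
    congr 1
    ring

/-- Power series in variables `ξ_1, …, ξ_r` of degrees `d`, with coefficients in `A`
(written on the left); no condition on the total degree yet. -/
def Series : Type u := {K : Fin r →₀ ℕ // IsMono d K} → A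

namespace Series

variable {A d}

instance : AddCommGroup (Series A d) := inferInstanceAs (AddCommGroup ({K : Fin r →₀ ℕ // IsMono d K} → A))
instance : Module ℝ (Series A d) := inferInstanceAs (Module ℝ ({K : Fin r →₀ ℕ // IsMono d K} → A))

open Classical in
/-- Extension by zero to all multi-indices. -/
def ext0 (F : Series A d) : (Fin r →₀ ℕ) → A := fun K => if h : IsMono d K then F ⟨K, h⟩ else 0

theorem ext0_of (F : Series A d) {K : Fin r →₀ ℕ} (h : IsMono d K) : F.ext0 K = F ⟨K, h⟩ := dif_pos h

instance : Mul (Series A d) := ⟨fun F G N => preMul A d F.ext0 G.ext0 N.1⟩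

open Classical in
/-- The series with the single term `a ξ^K`. -/
def single (K : Fin r →₀ ℕ) (a : A) : Series A d := fun N => if N.1 = K then a else 0

instance : One (Series A d) := ⟨single 0 1⟩

theorem mul_apply (F G : Series A d) (N) : (F * G) N =
    ∑ p ∈ Finset.HasAntidiagonal.antidiagonal N.1, sgn (mswap d p.1 p.2) • (F.ext0 p.1 * A.twist (mdeg d p.1) (G.ext0 p.2)) := rfl

theorem add_apply (F G : Series A d) (N) : (F + G) N = F N + G N := rfl
theorem zero_apply (N) : (0 : Series A d) N = 0 := rfl
theorem smul_apply (c : ℝ) (F : Series A d) (N) : (c • F) N = c • F N := rfl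
theorem zsmul_apply (c : ℤ) (F : Series A d) (N) : (c • F) N = c • F N := rfl

theorem ext0_add (F G : Series A d) (K) : (F + G).ext0 K = F.ext0 K + G.ext0 K := by
  by_cases h : IsMono d K
  · simp only [ext0_of _ h]; rfl
  · simp [ext0, h]

theorem ext0_zero (K) : (0 : Series A d).ext0 K = 0 := by
  by_cases h : IsMono d K
  · simp only [ext0_of _ h]; rfl
  · simp [ext0, h]

theorem ext0_smul (c : ℝ) (F : Series A d) (K) : (c • F).ext0 K = c • F.ext0 K := by
  by_cases h : IsMono d K
  · simp only [ext0_of _ h]; rfl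
  · simp [ext0, h]

theorem ext0_mul (F G : Series A d) {K} (h : IsMono d K) :
    (F * G).ext0 K = preMul A d F.ext0 G.ext0 K := by
  rw [ext0_of _ h]; rfl

theorem isMono_zero : IsMono d 0 := fun i _ => by simp

open Classical in
theorem ext0_one (K) : (1 : Series A d).ext0 K = if K = 0 then 1 else 0 := by
  by_cases h : IsMono d K
  · rw [ext0_of _ h]; rfl
  · rw [ext0, dif_neg h, if_neg]
    rintro rfl
    exact h isMono_zero

instance : Ring (Series A d) :=
  { (inferInstance : AddCommGroup (Series A d)), (inferInstance : Mul (Series A d)),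
    (inferInstance : One (Series A d)) with
    left_distrib := by
      intro F G H
      funext N
      simp only [mul_apply, add_apply, ext0_add, map_add, mul_add, smul_add, Finset.sum_add_distrib]
    right_distrib := by
      intro F G H
      funext N
      simp only [mul_apply, add_apply, ext0_add, add_mul, smul_add, Finset.sum_add_distrib]
    zero_mul := by
      intro F
      funext N
      simp [mul_apply, ext0_zero, zero_apply]
    mul_zero := by
      intro F
      funext N
      simp [mul_apply, ext0_zero, zero_apply]
    mul_assoc := by
      intro F G H
      funext N
      have h1 : (F * G * H) N = preMul A d (preMul A d F.ext0 G.ext0) H.ext0 N.1 := by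
        rw [mul_apply]
        refine Finset.sum_congr rfl fun p hp => ?_
        rw [ext0_mul _ _ (IsMono.left (by rw [Finset.HasAntidiagonal.mem_antidiagonal.1 hp]; exact N.2))]
      have h2 : (F * (G * H)) N = preMul A d F.ext0 (preMul A d G.ext0 H.ext0) N.1 := by
        rw [mul_apply]
        refine Finset.sum_congr rfl fun p hp => ?_
        rw [ext0_mul _ _ (IsMono.right (by rw [Finset.HasAntidiagonal.mem_antidiagonal.1 hp]; exact N.2))]
      rw [h1, h2, preMul_assoc]
    one_mul := by
      intro F
      funext N
      rw [mul_apply, Finset.sum_eq_single (0, N.1)]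
      · simp [ext0_one, mswap_zero_left, mdeg_zero, sgn_zero, A.twist_zero, ext0_of _ N.2]
      · rintro ⟨K, L⟩ hp hne
        have hK : K ≠ 0 := by
          rintro rfl
          apply hne
          simp only [Finset.HasAntidiagonal.mem_antidiagonal, zero_add] at hp
          rw [hp]
        simp [ext0_one, hK]
      · intro h
        simp at h
    mul_one := by
      intro F
      funext N
      rw [mul_apply, Finset.sum_eq_single (N.1, 0)]
      · simp [ext0_one, mswap_zero_right, sgn_zero, ext0_of _ N.2]
      · rintro ⟨K, L⟩ hp hne
        have hL : L ≠ 0 := by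
          rintro rfl
          apply hne
          simp only [Finset.HasAntidiagonal.mem_antidiagonal, add_zero] at hp
          rw [hp]
        simp [ext0_one, hL]
      · intro h
        simp at h
    zsmul := fun c F => c • F
    zsmul_zero' := fun F => zero_zsmul F
    zsmul_succ' := fun n F => SubNegMonoid.zsmul_succ' n F
    zsmul_neg' := fun n F => SubNegMonoid.zsmul_neg' n F }

instance : Algebra ℝ (Series A d) :=
  Algebra.ofModule (by
    intro c F G
    funext N
    simp only [mul_apply, smul_apply, ext0_smul, Finset.smul_sum, smul_mul_assoc]
    exact Finset.sum_congr rfl fun p _ => smul_comm _ _ _) (by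
    intro c F G
    funext N
    simp only [mul_apply, smul_apply, ext0_smul, Finset.smul_sum, map_smul, mul_smul_comm]
    exact Finset.sum_congr rfl fun p _ => smul_comm _ _ _)

/-- The series of total degree `k`. -/
def grade (A : GrAlg.{u}) (d : Fin r → ℤ) (k : ℤ) : Submodule ℝ (Series A d) where
  carrier := {F | ∀ N, F N ∈ A.gr (k - mdeg d N.1)}
  add_mem' := fun ha hb N => (A.gr (k - mdeg d N.1)).add_mem (ha N) (hb N)
  zero_mem' := fun N => (A.gr (k - mdeg d N.1)).zero_mem
  smul_mem' := fun c _ ha N => (A.gr (k - mdeg d N.1)).smul_mem c (ha N)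

theorem ext0_mem {k : ℤ} {F : Series A d} (hF : F ∈ grade A d k) (K) : F.ext0 K ∈ A.gr (k - mdeg d K) := by
  by_cases h : IsMono d K
  · rw [ext0_of _ h]; exact hF ⟨K, h⟩
  · simp [ext0, h]

theorem gr_mul {i j : ℤ} {F G : Series A d} (hF : F ∈ grade A d i) (hG : G ∈ grade A d j) :
    F * G ∈ grade A d (i + j) := by
  intro N
  rw [mul_apply]
  refine Submodule.sum_mem _ fun p hp => ?_
  have hN := Finset.HasAntidiagonal.mem_antidiagonal.1 hp
  refine zsmul_mem ?_ _
  rw [A.twist_of_mem _ (ext0_mem hG p.2), mul_smul_comm]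
  refine zsmul_mem ?_ _
  have := A.mul_mem (ext0_mem hF p.1) (ext0_mem hG p.2)
  rw [← hN, mdeg_add]
  convert this using 2
  ring

/-- The two reorderings of a product of monomials differ by the Koszul sign. -/
theorem mswap_swap {K L : Fin r →₀ ℕ} (h : IsMono d (K + L)) :
    Even (mswap d K L + mswap d L K - mdeg d K * mdeg d L) := by
  have e1 : mdeg d K * mdeg d L = ∑ i, ∑ j, (K i : ℤ) * (L j : ℤ) * (d i * d j) := by
    rw [mdeg, mdeg, Finset.sum_mul_sum]
    refine Finset.sum_congr rfl fun i _ => Finset.sum_congr rfl fun j _ => by ring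
  have e2 : mswap d L K = ∑ i, ∑ j ∈ Finset.univ.filter (fun j => i < j), (K i : ℤ) * (L j : ℤ) * (d i * d j) := by
    rw [mswap]
    simp only [Finset.sum_filter]
    rw [Finset.sum_comm]
    refine Finset.sum_congr rfl fun i _ => Finset.sum_congr rfl fun j _ => ?_
    split_ifs <;> ring
  rw [e1, e2, mswap, ← Finset.sum_add_distrib, ← Finset.sum_sub_distrib]
  refine Finset.even_sum _ fun i _ => ?_
  have e3 : ∑ j, (K i : ℤ) * (L j : ℤ) * (d i * d j) =
      (∑ j ∈ Finset.univ.filter (fun j => j < i), (K i : ℤ) * (L j : ℤ) * (d i * d j)) +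
      (∑ j ∈ Finset.univ.filter (fun j => i < j), (K i : ℤ) * (L j : ℤ) * (d i * d j)) +
      (K i : ℤ) * (L i : ℤ) * (d i * d i) := by
    simp only [Finset.sum_filter]
    rw [← Finset.sum_add_distrib]
    have : (K i : ℤ) * (L i : ℤ) * (d i * d i) =
        ∑ j, if j = i then (K i : ℤ) * (L j : ℤ) * (d i * d j) else 0 := by simp
    rw [this, ← Finset.sum_add_distrib]
    refine Finset.sum_congr rfl fun j _ => ?_
    rcases lt_trichotomy j i with h | h | h
    · simp [h, h.ne, h.asymm]
    · simp [h]
    · simp [h, h.ne', h.asymm]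
  rw [e3]
  have e4 : Even ((K i : ℤ) * (L i : ℤ) * (d i * d i)) := by
    rcases Int.even_or_odd (d i) with hd | hd
    · exact (hd.mul_right _).mul_left _
    · have := h i hd
      simp only [Finsupp.add_apply] at this
      have : K i = 0 ∨ L i = 0 := by omega
      rcases this with h | h <;> simp [h]
  have := e4.neg
  convert this using 1
  ring

theorem gr_comm {i j : ℤ} {F G : Series A d} (hF : F ∈ grade A d i) (hG : G ∈ grade A d j) :
    F * G = sgn (i * j) • (G * F) := by
  funext N
  rw [zsmul_apply, mul_apply, mul_apply, Finset.smul_sum]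
  refine Finset.sum_equiv (Equiv.prodComm _ _) (fun p => by simp [add_comm]) fun p hp => ?_
  obtain ⟨K, L⟩ := p
  have hN := Finset.HasAntidiagonal.mem_antidiagonal.1 hp
  simp only [Equiv.prodComm_apply, Prod.swap_prod_mk] at hN ⊢
  have hm : IsMono d (K + L) := by rw [hN]; exact N.2
  have hK := ext0_mem hF K
  have hL := ext0_mem hG L
  rw [A.twist_of_mem _ hL, A.twist_of_mem _ hK, mul_smul_comm, mul_smul_comm, A.comm hK hL]
  simp only [smul_smul, ← sgn_add]
  congr 1
  apply sgn_congr
  have h1 := mswap_swap hm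
  obtain ⟨q, hq⟩ := h1
  refine ⟨q - mswap d L K - mdeg d L * i + mdeg d K * mdeg d L, ?_⟩
  have : mswap d K L = q + q + mdeg d K * mdeg d L - mswap d L K := by linarith
  rw [this]
  ring

theorem gr_indep : iSupIndep (grade A d) := by
  intro k
  rw [Submodule.disjoint_def]
  intro F hF hF'
  funext N
  have hA : iSupIndep A.gr :=
    ((DirectSum.isInternal_submodule_iff_iSupIndep_and_iSup_eq_top _).1 A.internal).1
  refine Submodule.disjoint_def.1 (hA (k - mdeg d N.1)) _ (hF N) ?_
  let ev : Series A d →ₗ[ℝ] A := LinearMap.proj N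
  have h1 := Submodule.mem_map_of_mem (f := ev) hF'
  simp only [Submodule.map_iSup] at h1
  have key : (⨆ j, ⨆ (_ : j ≠ k), Submodule.map ev (grade A d j)) ≤
      ⨆ j, ⨆ (_ : j ≠ k - mdeg d N.1), A.gr j := by
    refine iSup₂_le fun j hj => ?_
    refine le_trans ?_ (le_iSup₂ (j - mdeg d N.1) (by intro h; apply hj; linarith))
    rintro _ ⟨G, hG, rfl⟩
    exact hG N
  exact key h1

end Series

/-- `A⟦ξ⟧`: formal power series in graded-commuting variables `ξ_i` of degree `d i` with
coefficients in `A`; an element of degree `k` is an arbitrary family of coefficients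
`a_K ∈ A^(k - |ξ^K|)`, and a general element is a finite sum of homogeneous ones. -/
def formal : GrAlg.{u} :=
  ofFamily (Series A d) (Series.grade A d)
    (by
      intro N
      change (if N.1 = 0 then (1 : A) else 0) ∈ _
      split_ifs with h
      · rw [h, mdeg_zero]; exact A.one_mem
      · exact zero_mem _)
    Series.gr_mul Series.gr_indep Series.gr_comm

theorem Series.single_apply {A : GrAlg.{u}} {d : Fin r → ℤ} (K : Fin r →₀ ℕ) (a : A) (N)
    [Decidable (N.1 = K)] : (Series.single K a : Series A d) N = if N.1 = K then a else 0 := by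
  unfold Series.single
  congr

theorem Series.single_add {A : GrAlg.{u}} {d : Fin r → ℤ} (K : Fin r →₀ ℕ) (a b : A) :
    (Series.single K (a + b) : Series A d) = Series.single K a + Series.single K b := by
  classical
  funext N
  simp only [Series.add_apply, Series.single_apply]
  split_ifs <;> simp

theorem Series.single_smul {A : GrAlg.{u}} {d : Fin r → ℤ} (K : Fin r →₀ ℕ) (c : ℝ) (a : A) :
    (Series.single K (c • a) : Series A d) = c • Series.single K a := by
  classical
  funext N
  simp only [Series.smul_apply, Series.single_apply]
  split_ifs <;> simp

theorem Series.single_mem {A : GrAlg.{u}} {d : Fin r → ℤ} (K : Fin r →₀ ℕ) {i : ℤ} {a : A}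
    (ha : a ∈ A.gr i) : (Series.single K a : Series A d) ∈ Series.grade A d (i + mdeg d K) := by
  classical
  intro N
  rw [Series.single_apply]
  split_ifs with h
  · rw [h]; simpa using ha
  · exact zero_mem _

theorem Series.single_mem_iSup {A : GrAlg.{u}} {d : Fin r → ℤ} (K : Fin r →₀ ℕ) (a : A) :
    (Series.single K a : Series A d) ∈ ⨆ k, Series.grade A d k := by
  refine A.homogeneous_induction (P := fun a => (Series.single K a : Series A d) ∈ ⨆ k, Series.grade A d k)
    ?_ (fun a b ha hb => ?_) (fun i a ha => ?_) a
  · have := Series.single_smul (A := A) (d := d) K 0 0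
    rw [zero_smul, zero_smul] at this
    rw [this]; exact zero_mem _
  · rw [Series.single_add]; exact add_mem ha hb
  · exact Submodule.mem_iSup_of_mem _ (Series.single_mem K ha)

theorem Series.single_zero_mul {A : GrAlg.{u}} {d : Fin r → ℤ} (a b : A) :
    (Series.single 0 (a * b) : Series A d) = Series.single 0 a * Series.single 0 b := by
  classical
  have hz : ∀ (a : A) K, (Series.single 0 a : Series A d).ext0 K = if K = 0 then a else 0 := by
    intro a K
    by_cases h : IsMono d K
    · rw [Series.ext0_of _ h, Series.single_apply]
    · rw [Series.ext0, dif_neg h, if_neg]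
      rintro rfl
      exact h Series.isMono_zero
  funext N
  rw [Series.single_apply, Series.mul_apply, Finset.sum_eq_single (0, N.1)]
  · simp only [hz, mswap_zero_left, mdeg_zero, sgn_zero, A.twist_zero, if_true, one_smul]
    split_ifs <;> simp
  · rintro ⟨K, L⟩ hp hne
    have hK : K ≠ 0 := by
      rintro rfl
      apply hne
      simp only [Finset.HasAntidiagonal.mem_antidiagonal, zero_add] at hp
      rw [hp]
    simp [hz, hK]
  · intro h
    simp at h

/-- The term `a ξ^K` of `A⟦ξ⟧` (zero if an odd variable is repeated in `K`). -/
def term (K : Fin r →₀ ℕ) (a : A) : formal A d := ⟨Series.single K a, Series.single_mem_iSup K a⟩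

/-- The inclusion `A → A⟦ξ⟧` of the constant series. -/
def const : Hom A (formal A d) where
  toAlgHom := AlgHom.ofLinearMap
    { toFun := fun a => term A d 0 a
      map_add' := fun a b => Subtype.ext (Series.single_add 0 a b)
      map_smul' := fun c a => Subtype.ext (Series.single_smul 0 c a) }
    rfl (fun a b => Subtype.ext (Series.single_zero_mul a b))
  map_gr := by
    intro i a ha
    have := Series.single_mem (d := d) 0 ha
    rwa [mdeg_zero, add_zero] at this

/-- The variable `ξ_i` of `A⟦ξ⟧`. -/
def var (i : Fin r) : formal A d := term A d (Finsupp.single i 1) 1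

/-- The homomorphism `A⟦ξ⟧ → B⟦ξ⟧` applying `φ` to the coefficients. -/
def Hom.formalMap {A : GrAlg.{u}} {B : GrAlg.{v}} (φ : Hom A B) (d : Fin r → ℤ) :
    Hom (formal A d) (formal B d) :=
  let m : Series A d →ₗ[ℝ] Series B d :=
    { toFun := fun F N => φ (F N)
      map_add' := fun F G => by funext N; exact map_add φ.toAlgHom _ _
      map_smul' := fun c F => by funext N; exact map_smul φ.toAlgHom _ _ }
  have hm : ∀ {k : ℤ} {F : Series A d}, F ∈ Series.grade A d k → m F ∈ Series.grade B d k :=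
    fun hF N => φ.map_gr (hF N)
  have hS : ∀ F ∈ ⨆ k, Series.grade A d k, m F ∈ ⨆ k, Series.grade B d k := by
    intro F hF
    refine Submodule.iSup_induction _ (motive := fun F => m F ∈ ⨆ k, Series.grade B d k) hF
      (fun k F hF => Submodule.mem_iSup_of_mem k (hm hF)) (by rw [map_zero]; exact zero_mem _)
      (fun F G h1 h2 => by rw [map_add]; exact add_mem h1 h2)
  have hext : ∀ (F : Series A d) K, (m F).ext0 K = φ (F.ext0 K) := by
    intro F K
    by_cases h : IsMono d K
    · rw [Series.ext0_of _ h, Series.ext0_of _ h]; rfl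
    · simp [Series.ext0, h]
  { toAlgHom := AlgHom.ofLinearMap
      { toFun := fun F => ⟨m F.1, hS F.1 F.2⟩
        map_add' := fun F G => Subtype.ext (map_add m F.1 G.1)
        map_smul' := fun c F => Subtype.ext (map_smul m c F.1) }
      (by
        classical
        refine Subtype.ext (funext fun N => ?_)
        change φ ((Series.single 0 1 : Series A d) N) = (Series.single 0 1 : Series B d) N
        rw [Series.single_apply, Series.single_apply]
        split_ifs <;> simp)
      (by
        intro F G
        refine Subtype.ext (funext fun N => ?_)
        change φ ((F.1 * G.1) N) = (m F.1 * m G.1) N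
        rw [Series.mul_apply, Series.mul_apply, map_sum]
        refine Finset.sum_congr rfl fun p _ => ?_
        rw [map_zsmul, map_mul, hext, hext, twist_map])
    map_gr := fun hF => hm hF }

end Series

/-! ### Vector fields and differential forms -/

/-- Vector fields of degree `k`: derivations of the graded algebra of functions,
`X (a b) = X(a) b + (-1)^(k|a|) a X(b)`. -/
def Vect (A : GrAlg.{u}) (k : ℤ) : Submodule ℝ (A →ₗ[ℝ] A) where
  carrier := {X | (∀ i, ∀ a ∈ A.gr i, X a ∈ A.gr (i + k)) ∧
    ∀ i, ∀ a ∈ A.gr i, ∀ b, X (a * b) = X a * b + sgn (k * i) • (a * X b)}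
  add_mem' := by
    rintro X Y ⟨hX, hX'⟩ ⟨hY, hY'⟩
    refine ⟨fun i a ha => add_mem (hX i a ha) (hY i a ha), fun i a ha b => ?_⟩
    simp only [LinearMap.add_apply, hX' i a ha b, hY' i a ha b, add_mul, mul_add, smul_add]
    abel
  zero_mem' := ⟨fun i a ha => zero_mem _, fun i a ha b => by simp⟩
  smul_mem' := by
    rintro c X ⟨hX, hX'⟩
    refine ⟨fun i a ha => (A.gr _).smul_mem c (hX i a ha), fun i a ha b => ?_⟩
    simp only [LinearMap.smul_apply, hX' i a ha b, smul_add, smul_mul_assoc, mul_smul_comm]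
    rw [smul_comm]

variable {A : GrAlg.{u}}

instance (k : ℤ) : CoeFun (Vect A k) (fun _ => A → A) := ⟨fun X => X.1⟩

/-- The graded commutator `[X, Y] = X Y - (-1)^(|X||Y|) Y X`. -/
def bracket {k l : ℤ} (X : Vect A k) (Y : Vect A l) : Vect A (k + l) :=
  ⟨X.1 ∘ₗ Y.1 - sgn (k * l) • (Y.1 ∘ₗ X.1), by
    obtain ⟨X, hX, hX'⟩ := X
    obtain ⟨Y, hY, hY'⟩ := Y
    constructor
    · intro i a ha
      simp only [LinearMap.sub_apply, LinearMap.smul_apply, LinearMap.comp_apply]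
      refine sub_mem ?_ (zsmul_mem ?_ _)
      · convert hX _ _ (hY i a ha) using 2; ring
      · convert hY _ _ (hX i a ha) using 2; ring
    · intro i a ha b
      simp only [LinearMap.sub_apply, LinearMap.smul_apply, LinearMap.comp_apply]
      simp only [hY' i a ha, hX' i a ha, map_add, map_zsmul, hX' _ _ (hY i a ha), hY' _ _ (hX i a ha),
        sub_mul, mul_sub, smul_add, smul_sub, smul_smul, smul_mul_assoc, mul_smul_comm, mul_add, add_mul,
        sgn_add]
      have e := sgn_mul_self (k * l)
      rw [mul_comm l k, show sgn (k * l) * (sgn (l * i) * sgn (k * l)) = sgn (l * i) by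
          rw [mul_comm (sgn (l * i)), ← mul_assoc, e, one_mul],
        show sgn (k * l) * (sgn (k * i) * sgn (l * i)) = sgn (k * i) * sgn (l * i) * sgn (k * l) by ring,
        mul_comm (sgn (k * l)) (sgn (k * i)), mul_comm (sgn (l * i)) (sgn (k * i))]
      abel⟩

/-- Maps eating `p` homogeneous vector fields; a differential form `η` is recorded by its
contractions `(X₁, …, X_p) ↦ i_{X_p} ⋯ i_{X₁} η`, one vector field at a time. -/
def Form (A : GrAlg.{u}) : ℕ → Type u
  | 0 => A
  | p + 1 => ∀ k : ℤ, Vect A k → Form A p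

instance Form.instAddCommGroup (A : GrAlg.{u}) : ∀ p : ℕ, AddCommGroup (Form A p)
  | 0 => inferInstanceAs (AddCommGroup A)
  | p + 1 =>
    have := Form.instAddCommGroup A p
    inferInstanceAs (AddCommGroup (∀ k : ℤ, Vect A k → Form A p))

/-- Contraction `i_X`. -/
def contract {p : ℕ} {k : ℤ} (X : Vect A k) (η : Form A (p + 1)) : Form A p := η k X

/-- Lie derivative, determined by `L_X a = X a` on functions and
`[L_X, i_Y] = i_{[X, Y]}`, i.e. `i_Y L_X = (-1)^(|X|(|Y|+1)) (L_X i_Y - i_{[X,Y]})`. -/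
def lie {k : ℤ} (X : Vect A k) : ∀ {p : ℕ}, Form A p → Form A p
  | 0, a => X.1 a
  | _ + 1, η => fun l Y => sgn (k * (l + 1)) • (lie X (η l Y) - η (k + l) (bracket X Y))

/-- De Rham differential, determined by Cartan's formula `i_X d = L_X - (-1)^|X| d i_X`. -/
def diff : ∀ {p : ℕ}, Form A p → Form A (p + 1)
  | 0, a => fun _ X => X.1 a
  | _ + 1, η => fun k X => lie X η - sgn k • diff (η k X)

/-- The one-form `a dg`, for `a` of degree `i`; `i_X (a dg) = (-1)^((|X|+1) i) a X(g)`. -/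
def oneForm (i : ℤ) (a g : A) : Form A 1 := fun k X => (sgn ((k + 1) * i) • (a * X.1 g) : A)

/-- The two-form `a dg dh`, for `a`, `g` of degrees `i`, `j`. -/
def twoForm (i : ℤ) (a : A) (j : ℤ) (g h : A) : Form A 2 := fun k Y l X =>
  (sgn ((k + l) * i) • (a * (sgn ((l + 1) * (j + k)) • (Y.1 g * X.1 h)
    + sgn ((k + 1) * (j + 1)) • (X.1 g * Y.1 h))) : A)

/-- One-forms of degree `m`: sums of `a dg`. -/
def Omega1 (A : GrAlg.{u}) (m : ℤ) : AddSubgroup (Form A 1) :=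
  AddSubgroup.closure {η | ∃ i j : ℤ, ∃ a ∈ A.gr i, ∃ g ∈ A.gr j, i + j = m ∧ η = oneForm i a g}

/-- Two-forms of degree `m`: sums of `a dg dh`. -/
def Omega2 (A : GrAlg.{u}) (m : ℤ) : AddSubgroup (Form A 2) :=
  AddSubgroup.closure {η | ∃ i j l : ℤ, ∃ a ∈ A.gr i, ∃ g ∈ A.gr j, ∃ h ∈ A.gr l,
    i + j + l = m ∧ η = twoForm i a j g h}

section Ideal

variable {B : GrAlg.{v}}

/-- One-forms of degree `m` in the ideal generated by the forms `π^* α`, where `α` is a form of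
positive form degree on the base: sums of `a π^*(db)`. -/
def Ideal1 (π : Hom B A) (m : ℤ) : AddSubgroup (Form A 1) :=
  AddSubgroup.closure {η | ∃ i j : ℤ, ∃ a ∈ A.gr i, ∃ b ∈ B.gr j, i + j = m ∧ η = oneForm i a (π b)}

/-- Two-forms of degree `m` in this ideal: sums of `a dg π^*(db)`. -/
def Ideal2 (π : Hom B A) (m : ℤ) : AddSubgroup (Form A 2) :=
  AddSubgroup.closure {η | ∃ i j l : ℤ, ∃ a ∈ A.gr i, ∃ g ∈ A.gr j, ∃ b ∈ B.gr l,
    i + j + l = m ∧ η = twoForm i a j g (π b)}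

end Ideal
end GrAlg

/-! ### Functions on `T[1]X`: the algebra of differential forms on `X` -/

section ShiftedTangent

/-- The exterior algebra of the cotangent space (the tangent spaces of `X` are `ℝⁿ`). -/
abbrev CotExt (n : ℕ) : Type := ExteriorAlgebra ℝ (EuclideanSpace ℝ (Fin n) →L[ℝ] ℝ)

theorem exteriorPower_comm {V : Type*} [AddCommGroup V] [Module ℝ V] {p q : ℕ}
    {x y : ExteriorAlgebra ℝ V} (hx : x ∈ ⋀[ℝ]^p V) (hy : y ∈ ⋀[ℝ]^q V) :
    x * y = sgn ((p : ℤ) * q) • (y * x) := by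
  have h1 : ∀ m ∈ LinearMap.range (ExteriorAlgebra.ι ℝ (M := V)), m * y = sgn (q : ℤ) • (y * m) := by
    rintro _ ⟨v, rfl⟩
    induction hy using Submodule.pow_induction_on_left' with
    | algebraMap c => simp [sgn_zero, Algebra.commutes]
    | add a b i ha hb h h' => rw [mul_add, add_mul, smul_add, h, h']
    | mem_mul m hm i a ha h =>
      obtain ⟨w, rfl⟩ := hm
      have e : ExteriorAlgebra.ι ℝ v * ExteriorAlgebra.ι ℝ w
          = - (ExteriorAlgebra.ι ℝ w * ExteriorAlgebra.ι ℝ v) :=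
        eq_neg_of_add_eq_zero_left (ExteriorAlgebra.ι_add_mul_swap v w)
      rw [← mul_assoc, e, neg_mul, mul_assoc, h, mul_smul_comm, ← mul_assoc, Nat.cast_succ, sgn_add,
        sgn_odd odd_one]
      simp
  induction hx using Submodule.pow_induction_on_left' with
  | algebraMap c => simp [sgn_zero, Algebra.commutes]
  | add a b i ha hb h h' => rw [mul_add, add_mul, smul_add, h, h']
  | mem_mul m hm i a ha h =>
    rw [mul_assoc, h, mul_smul_comm, ← mul_assoc, h1 m hm, smul_mul_assoc, smul_smul, mul_assoc,
      ← sgn_add, Nat.cast_succ, add_mul, one_mul]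

variable (n : ℕ) (X : Type u) [TopologicalSpace X] [ChartedSpace (EuclideanSpace ℝ (Fin n)) X]

/-- The differential of `f` at `x`; `T_x X` is definitionally `ℝⁿ`. -/
def diffAt {n : ℕ} {X : Type u} [TopologicalSpace X] [ChartedSpace (EuclideanSpace ℝ (Fin n)) X]
    (f : C^∞⟮𝓡 n, X; ℝ⟯) (x : X) : EuclideanSpace ℝ (Fin n) →L[ℝ] ℝ :=
  mfderiv (𝓡 n) 𝓘(ℝ) f x

/-- Finite sums of `f dg₁ ∧ ⋯ ∧ dg_p` with `f, g_i` smooth and `p = k` (none if `k < 0`). -/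
def formSpan (k : ℤ) : Submodule ℝ (X → CotExt n) :=
  Submodule.span ℝ {α | ∃ p : ℕ, (p : ℤ) = k ∧ ∃ (f : C^∞⟮𝓡 n, X; ℝ⟯) (g : Fin p → C^∞⟮𝓡 n, X; ℝ⟯),
    α = fun x => f x • ExteriorAlgebra.ιMulti ℝ p (fun i => diffAt (g i) x)}

/-- Differential forms of degree `k` on `X`: sections of the exterior powers of the cotangent
bundle which near every point are sums of `f dg₁ ∧ ⋯ ∧ dg_k`. -/
def smoothForms (k : ℤ) : Submodule ℝ (X → CotExt n) where
  carrier := {α | ∀ x, ∃ η ∈ formSpan n X k, ∀ᶠ y in nhds x, α y = η y}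
  add_mem' := by
    intro a b ha hb x
    obtain ⟨η, hη, h⟩ := ha x
    obtain ⟨η', hη', h'⟩ := hb x
    refine ⟨η + η', add_mem hη hη', ?_⟩
    filter_upwards [h, h'] with y h1 h2
    rw [Pi.add_apply, Pi.add_apply, h1, h2]
  zero_mem' := fun x => ⟨0, zero_mem _, Filter.Eventually.of_forall fun _ => rfl⟩
  smul_mem' := by
    intro c a ha x
    obtain ⟨η, hη, h⟩ := ha x
    refine ⟨c • η, Submodule.smul_mem _ c hη, ?_⟩
    filter_upwards [h] with y h1
    rw [Pi.smul_apply, Pi.smul_apply, h1]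

variable {n X}

theorem formSpan_mul {i j : ℤ} {a b : X → CotExt n} (ha : a ∈ formSpan n X i) (hb : b ∈ formSpan n X j) :
    a * b ∈ formSpan n X (i + j) := by
  have := Submodule.mul_mem_mul ha hb
  rw [formSpan, formSpan, Submodule.span_mul_span] at this
  refine Submodule.span_le.2 ?_ this
  rintro _ ⟨_, ⟨p, rfl, f, g, rfl⟩, _, ⟨q, rfl, f', g', rfl⟩, rfl⟩
  refine Submodule.subset_span ⟨p + q, by push_cast; rfl, f * f', Fin.append g g', ?_⟩
  funext x
  simp only [Pi.mul_apply]
  rw [smul_mul_smul_comm, ExteriorAlgebra.ιMulti_mul_ιMulti]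
  change _ = (f x * f' x) • _
  congr 2
  funext k
  refine Fin.addCases (fun l => ?_) (fun l => ?_) k <;> simp

theorem formSpan_pointwise {k : ℤ} {a : X → CotExt n} (ha : a ∈ formSpan n X k) (x : X) :
    a x ∈ (⨆ p : ℕ, ⨆ (_ : (p : ℤ) = k), ⋀[ℝ]^p (EuclideanSpace ℝ (Fin n) →L[ℝ] ℝ)) := by
  let ev : (X → CotExt n) →ₗ[ℝ] CotExt n := LinearMap.proj x
  have h1 := Submodule.mem_map_of_mem (f := ev) ha
  rw [formSpan, Submodule.map_span] at h1
  refine Submodule.span_le.2 ?_ h1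
  rintro _ ⟨_, ⟨p, hp, f, g, rfl⟩, rfl⟩
  refine Submodule.mem_iSup_of_mem p (Submodule.mem_iSup_of_mem hp ?_)
  exact Submodule.smul_mem _ _ (ExteriorAlgebra.ιMulti_range ℝ p ⟨_, rfl⟩)

theorem smoothForms_pointwise {k : ℤ} {a : X → CotExt n} (ha : a ∈ smoothForms n X k) (x : X) :
    (k < 0 ∧ a x = 0) ∨ ∃ p : ℕ, (p : ℤ) = k ∧ a x ∈ ⋀[ℝ]^p (EuclideanSpace ℝ (Fin n) →L[ℝ] ℝ) := by
  obtain ⟨η, hη, h⟩ := ha x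
  have h2 := formSpan_pointwise hη x
  rw [← h.self_of_nhds] at h2
  rcases lt_or_ge k 0 with hk | hk
  · refine Or.inl ⟨hk, ?_⟩
    have : (⨆ p : ℕ, ⨆ (_ : (p : ℤ) = k), ⋀[ℝ]^p (EuclideanSpace ℝ (Fin n) →L[ℝ] ℝ)) = ⊥ := by
      simp only [iSup_eq_bot]
      intro p hp
      omega
    rw [this] at h2
    simpa using h2
  · obtain ⟨p, rfl⟩ := Int.eq_ofNat_of_zero_le hk
    refine Or.inr ⟨p, rfl, ?_⟩
    refine (iSup₂_le fun q hq => ?_ : (⨆ q : ℕ, ⨆ (_ : (q : ℤ) = p),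
      ⋀[ℝ]^q (EuclideanSpace ℝ (Fin n) →L[ℝ] ℝ)) ≤ ⋀[ℝ]^p (EuclideanSpace ℝ (Fin n) →L[ℝ] ℝ)) h2
    have : q = p := by exact_mod_cast hq
    rw [this]

variable (n X)

/-- The graded algebra `C^∞(T[1]X) = Ω(X)`. -/
def functionsT1 : GrAlg.{u} :=
  GrAlg.ofFamily (X → CotExt n) (smoothForms n X)
    (by
      intro x
      refine ⟨1, Submodule.subset_span ⟨0, rfl, 1, Fin.elim0, ?_⟩, Filter.Eventually.of_forall fun _ => rfl⟩
      funext y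
      simp)
    (by
      intro i j a b ha hb x
      obtain ⟨η, hη, h⟩ := ha x
      obtain ⟨η', hη', h'⟩ := hb x
      refine ⟨η * η', formSpan_mul hη hη', ?_⟩
      filter_upwards [h, h'] with y h1 h2
      rw [Pi.mul_apply, Pi.mul_apply, h1, h2])
    (by
      intro k
      rw [Submodule.disjoint_def]
      intro α hα hα'
      funext x
      rcases smoothForms_pointwise hα x with ⟨_, h⟩ | ⟨p, rfl, h⟩
      · exact h
      · let pr : (X → CotExt n) →ₗ[ℝ] CotExt n :=
          (GradedAlgebra.proj (fun i : ℕ => ⋀[ℝ]^i (EuclideanSpace ℝ (Fin n) →L[ℝ] ℝ)) p) ∘ₗ LinearMap.proj x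
        have h1 : pr α = α x := by
          simp only [pr, LinearMap.comp_apply, LinearMap.proj_apply, GradedAlgebra.proj_apply]
          exact DirectSum.decompose_of_mem_same _ h
        have h2 : (⨆ j, ⨆ (_ : j ≠ (p : ℤ)), smoothForms n X j) ≤ LinearMap.ker pr := by
          refine iSup₂_le fun j hj η hη => ?_
          rw [LinearMap.mem_ker]
          simp only [pr, LinearMap.comp_apply, LinearMap.proj_apply, GradedAlgebra.proj_apply]
          rcases smoothForms_pointwise hη x with ⟨_, h⟩ | ⟨q, rfl, h⟩
          · rw [h, DirectSum.decompose_zero]; rfl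
          · exact DirectSum.decompose_of_mem_ne _ h (by exact_mod_cast hj)
        rw [← h1]
        exact h2 hα')
    (by
      intro i j a b ha hb
      funext x
      change a x * b x = sgn (i * j) • (b x * a x)
      rcases smoothForms_pointwise ha x with ⟨_, h⟩ | ⟨p, rfl, h⟩
      · simp [h]
      · rcases smoothForms_pointwise hb x with ⟨_, h'⟩ | ⟨q, rfl, h'⟩
        · simp [h']
        · exact exteriorPower_comm h h')

variable {n X}

theorem mem_iSup_of_formSpan {k : ℤ} {α : X → CotExt n} (h : α ∈ formSpan n X k) :
    α ∈ ⨆ k, smoothForms n X k :=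
  Submodule.mem_iSup_of_mem k fun _ => ⟨α, h, Filter.Eventually.of_forall fun _ => rfl⟩

/-- A smooth function on `X` as a function on `T[1]X`. -/
def funT1 (f : C^∞⟮𝓡 n, X; ℝ⟯) : functionsT1 n X :=
  ⟨fun x => f x • 1, mem_iSup_of_formSpan (k := 0) (Submodule.subset_span
    ⟨0, rfl, f, Fin.elim0, by funext x; simp⟩)⟩

/-- The differential `df` of a smooth function on `X` as a function on `T[1]X`. -/
def dfunT1 (f : C^∞⟮𝓡 n, X; ℝ⟯) : functionsT1 n X :=
  ⟨fun x => ExteriorAlgebra.ιMulti ℝ 1 (fun _ => diffAt f x),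
    mem_iSup_of_formSpan (k := 1) (Submodule.subset_span
    ⟨1, rfl, 1, fun _ => f, by funext x; exact (one_smul ℝ _).symm⟩)⟩

/-- `dX` is the de Rham differential, seen as a vector field of degree `1` on `T[1]X`: the unique
derivation that squares to zero and takes a function `f` on `X` to its differential. -/
def IsDeRham (dX : GrAlg.Vect (functionsT1 n X) 1) : Prop :=
  (∀ f : C^∞⟮𝓡 n, X; ℝ⟯, dX (funT1 f) = dfunT1 f) ∧ ∀ a, dX (dX a) = 0

end ShiftedTangent

/-! ### Graded manifolds and graded bundles over `T[1]X` -/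

section Geometry

open TopologicalSpace

/-- A homomorphism of commutative algebras as a homomorphism of graded algebras. -/
def GrAlg.ofCommMap {R : Type u} {S : Type v} [CommRing R] [Algebra ℝ R] [CommRing S] [Algebra ℝ S]
    (φ : R →ₐ[ℝ] S) : GrAlg.Hom (GrAlg.ofComm R) (GrAlg.ofComm S) where
  toAlgHom := φ
  map_gr := by
    intro i a ha
    change a ∈ (if i = 0 then (⊤ : Submodule ℝ R) else ⊥) at ha
    change φ a ∈ (if i = 0 then (⊤ : Submodule ℝ S) else ⊥)
    split_ifs with h
    · trivial
    · rw [if_neg h] at ha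
      have h0 : φ a = 0 := by
        rw [show (a : R) = 0 from (Submodule.mem_bot ℝ).1 ha]
        exact map_zero φ
      exact (Submodule.mem_bot ℝ).2 h0

/-- A sheaf of graded algebras; the gluing axiom is imposed in each degree. -/
structure GrSheaf (M : Type w) [TopologicalSpace M] where
  O : Opens M → GrAlg.{u}
  res : ∀ {U V : Opens M}, U ≤ V → GrAlg.Hom (O V) (O U)
  res_self : ∀ {U : Opens M} (a : O U), res (le_refl U) a = a
  res_res : ∀ {U V W : Opens M} (h : U ≤ V) (h' : V ≤ W) (a : O W),
    res h (res h' a) = res (h.trans h') a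
  glue : ∀ {ι : Type w} (U : ι → Opens M) (k : ℤ) (f : ∀ i, O (U i)),
    (∀ i, f i ∈ (O (U i)).gr k) →
    (∀ i j, res (inf_le_left : U i ⊓ U j ≤ U i) (f i) = res (inf_le_right : U i ⊓ U j ≤ U j) (f j)) →
    ∃! g : O (⨆ i, U i), g ∈ (O (⨆ i, U i)).gr k ∧ ∀ i, res (le_iSup U i) g = f i

variable {m : ℕ} {M : Type w} [TopologicalSpace M] [ChartedSpace (EuclideanSpace ℝ (Fin m)) M]

/-- The local model of a graded manifold: `C^∞(V)⟦ξ⟧` with `ξ_i` of degree `d i`. -/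
def localModel (m : ℕ) {M : Type w} [TopologicalSpace M] [ChartedSpace (EuclideanSpace ℝ (Fin m)) M]
    {r : ℕ} (d : Fin r → ℤ) (V : Opens M) : GrAlg.{w} :=
  GrAlg.formal (GrAlg.ofComm C^∞⟮𝓡 m, V; ℝ⟯) d

/-- Restriction of smooth functions. -/
def restrictSmooth (m : ℕ) {M : Type w} [TopologicalSpace M] [ChartedSpace (EuclideanSpace ℝ (Fin m)) M]
    {U V : Opens M} (h : U ≤ V) : C^∞⟮𝓡 m, V; ℝ⟯ →ₐ[ℝ] C^∞⟮𝓡 m, U; ℝ⟯ :=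
  { ContMDiffMap.restrictRingHom (𝓡 m) 𝓘(ℝ) ℝ h with commutes' := fun _ => rfl }

/-- Restriction in the local model, applied to the coefficients of the series. -/
def localModelRes (m : ℕ) {M : Type w} [TopologicalSpace M] [ChartedSpace (EuclideanSpace ℝ (Fin m)) M]
    {r : ℕ} (d : Fin r → ℤ) {U V : Opens M} (h : U ≤ V) :
    GrAlg.Hom (localModel m d V) (localModel m d U) :=
  (GrAlg.ofCommMap (restrictSmooth m h)).formalMap d

/-- An isomorphism over `W` of a sheaf of graded algebras with the local model. -/
structure GrChart (m : ℕ) {M : Type w} [TopologicalSpace M] [ChartedSpace (EuclideanSpace ℝ (Fin m)) M]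
    (F : GrSheaf.{u} M) {r : ℕ} (d : Fin r → ℤ) (W : Opens M) where
  map : ∀ V : Opens M, V ≤ W → GrAlg.Hom (F.O V) (localModel m d V)
  bijective : ∀ V hV, Function.Bijective (map V hV)
  natural : ∀ {U V : Opens M} (h : U ≤ V) (hV : V ≤ W) (a : F.O V),
    map U (h.trans hV) (F.res h a) = localModelRes m d h (map V hV a)

/-- A graded manifold `E` with body `M`, together with a projection `π : E → T[1]X` that is a
surjective submersion with connected fibres (every fibre bundle with nonempty connected fibres is
of this form). `body` is the induced map `M → X` and `pull` is `π^*`. Near every point of `M`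
there are coordinates of `E` that consist of coordinates of `M`, of the coordinates `θ^a = dx^a` of
`T[1]X` for functions `x^a` on `X` that are coordinates near the image point, and of further
coordinates of degrees `deg`. -/
structure GradedBundle (n : ℕ) (X : Type v) [TopologicalSpace X]
    [ChartedSpace (EuclideanSpace ℝ (Fin n)) X] (m : ℕ) (M : Type w) [TopologicalSpace M]
    [ChartedSpace (EuclideanSpace ℝ (Fin m)) M] where
  sheaf : GrSheaf.{u} M
  body : C^∞⟮𝓡 m, M; 𝓡 n, X⟯
  submersion : ∀ p, Function.Surjective (mfderiv (𝓡 m) (𝓡 n) body p)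
  fibres_connected : ∀ x, IsConnected (body ⁻¹' {x})
  pull : GrAlg.Hom (functionsT1 n X) (sheaf.O ⊤)
  rank : ℕ
  deg : Fin rank → ℤ
  deg_ne_zero : ∀ i, deg i ≠ 0
  charts : ∀ p : M, ∃ W : Opens M, p ∈ W ∧
    ∃ Φ : GrChart m sheaf (Fin.append (fun _ : Fin n => (1 : ℤ)) deg) W,
    ∃ x : Fin n → C^∞⟮𝓡 n, X; ℝ⟯, LinearIndependent ℝ (fun a => diffAt (x a) (body p)) ∧
      (∀ f : C^∞⟮𝓡 n, X; ℝ⟯, Φ.map W le_rfl (sheaf.res le_top (pull (funT1 f))) =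
        GrAlg.const (GrAlg.ofComm C^∞⟮𝓡 m, W; ℝ⟯) (Fin.append (fun _ : Fin n => (1 : ℤ)) deg)
          ⟨fun q : W => f (body q.1),
            f.contMDiff.comp (body.contMDiff.comp contMDiff_subtype_val)⟩) ∧
      ∀ a, Φ.map W le_rfl (sheaf.res le_top (pull (dfunT1 (x a)))) =
        GrAlg.var (GrAlg.ofComm C^∞⟮𝓡 m, W; ℝ⟯) (Fin.append (fun _ : Fin n => (1 : ℤ)) deg)
          (Fin.castAdd rank a)

/-- The algebra of functions `C^∞(E)`. -/
abbrev GradedBundle.functions {n : ℕ} {X : Type v} [TopologicalSpace X]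
    [ChartedSpace (EuclideanSpace ℝ (Fin n)) X] {m : ℕ} {M : Type w} [TopologicalSpace M]
    [ChartedSpace (EuclideanSpace ℝ (Fin m)) M] (E : GradedBundle.{u} n X m M) : GrAlg.{u} :=
  E.sheaf.O ⊤

end Geometry

/-! ### Presymplectic gauge PDEs over a background, internal symmetries and currents

`π : B → A` is the pullback of functions along a projection `E → B`. -/

namespace GrAlg

variable {A : GrAlg.{u}} {B : GrAlg.{v}}

/-- The conditions on a presymplectic gauge PDE `E → B` other than the master equation: `D` is
homological on the base, `Q` is a lift of `D`, `om` is a closed two-form of degree `n - 1`, `L` has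
degree `n`, and `i_Q om + dL` lies in the ideal generated by the one-forms on the base. -/
structure IsPremaster (π : Hom B A) (D : Vect B 1) (Q : Vect A 1) (om : Form A 2) (L : A) (n : ℤ) :
    Prop where
  homological : ∀ b, D (D b) = 0
  projects : ∀ b, Q (π b) = π (D b)
  om_mem : om ∈ Omega2 A (n - 1)
  om_closed : diff om = 0
  L_mem : L ∈ A.gr n
  hamiltonian : contract Q om + diff (p := 0) L ∈ Ideal1 π n

/-- The function `i_Z i_Y om`. -/
def contract2 {k l : ℤ} (Z : Vect A l) (Y : Vect A k) (om : Form A 2) : A := contract Z (contract Y om)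

/-- The left hand side `½ i_Q i_Q om + Q L` of the presymplectic master equation. -/
def master (Q : Vect A 1) (om : Form A 2) (L : A) : A :=
  (1 / 2 : ℝ) • contract2 Q Q om + Q L

/-- A presymplectic gauge PDE over the background `(B, D)` (a background without a distribution,
`𝒦_B = 0`). For `B = T[1]X` and `D` the de Rham differential this is a presymplectic gauge PDE. -/
structure IsPresymplecticGPDE (π : Hom B A) (D : Vect B 1) (Q : Vect A 1) (om : Form A 2) (L : A)
    (n : ℤ) : Prop extends IsPremaster π D Q om L n where
  master_eq : master Q om L = 0

/-- Vertical vector fields. -/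
def IsVertical (π : Hom B A) {k : ℤ} (V : Vect A k) : Prop := ∀ b, V (π b) = 0

/-- The vertical kernel of a two-form `om` of degree `l`: vertical `Z` with `i_Z om` in the ideal. -/
def InVerticalKernel (π : Hom B A) (om : Form A 2) (l : ℤ) {k : ℤ} (Z : Vect A k) : Prop :=
  IsVertical π Z ∧ contract Z om ∈ Ideal1 π (l + k)

/-- Internal symmetries of a presymplectic gauge PDE: `L_V om ∈ ℐ` and `[V, Q] ∈ 𝒦`. -/
structure IsInternalSymmetry (π : Hom B A) (Q : Vect A 1) (om : Form A 2) (n : ℤ) {k : ℤ}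
    (V : Vect A k) : Prop where
  vertical : IsVertical π V
  lie_mem : lie V om ∈ Ideal2 π (n - 1 + k)
  bracket_mem : InVerticalKernel π om (n - 1) (bracket V Q)

/-- `J` is a conserved current associated to the internal symmetry `V`:
`i_V om + dJ ∈ ℐ`, `Q J = 0` and `𝒦 J = 0`. -/
structure IsCurrent (π : Hom B A) (Q : Vect A 1) (om : Form A 2) (n : ℤ) {k : ℤ} (V : Vect A k)
    (J : A) : Prop where
  mem : J ∈ A.gr (n - 1 + k)
  hamiltonian : contract V om + diff (p := 0) J ∈ Ideal1 π (n - 1 + k)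
  conserved : Q J = 0
  kernel : ∀ (l : ℤ) (Z : Vect A l), InVerticalKernel π om (n - 1) Z → Z J = 0

/-- The two-form `om'` is the pullback of `om` under the projection with pullback of functions `p`:
its values on projectable vector fields are the pullbacks of the values of `om`. -/
def IsPullback (p : Hom A B) (om : Form A 2) (om' : Form B 2) : Prop :=
  ∀ (k : ℤ) (Y : Vect A k) (Y' : Vect B k) (l : ℤ) (Z : Vect A l) (Z' : Vect B l),
    (∀ a, Y' (p a) = p (Y a)) → (∀ a, Z' (p a) = p (Z a)) →
    contract2 Z' Y' om' = p (contract2 Z Y om)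

/-- The first cohomology of `E` relative to the base vanishes: a one-form that is closed modulo the
ideal `ℐ` of the base is exact modulo `ℐ`. -/
def RelativeH1Vanishes (π : Hom B A) : Prop :=
  ∀ m : ℤ, ∀ α ∈ Omega1 A m, diff α ∈ Ideal2 π m → ∃ J ∈ A.gr m, α - diff (p := 0) J ∈ Ideal1 π m

end GrAlg

/-- The de Rham cohomology of `X` vanishes in positive degrees. -/
def DeRhamVanishes {n : ℕ} {X : Type u} [TopologicalSpace X]
    [ChartedSpace (EuclideanSpace ℝ (Fin n)) X] (dX : GrAlg.Vect (functionsT1 n X) 1) : Prop :=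
  ∀ p : ℤ, 1 ≤ p → ∀ η ∈ (functionsT1 n X).gr p, dX η = 0 →
    ∃ ζ ∈ (functionsT1 n X).gr (p - 1), dX ζ = η

/-- A finite-dimensional graded Lie algebra with a homogeneous basis `e_α` of degrees `deg α`,
given by its structure constants: `[e_α, e_β] = Σ_γ U α β γ e_γ`. -/
structure GradedLie (s : ℕ) where
  deg : Fin s → ℤ
  U : Fin s → Fin s → Fin s → ℝ
  degree : ∀ α β γ, U α β γ ≠ 0 → deg γ = deg α + deg β
  antisymm : ∀ α β γ, U α β γ = -((sgn (deg α * deg β) : ℝ) * U β α γ)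
  jacobi : ∀ α β γ ε, ∑ δ, U β γ δ * U α δ ε =
    ∑ δ, U α β δ * U δ γ ε + (sgn (deg α * deg β) : ℝ) * ∑ δ, U α γ δ * U β δ ε

namespace GradedLie

open GrAlg

variable {s : ℕ} (g : GradedLie s)

/-- The degrees of the coordinates `c^α` of `g[1]`. -/
def ghost (α : Fin s) : ℤ := 1 - g.deg α

/-- The algebra of functions on `E × g[1]`, where `A = C^∞(E)`. -/
abbrev adjoin (A : GrAlg.{u}) : GrAlg.{u} := formal A g.ghost

/-- The coordinate `c^α` on `E × g[1]`. -/
abbrev c (A : GrAlg.{u}) (α : Fin s) : g.adjoin A := var A g.ghost α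

/-- Pullback of functions along `E × g[1] → E`. -/
abbrev proj (A : GrAlg.{u}) : Hom A (g.adjoin A) := const A g.ghost

/-- Vector fields `V_α` of degrees `deg α` that represent the Lie algebra. -/
def IsRepresentation {A : GrAlg.{u}} (V : ∀ α, Vect A (g.deg α)) : Prop :=
  ∀ α β a, bracket (V α) (V β) a = ∑ γ, g.U α β γ • V γ a

/-- `d_g⁰ c^γ = -½ Σ ± U_{αβ}^γ c^α c^β` for an arbitrary family `c` in place of the coordinates;
the sign is `1` if the Lie algebra has degree `0`. -/
def quadratic {A : GrAlg.{u}} (c : Fin s → A) (γ : Fin s) : A :=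
  -((1 / 2 : ℝ) • ∑ α, ∑ β, ((sgn (g.deg α * (1 + g.deg β)) : ℝ) * g.U α β γ) • (c α * c β))

/-- `D' = D + d_g⁰` on `B × g[1]`: the action on generators. -/
def IsBackground {B : GrAlg.{u}} (D : Vect B 1) (D' : Vect (g.adjoin B) 1) : Prop :=
  (∀ b, D' (g.proj B b) = g.proj B (D b)) ∧ ∀ γ, D' (g.c B γ) = g.quadratic (g.c B) γ

/-- `Q' = Q + d_g = Q + d_g⁰ + c^α V_α` on `E × g[1]`: the action on generators. -/
def IsGauging {A : GrAlg.{u}} (Q : Vect A 1) (V : ∀ α, Vect A (g.deg α)) (Q' : Vect (g.adjoin A) 1) :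
    Prop :=
  (∀ a, Q' (g.proj A a) = g.proj A (Q a) + ∑ α, g.c A α * g.proj A (V α a)) ∧
    ∀ γ, Q' (g.c A γ) = g.quadratic (g.c A) γ

/-- `Σ_α (-1)^|V_α| c^α J_α` for elements `c^α`; it is `c^α J_α` in degree `0`. -/
def coupling {A : GrAlg.{u}} (c J : Fin s → A) : A :=
  ∑ α, sgn (g.deg α) • (c α * J α)

/-- `½ Σ ± c^α c^β f_{αβ}` for elements `c^α`; it is `½ c^α c^β f_{αβ}` in degree `0`. -/
def anomaly {A : GrAlg.{u}} (c : Fin s → A) (f : Fin s → Fin s → A) : A :=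
  (1 / 2 : ℝ) • ∑ α, ∑ β, sgn (g.deg β * (g.deg α + 1)) • (c α * c β * f α β)

end GradedLie

end

/-!
The theorem rests on a description of the functions that come from the base, and on Cartan calculus with the closed
form `ω`.

*Vertical vector fields detect functions of the base.* A function on `E` that is annihilated by all vertical
vector fields is the pullback of a form on `X` (`GradedBundle.exists_pull_eq_of_vertical`). In a chart the
derivatives along the graded fibre coordinates, and along the fibres of the submersion of bodies, are vertical, and
after multiplication by a bump function they extend to all of `E`. So the coefficients of the function depend on the
point of `X` only, which gives forms near every point; they agree along the fibres because the fibres are connected.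
The pullback `π^*` is injective (`GradedBundle.pull_injective`).

*Conserved currents.* The relative cohomology provides `J` with `i_V ω + dJ` in the ideal of the base. Evaluation of
`dω = 0` on `V`, `Q` and a vertical field shows that `QJ` is annihilated by vertical fields
(`GrAlg.IsPremaster.vertical_apply_apply`), and evaluation on `Q`, `Q`, `V` together with the master equation gives
`Q²J = 0`. Hence `QJ` is the pullback of a closed form `h` on `X` of degree `n + |V| ≠ 0`, which is exact or zero,
and `J` minus the pullback of a primitive is conserved (`exists_isCurrent`). In the same way `L_V ω` in the ideal shows
that the defect `± V_α J_β - U J` is annihilated by vertical fields, hence is the pullback of a form `f`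
(`exists_defect`).

*Gauging.* Let `ω'` be the pullback of `ω`. The vector field `Q' = Q + c^α V_α + d_g⁰` is hamiltonian for `ω'`, up to
the ideal of the base, with hamiltonian `L - Σ ± c^α J_α`: contraction is linear in vector fields along the projection,
and the terms with `dc` lie in the ideal (`GradedLie.hamiltonian_gauging`). Expansion of the master equation leaves
exactly the anomaly (`GradedLie.master_gauging`). Both statements concern a homomorphism `p` of algebras of functions
and elements `c` of the right degrees. They serve for the projection `E × g[1] → E`, and for the identity of `E` with
`c` a flat background field. The pullback of `ω` is closed because vector fields along the projection are, order by order in the `c`,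
combinations of vector fields on `E` (`GrAlg.eq_zero_of_lmul_var`). The vector field `d_X + d_g⁰` on the base is
homological by the Jacobi identity (`GradedLie.cubic_eq_zero`).

*The anomaly.* Closedness of `ω'` on `Q'`, `Q'`, `Q'` shows that the left hand side of the master equation is always
annihilated by `Q'` (`GrAlg.IsPremaster.apply_master`); as it is minus the pullback of the anomaly and pullback is
injective, the anomaly is closed. A primitive `b` of it, added to the hamiltonian, cancels it. On a background
solution the anomaly becomes a form of degree `n + 1` on the `n`-dimensional `X`, and so vanishes
(`functionsT1_eq_zero`).
-/

noncomputable section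

theorem sgn_smul_congr {m n : ℤ} (h : Even (m - n)) {M : Type*} [AddCommGroup M] (x : M) :
    sgn m • x = sgn n • x := by rw [sgn_congr h]

namespace GrAlg

/-! ### Derivations and homogeneous elements -/

section General

variable {A : GrAlg.{u}} {B : GrAlg.{v}}

theorem Vect.map_gr {k : ℤ} (X : Vect A k) {i : ℤ} {a : A} (ha : a ∈ A.gr i) : X a ∈ A.gr (i + k) :=
  X.2.1 i a ha

theorem Vect.leibniz {k : ℤ} (X : Vect A k) {i : ℤ} {a : A} (ha : a ∈ A.gr i) (b : A) :
    X (a * b) = X a * b + sgn (k * i) • (a * X b) := X.2.2 i a ha b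

theorem Vect.map_one {k : ℤ} (X : Vect A k) : X (1 : A) = 0 := by
  have h := Vect.leibniz X A.one_mem (1 : A)
  rw [mul_one, mul_zero, sgn_zero, one_smul, one_mul, mul_one] at h
  exact left_eq_add.1 h

/-- The function `f` times the vector field `X`. -/
def Vect.leftMul {k e : ℤ} {f : A} (hf : f ∈ A.gr e) (X : Vect A k) : Vect A (e + k) :=
  ⟨LinearMap.mulLeft ℝ f ∘ₗ X.1, by
    constructor
    · intro i a ha
      have := A.mul_mem hf (Vect.map_gr X ha)
      simp only [LinearMap.comp_apply, LinearMap.mulLeft_apply]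
      convert this using 2
      ring
    · intro i a ha b
      simp only [LinearMap.comp_apply, LinearMap.mulLeft_apply]
      rw [Vect.leibniz X ha, mul_add, mul_assoc, mul_smul_comm, ← mul_assoc f a, A.comm hf ha, smul_mul_assoc,
        smul_smul, mul_assoc, ← sgn_add]
      congr 1
      exact sgn_smul_congr (by grind) _⟩

/-- Reindexing a vector field along an equality of degrees. -/
def Vect.cast {k l : ℤ} (h : k = l) (X : Vect A k) : Vect A l := ⟨X.1, h ▸ X.2⟩

theorem Vect.sum_apply {k : ℤ} {ι : Type*} (s : Finset ι) (X : ι → Vect A k) (a : A) :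
    (∑ i ∈ s, X i : Vect A k) a = ∑ i ∈ s, X i a := by
  rw [AddSubmonoidClass.coe_finsetSum, LinearMap.sum_apply]

theorem bracket_apply {k l : ℤ} (X : Vect A k) (Y : Vect A l) (a : A) :
    bracket X Y a = X (Y a) - sgn (k * l) • Y (X a) := rfl

end General

/-! ### Coefficients of power series -/

section Coefficients

variable {A : GrAlg.{u}} {A' : GrAlg.{v}} {r : ℕ} {d : Fin r → ℤ}

/-- The coefficient of `ξ^K`, written on the left of the monomial. -/
def coeff (K : Fin r →₀ ℕ) : formal A d →ₗ[ℝ] A where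
  toFun F := Series.ext0 F.1 K
  map_add' F G := Series.ext0_add F.1 G.1 K
  map_smul' c F := Series.ext0_smul c F.1 K

theorem coeff_of_isMono {K : Fin r →₀ ℕ} (h : IsMono d K) (F : formal A d) :
    coeff K F = F.1 ⟨K, h⟩ := Series.ext0_of _ h

theorem coeff_of_not_isMono {K : Fin r →₀ ℕ} (h : ¬ IsMono d K) (F : formal A d) : coeff K F = 0 :=
  dif_neg h

theorem formal_ext {F G : formal A d} (h : ∀ K, IsMono d K → coeff K F = coeff K G) : F = G := by
  refine Subtype.ext (funext fun N => ?_)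
  have := h N.1 N.2
  rwa [coeff_of_isMono N.2, coeff_of_isMono N.2] at this

theorem coeff_mul {K : Fin r →₀ ℕ} (h : IsMono d K) (F G : formal A d) :
    coeff K (F * G) = ∑ p ∈ Finset.HasAntidiagonal.antidiagonal K,
      sgn (mswap d p.1 p.2) • (coeff p.1 F * A.twist (mdeg d p.1) (coeff p.2 G)) :=
  Series.ext0_mul F.1 G.1 h

theorem coeff_mem {k : ℤ} {F : formal A d} (hF : F ∈ (formal A d).gr k) (K : Fin r →₀ ℕ) :
    coeff K F ∈ A.gr (k - mdeg d K) := Series.ext0_mem hF K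

theorem mem_gr_of_coeff {k : ℤ} {F : formal A d} (h : ∀ K, IsMono d K → coeff K F ∈ A.gr (k - mdeg d K)) :
    F ∈ (formal A d).gr k := by
  intro N
  have := h N.1 N.2
  rwa [coeff_of_isMono N.2] at this

open Classical in
theorem coeff_term (K L : Fin r →₀ ℕ) (hK : IsMono d K) (a : A) :
    coeff L (term A d K a) = if L = K then a else 0 := by
  by_cases h : IsMono d L
  · rw [coeff_of_isMono h]
    exact Series.single_apply K a _
  · rw [coeff_of_not_isMono h, if_neg]
    rintro rfl
    exact h hK

theorem isMono_single (i : Fin r) : IsMono d (Finsupp.single i 1) := by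
  intro j _
  by_cases h : i = j
  · simp [h]
  · simp [h]

theorem mdeg_single (i : Fin r) (c : ℕ) : mdeg d (Finsupp.single i c) = c * d i := by
  classical
  simp only [mdeg, Finsupp.single_apply]
  rw [Finset.sum_eq_single i]
  · simp
  · intro j _ hj
    simp [hj.symm]
  · simp

open Classical in
theorem coeff_const (a : A) (L : Fin r →₀ ℕ) : coeff L (const A d a) = if L = 0 then a else 0 :=
  coeff_term 0 L Series.isMono_zero a

theorem var_mem (i : Fin r) : var A d i ∈ (formal A d).gr (d i) := by
  have := Series.single_mem (d := d) (Finsupp.single i 1) A.one_mem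
  rwa [mdeg_single, Nat.cast_one, one_mul, zero_add] at this

open Classical in
theorem coeff_var (i : Fin r) (L : Fin r →₀ ℕ) :
    coeff L (var A d i) = if L = Finsupp.single i 1 then 1 else 0 :=
  coeff_term _ L (isMono_single i) 1

theorem coeff_const_mul (a : A) (F : formal A d) (K : Fin r →₀ ℕ) :
    coeff K (const A d a * F) = a * coeff K F := by
  classical
  by_cases h : IsMono d K
  · rw [coeff_mul h, Finset.sum_eq_single (0, K)]
    · simp [coeff_const, mswap_zero_left, sgn_zero, mdeg_zero, A.twist_zero]
    · rintro ⟨P, Q⟩ hp hne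
      have hP : P ≠ 0 := by
        rintro rfl
        apply hne
        simp only [Finset.HasAntidiagonal.mem_antidiagonal, zero_add] at hp
        rw [hp]
      simp [coeff_const, hP]
    · simp
  · rw [coeff_of_not_isMono h, coeff_of_not_isMono h, mul_zero]

theorem coeff_mul_const (a : A) (F : formal A d) (K : Fin r →₀ ℕ) :
    coeff K (F * const A d a) = coeff K F * A.twist (mdeg d K) a := by
  classical
  by_cases h : IsMono d K
  · rw [coeff_mul h, Finset.sum_eq_single (K, 0)]
    · simp [coeff_const, mswap_zero_right, sgn_zero]
    · rintro ⟨P, Q⟩ hp hne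
      have hQ : Q ≠ 0 := by
        rintro rfl
        apply hne
        simp only [Finset.HasAntidiagonal.mem_antidiagonal, add_zero] at hp
        rw [hp]
      simp [coeff_const, hQ]
    · simp
  · rw [coeff_of_not_isMono h, coeff_of_not_isMono h, zero_mul]

/-- Multiplication by a variable shifts coefficients, up to the sign of reordering. -/
theorem coeff_var_mul (i : Fin r) (F : formal A d) {M : Fin r →₀ ℕ} (h : IsMono d (Finsupp.single i 1 + M)) :
    coeff (Finsupp.single i 1 + M) (var A d i * F) =
      sgn (mswap d (Finsupp.single i 1) M) • A.twist (d i) (coeff M F) := by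
  classical
  rw [coeff_mul h, Finset.sum_eq_single (Finsupp.single i 1, M)]
  · simp [coeff_var, mdeg_single]
  · rintro ⟨P, Q⟩ hp hne
    have hP : P ≠ Finsupp.single i 1 := by
      rintro rfl
      apply hne
      simp only [Finset.HasAntidiagonal.mem_antidiagonal] at hp
      rw [add_left_cancel hp]
    simp [coeff_var, hP]
  · simp

theorem coeff_var_mul_of_eq_zero (i : Fin r) (F : formal A d) {M : Fin r →₀ ℕ} (h : M i = 0) :
    coeff M (var A d i * F) = 0 := by
  classical
  by_cases hM : IsMono d M
  · rw [coeff_mul hM]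
    refine Finset.sum_eq_zero ?_
    rintro ⟨P, Q⟩ hp
    have hP : P ≠ Finsupp.single i 1 := by
      rintro rfl
      rw [Finset.HasAntidiagonal.mem_antidiagonal] at hp
      rw [← hp] at h
      simp at h
    simp [coeff_var, hP]
  · exact coeff_of_not_isMono hM _

theorem coeff_formalMap (φ : Hom A A') (F : formal A d) (K : Fin r →₀ ℕ) :
    coeff K (φ.formalMap d F) = φ (coeff K F) := by
  by_cases h : IsMono d K
  · rw [coeff_of_isMono h, coeff_of_isMono h]; rfl
  · rw [coeff_of_not_isMono h, coeff_of_not_isMono h]; simp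

theorem formalMap_const (φ : Hom A A') (a : A) : φ.formalMap d (const A d a) = const A' d (φ a) := by
  classical
  refine formal_ext fun K _ => ?_
  rw [coeff_formalMap, coeff_const, coeff_const]
  split_ifs <;> simp

theorem formalMap_term (φ : Hom A A') (K : Fin r →₀ ℕ) (hK : IsMono d K) (a : A) :
    φ.formalMap d (term A d K a) = term A' d K (φ a) := by
  classical
  refine formal_ext fun L _ => ?_
  rw [coeff_formalMap, coeff_term K L hK, coeff_term K L hK]
  split_ifs <;> simp

theorem formalMap_var (φ : Hom A A') (i : Fin r) : φ.formalMap d (var A d i) = var A' d i := by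
  rw [var, formalMap_term φ _ (isMono_single i), map_one]; rfl

theorem formalMap_injective {φ : Hom A A'} (h : Function.Injective φ) :
    Function.Injective (φ.formalMap d) := by
  intro F G e
  refine formal_ext fun K _ => h ?_
  rw [← coeff_formalMap, ← coeff_formalMap, e]

theorem twist_congr (A : GrAlg.{u}) {e f : ℤ} (h : Even (e - f)) (a : A) : A.twist e a = A.twist f a := by
  refine A.homogeneous_induction (P := fun a => A.twist e a = A.twist f a) (by simp) ?_ ?_ a
  · intro a b ha hb
    simp only [map_add, ha, hb]
  · intro i a ha
    rw [A.twist_of_mem _ ha, A.twist_of_mem _ ha]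
    refine sgn_smul_congr ?_ _
    rw [← sub_mul]
    exact h.mul_right i

/-- A linear map of coefficient families that shifts the degree, as a map of the algebras of series. -/
def liftSeries {r' : ℕ} {d' : Fin r' → ℤ} (m : Series A d →ₗ[ℝ] Series A' d') (e : ℤ)
    (hm : ∀ k, ∀ F ∈ Series.grade A d k, m F ∈ Series.grade A' d' (k + e)) :
    formal A d →ₗ[ℝ] formal A' d' where
  toFun F := ⟨m F.1, by
    obtain ⟨F, hF⟩ := F
    refine Submodule.iSup_induction _ (motive := fun F => m F ∈ ⨆ k, Series.grade A' d' k) hF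
      (fun k F hF => Submodule.mem_iSup_of_mem (k + e) (hm k F hF)) (by rw [map_zero]; exact zero_mem _)
      (fun F G h1 h2 => by rw [map_add]; exact add_mem h1 h2)⟩
  map_add' F G := Subtype.ext (map_add m F.1 G.1)
  map_smul' c F := Subtype.ext (map_smul m c F.1)

end Coefficients

/-! ### Vector fields on power series -/

section SeriesVect

variable {A : GrAlg.{u}} {r : ℕ} (d : Fin r → ℤ)

/-- The linear map underlying `extend`. -/
def extendLin {k : ℤ} (X : Vect A k) : formal A d →ₗ[ℝ] formal A d :=
  liftSeries { toFun := fun F N => X (F N)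
               map_add' := fun F G => by funext N; exact map_add X.1 _ _
               map_smul' := fun c F => by funext N; exact map_smul X.1 _ _ } k (by
    intro i F hF N
    have h := Vect.map_gr X (hF N)
    rwa [show i - mdeg d N.1 + k = i + k - mdeg d N.1 by ring] at h)

theorem coeff_extendLin {k : ℤ} (X : Vect A k) (F : formal A d) (K : Fin r →₀ ℕ) :
    coeff K (extendLin d X F) = X (coeff K F) := by
  by_cases h : IsMono d K
  · rw [coeff_of_isMono h, coeff_of_isMono h]; rfl
  · rw [coeff_of_not_isMono h, coeff_of_not_isMono h]; simp

theorem Vect.apply_twist {k : ℤ} (X : Vect A k) (e : ℤ) (a : A) :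
    X (A.twist e a) = sgn (k * e) • A.twist e (X a) := by
  refine A.homogeneous_induction (P := fun b => X (A.twist e b) = sgn (k * e) • A.twist e (X b))
    (by simp) ?_ ?_ _
  · intro a b ha hb
    simp only [map_add, ha, hb, smul_add]
  · intro j b hb
    rw [A.twist_of_mem _ hb, map_zsmul, A.twist_of_mem _ (Vect.map_gr X hb), smul_smul, ← sgn_add]
    exact sgn_smul_congr (by grind) _

/-- A vector field acting on the coefficients of power series. -/
def extend {k : ℤ} (X : Vect A k) : Vect (formal A d) k :=
  ⟨extendLin d X, by
    constructor
    · intro i F hF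
      refine mem_gr_of_coeff fun K _ => ?_
      rw [coeff_extendLin]
      have h := Vect.map_gr X (coeff_mem hF K)
      rwa [show i - mdeg d K + k = i + k - mdeg d K by ring] at h
    · intro i F hF G
      refine formal_ext fun K hK => ?_
      rw [map_add, map_zsmul, coeff_extendLin, coeff_mul hK, coeff_mul hK, coeff_mul hK, map_sum, Finset.smul_sum,
        ← Finset.sum_add_distrib]
      refine Finset.sum_congr rfl ?_
      rintro ⟨P, Q⟩ hp
      simp only [coeff_extendLin, map_zsmul]
      rw [Vect.leibniz X (coeff_mem hF P), Vect.apply_twist, smul_add, mul_smul_comm, smul_smul, smul_smul,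
        smul_smul, ← sgn_add, ← sgn_add, ← sgn_add]
      congr 1
      exact sgn_smul_congr (by grind) _⟩

theorem coeff_extend {k : ℤ} (X : Vect A k) (F : formal A d) (K : Fin r →₀ ℕ) :
    coeff K (extend d X F) = X (coeff K F) := coeff_extendLin d X F K

theorem extend_const {k : ℤ} (X : Vect A k) (a : A) : extend d X (const A d a) = const A d (X a) := by
  classical
  refine formal_ext fun K _ => ?_
  rw [coeff_extend, coeff_const, coeff_const]
  split_ifs <;> simp

theorem extend_var {k : ℤ} (X : Vect A k) (i : Fin r) : extend d X (var A d i) = 0 := by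
  classical
  refine formal_ext fun K _ => ?_
  rw [coeff_extend, coeff_var, map_zero]
  split_ifs
  · exact Vect.map_one X
  · simp

variable (A)

/-- Exponent of the sign from moving `∂/∂ξ_i` past the variables in front of `ξ_i`. -/
def pastSign (i : Fin r) (K : Fin r →₀ ℕ) : ℤ :=
  d i * ∑ j ∈ Finset.univ.filter (fun j => j < i), (K j : ℤ) * d j

theorem pastSign_add (i : Fin r) (K L : Fin r →₀ ℕ) :
    pastSign d i (K + L) = pastSign d i K + pastSign d i L := by
  simp [pastSign, add_mul, Finset.sum_add_distrib, mul_add]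

theorem mswap_single_left (i : Fin r) (K : Fin r →₀ ℕ) :
    mswap d (Finsupp.single i 1) K = pastSign d i K := by
  rw [mswap, Finset.sum_eq_single i, pastSign, Finset.mul_sum]
  · refine Finset.sum_congr rfl fun j _ => ?_
    simp
    ring
  · intro j _ hj
    simp [hj.symm]
  · simp

/-- Moving `ξ_i` past `ξ^K` from either side of its place in `ξ^K`. -/
theorem mswap_single_right (i : Fin r) (K : Fin r →₀ ℕ) :
    mswap d K (Finsupp.single i 1) + pastSign d i K + K i * (d i * d i) = d i * mdeg d K := by
  have e1 : mswap d K (Finsupp.single i 1) =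
      ∑ j ∈ Finset.univ.filter (fun j => i < j), (K j : ℤ) * (d i * d j) := by
    rw [mswap, Finset.sum_filter]
    refine Finset.sum_congr rfl fun j _ => ?_
    split_ifs with h
    · rw [Finset.sum_eq_single i]
      · rw [Finsupp.single_eq_same]
        push_cast
        ring
      · intro l _ hl
        simp [hl.symm]
      · simp [h]
    · refine Finset.sum_eq_zero fun l hl => ?_
      rw [Finset.mem_filter] at hl
      have : i ≠ l := by
        rintro rfl
        exact h hl.2
      simp [this]
  have e2 : (K i : ℤ) * (d i * d i) = ∑ j, if j = i then (K j : ℤ) * (d i * d j) else 0 := by simp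
  rw [e1, e2, pastSign, mdeg, Finset.mul_sum, Finset.mul_sum, Finset.sum_filter, Finset.sum_filter,
    ← Finset.sum_add_distrib, ← Finset.sum_add_distrib]
  refine Finset.sum_congr rfl fun j _ => ?_
  rcases lt_trichotomy j i with h | h | h
  · simp [h, h.ne, h.asymm]
  · subst h
    simp
    ring
  · simp [h, h.ne', h.asymm]
    ring

/-- The linear map underlying `∂/∂ξ_i`: a term `a ξ^K ξ_i` contributes the multiplicity `K i + 1`, the sign of
moving `ξ_i` to the front of `ξ^K`, and the sign of moving `∂/∂ξ_i` past the coefficient `a`, which is the twist. -/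
def partialLin (i : Fin r) : formal A d →ₗ[ℝ] formal A d :=
  liftSeries
    { toFun := fun F N => (((N.1 i + 1 : ℕ) : ℤ) * sgn (pastSign d i N.1)) •
        A.twist (d i) (F.ext0 (N.1 + Finsupp.single i 1))
      map_add' := fun F G => by
        funext N
        simp only [Series.ext0_add, map_add, smul_add]
        rfl
      map_smul' := fun c F => by
        funext N
        simp only [Series.ext0_smul, map_smul]
        rw [smul_comm]
        rfl } (-d i) (by
      intro k F hF N
      have := Series.ext0_mem hF (N.1 + Finsupp.single i 1)
      rw [mdeg_add, mdeg_single, Nat.cast_one, one_mul] at this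
      refine zsmul_mem ?_ _
      rw [A.twist_of_mem _ this]
      refine zsmul_mem ?_ _
      convert this using 2
      ring)

theorem coeff_partialLin (i : Fin r) (F : formal A d) {K : Fin r →₀ ℕ} (hK : IsMono d K) :
    coeff K (partialLin A d i F) = (((K i + 1 : ℕ) : ℤ) * sgn (pastSign d i K)) •
        A.twist (d i) (coeff (K + Finsupp.single i 1) F) := by
  rw [coeff_of_isMono hK]; rfl

/-- Shifting the first component of a decomposition. The terms added on the right have weight `0`. -/
theorem sum_antidiagonal_shift_left {R : Type*} [AddCommGroup R] (i : Fin r) (N : Fin r →₀ ℕ)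
    (h : (Fin r →₀ ℕ) → (Fin r →₀ ℕ) → R) :
    ∑ p ∈ Finset.HasAntidiagonal.antidiagonal N, ((p.1 i + 1 : ℕ) : ℤ) • h (p.1 + Finsupp.single i 1) p.2 =
      ∑ p ∈ (Finset.HasAntidiagonal.antidiagonal (N + Finsupp.single i 1) : Finset ((Fin r →₀ ℕ) × (Fin r →₀ ℕ))), ((p.1 i : ℕ) : ℤ) • h p.1 p.2 := by
  classical
  rw [← Finset.sum_filter_of_ne (p := fun p : (Fin r →₀ ℕ) × (Fin r →₀ ℕ) => p.1 i ≠ 0)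
    (s := Finset.HasAntidiagonal.antidiagonal (N + Finsupp.single i 1))]
  · refine Finset.sum_nbij' (fun p => (p.1 + Finsupp.single i 1, p.2)) (fun p => (p.1 - Finsupp.single i 1, p.2))
      ?_ ?_ ?_ ?_ ?_
    · rintro ⟨P, Q⟩ hp
      simp only [Finset.mem_filter, Finset.HasAntidiagonal.mem_antidiagonal] at hp ⊢
      refine ⟨by rw [← hp, add_right_comm], by simp⟩
    · rintro ⟨P, Q⟩ hp
      simp only [Finset.mem_filter, Finset.HasAntidiagonal.mem_antidiagonal] at hp ⊢
      have hle : Finsupp.single i 1 ≤ P := by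
        rw [Finsupp.single_le_iff]; omega
      have := hp.1
      rw [← tsub_add_cancel_of_le hle, add_right_comm] at this
      exact add_right_cancel this
    · rintro ⟨P, Q⟩ hp
      simp
    · rintro ⟨P, Q⟩ hp
      simp only [Finset.mem_filter] at hp
      have hle : Finsupp.single i 1 ≤ P := by
        rw [Finsupp.single_le_iff]; omega
      simp [tsub_add_cancel_of_le hle]
    · rintro ⟨P, Q⟩ hp
      simp
  · intro p hp hne h0
    exact hne (by simp [h0])

theorem sum_antidiagonal_shift_right {R : Type*} [AddCommGroup R] (i : Fin r) (N : Fin r →₀ ℕ)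
    (h : (Fin r →₀ ℕ) → (Fin r →₀ ℕ) → R) :
    ∑ p ∈ Finset.HasAntidiagonal.antidiagonal N, ((p.2 i + 1 : ℕ) : ℤ) • h p.1 (p.2 + Finsupp.single i 1) =
      ∑ p ∈ (Finset.HasAntidiagonal.antidiagonal (N + Finsupp.single i 1) : Finset ((Fin r →₀ ℕ) × (Fin r →₀ ℕ))), ((p.2 i : ℕ) : ℤ) • h p.1 p.2 := by
  have := sum_antidiagonal_shift_left i N (fun P Q => h Q P)
  rw [← Finset.sum_equiv (Equiv.prodComm _ _) (s := Finset.HasAntidiagonal.antidiagonal N)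
    (t := Finset.HasAntidiagonal.antidiagonal N)
    (f := fun p => ((p.2 i + 1 : ℕ) : ℤ) • h p.1 (p.2 + Finsupp.single i 1)) (by simp [add_comm]) (by simp),
    ← Finset.sum_equiv (Equiv.prodComm _ _)
    (s := Finset.HasAntidiagonal.antidiagonal (N + Finsupp.single i 1))
    (t := Finset.HasAntidiagonal.antidiagonal (N + Finsupp.single i 1))
    (f := fun p : (Fin r →₀ ℕ) × (Fin r →₀ ℕ) => ((p.2 i : ℕ) : ℤ) • h p.1 p.2) (by simp [add_comm]) (by simp)]
    at this
  exact this

theorem partialLin_leibniz (i : Fin r) {k : ℤ} {F : formal A d} (hF : F ∈ (formal A d).gr k)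
    (G : formal A d) :
    partialLin A d i (F * G) = partialLin A d i F * G + sgn (-d i * k) • (F * partialLin A d i G) := by
  classical
  set e : Fin r →₀ ℕ := Finsupp.single i 1 with he
  refine formal_ext fun N hN => ?_
  -- the summands of the coefficient of `F G` at `N + e`, after `∂/∂ξ_i`
  let H : (Fin r →₀ ℕ) → (Fin r →₀ ℕ) → A := fun P Q =>
    sgn (pastSign d i N + mswap d P Q) • A.twist (d i) (coeff P F * A.twist (mdeg d P) (coeff Q G))
  have h1 : coeff N (partialLin A d i F * G) =
      ∑ p ∈ (Finset.HasAntidiagonal.antidiagonal (N + e) : Finset ((Fin r →₀ ℕ) × (Fin r →₀ ℕ))), ((p.1 i : ℕ) : ℤ) • H p.1 p.2 := by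
    rw [← sum_antidiagonal_shift_left i N H, coeff_mul hN]
    refine Finset.sum_congr rfl ?_
    rintro ⟨P, Q⟩ hp
    rw [Finset.HasAntidiagonal.mem_antidiagonal] at hp
    simp only at hp
    rw [← hp] at hN
    simp only [H, map_mul, A.twist_twist]
    rw [coeff_partialLin A d i F hN.left, smul_mul_assoc, smul_smul, smul_smul, mdeg_add, mdeg_single,
      ← hp, pastSign_add, mswap_add_left, mswap_single_left]
    rw [A.twist_congr (show Even (d i + (mdeg d P + ((1 : ℕ) : ℤ) * d i) - mdeg d P) by grind),
      sgn_congr (show Even (pastSign d i P + pastSign d i Q + (mswap d P Q + pastSign d i Q) -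
        (mswap d P Q + pastSign d i P)) by grind), sgn_add]
    congr 1
    ring
  have h2 : sgn (-d i * k) • coeff N (F * partialLin A d i G) =
      ∑ p ∈ (Finset.HasAntidiagonal.antidiagonal (N + e) : Finset ((Fin r →₀ ℕ) × (Fin r →₀ ℕ))), ((p.2 i : ℕ) : ℤ) • (sgn (d i * p.1 i) • H p.1 p.2) := by
    rw [← sum_antidiagonal_shift_right i N (fun P Q => sgn (d i * P i) • H P Q), coeff_mul hN, Finset.smul_sum]
    refine Finset.sum_congr rfl ?_
    rintro ⟨P, Q⟩ hp
    rw [Finset.HasAntidiagonal.mem_antidiagonal] at hp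
    simp only at hp
    rw [← hp] at hN
    simp only [H, map_mul, A.twist_twist]
    have hs := mswap_single_right d i P
    rw [coeff_partialLin A d i G hN.right, A.twist_of_mem _ (coeff_mem hF P), map_zsmul, A.twist_twist,
      mul_smul_comm, smul_mul_assoc, ← hp, pastSign_add, mswap_add_right, smul_smul, smul_smul, smul_smul,
      smul_smul, smul_smul, add_comm (mdeg d P)]
    congr 1
    have e1 : sgn (-d i * k) * (sgn (mswap d P Q) * sgn (pastSign d i Q)) =
        sgn (d i * P i) * (sgn (pastSign d i P + pastSign d i Q + (mswap d P Q + mswap d P (Finsupp.single i 1))) *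
          sgn (d i * (k - mdeg d P))) := by
      rw [← sgn_add, ← sgn_add, ← sgn_add, ← sgn_add]
      refine sgn_congr ?_
      rw [show mswap d P (Finsupp.single i 1) = d i * mdeg d P - pastSign d i P - P i * (d i * d i) by linarith]
      have h1 := (Int.even_mul_pred_self (d i)).mul_left (P i : ℤ)
      have h2 := even_two_mul (d i * k)
      obtain ⟨x, hx⟩ := h1.sub h2
      exact ⟨x, by linear_combination hx⟩
    linear_combination ((Q i + 1 : ℕ) : ℤ) * e1
  rw [map_add, map_zsmul, coeff_partialLin A d i _ hN, h1, h2, ← Finset.sum_add_distrib]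
  -- the weights on the two sides agree: for odd `ξ_i` only one of the two factors can contain `ξ_i`
  by_cases hNe : IsMono d (N + e)
  · rw [coeff_mul hNe, map_sum, Finset.smul_sum]
    refine Finset.sum_congr rfl ?_
    rintro ⟨P, Q⟩ hp
    rw [Finset.HasAntidiagonal.mem_antidiagonal] at hp
    have hsum : P i + Q i = N i + 1 := by
      have := DFunLike.congr_fun hp i
      simpa [he] using this
    simp only [H, map_zsmul, smul_smul, ← add_smul]
    congr 1
    rw [sgn_add]
    rcases Int.even_or_odd (d i) with hd | hd
    · rw [sgn_even (hd.mul_right _), ← hsum]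
      push_cast
      ring
    · have h3 := hNe i hd
      rw [← hp] at h3
      simp only [Finsupp.add_apply] at h3
      have h4 : N i = 0 := by omega
      rcases Nat.eq_zero_or_pos (P i) with h5 | h5
      · rw [h5] at hsum ⊢
        rw [show Q i = 1 by omega, h4]
        simp [sgn_zero]
      · rw [show P i = 1 by omega, show Q i = 0 by omega, h4]
        simp
  · rw [coeff_of_not_isMono hNe, map_zero, smul_zero]
    symm
    refine Finset.sum_eq_zero ?_
    rintro ⟨P, Q⟩ hp
    rw [Finset.HasAntidiagonal.mem_antidiagonal] at hp
    have hsum : P i + Q i = N i + 1 := by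
      have := DFunLike.congr_fun hp i
      simpa [he] using this
    -- `ξ^N ξ_i` vanishes, so `ξ_i` is odd and occurs in `ξ^N`; the terms in which both factors contain
    -- `ξ_i` once have opposite signs
    have hodd : Odd (d i) ∧ N i = 1 := by
      by_contra hcon
      apply hNe
      intro j hj
      by_cases hij : i = j
      · subst hij
        have h1 := hN i hj
        have h2 : N i ≠ 1 := fun h2 => hcon ⟨hj, h2⟩
        simp only [he, Finsupp.add_apply, Finsupp.single_eq_same]
        omega
      · have := hN j hj
        simpa [he, hij] using this
    by_cases hP : P i ≤ 1
    · by_cases hQ : Q i ≤ 1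
      · rw [show P i = 1 by omega, show Q i = 1 by omega, Nat.cast_one, mul_one, sgn_odd hodd.1]
        simp
      · have : coeff Q G = 0 := coeff_of_not_isMono (fun h => hQ (h i hodd.1)) G
        simp [H, this]
    · have : coeff P F = 0 := coeff_of_not_isMono (fun h => hP (h i hodd.1)) F
      simp [H, this]

/-- The coordinate vector field `∂/∂ξ_i` on power series. -/
def partialVect (i : Fin r) : Vect (formal A d) (-d i) :=
  ⟨partialLin A d i, by
    constructor
    · intro k F hF
      refine mem_gr_of_coeff fun K hK => ?_
      rw [coeff_partialLin A d i F hK]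
      refine zsmul_mem ?_ _
      have h := coeff_mem hF (K + Finsupp.single i 1)
      rw [A.twist_of_mem _ h]
      refine zsmul_mem ?_ _
      rw [mdeg_add, mdeg_single, Nat.cast_one, one_mul] at h
      rwa [show k - (mdeg d K + d i) = k + -d i - mdeg d K by ring] at h
    · intro k F hF G
      exact partialLin_leibniz A d i hF G⟩

theorem coeff_partialVect (i : Fin r) (F : formal A d) {K : Fin r →₀ ℕ} (hK : IsMono d K) :
    coeff K (partialVect A d i F) = (((K i + 1 : ℕ) : ℤ) * sgn (pastSign d i K)) •
        A.twist (d i) (coeff (K + Finsupp.single i 1) F) := coeff_partialLin A d i F hK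

theorem partialVect_const (i : Fin r) (a : A) : partialVect A d i (const A d a) = 0 := by
  classical
  refine formal_ext fun K hK => ?_
  rw [coeff_partialVect A d i _ hK, coeff_const, if_neg, map_zero, map_zero, smul_zero]
  intro h
  have := DFunLike.congr_fun h i
  simp at this

theorem partialVect_var (i j : Fin r) : partialVect A d i (var A d j) = if j = i then 1 else 0 := by
  classical
  refine formal_ext fun K hK => ?_
  rw [coeff_partialVect A d i _ hK, coeff_var]
  by_cases hij : j = i
  · subst hij
    rw [if_pos rfl, ← map_one (const A d).toAlgHom, coeff_const]
    by_cases hK0 : K = 0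
    · subst hK0
      simp [pastSign, sgn_zero]
    · rw [if_neg (by simpa using hK0), if_neg hK0, map_zero, smul_zero]
  · rw [if_neg hij, if_neg, map_zero, map_zero, smul_zero]
    intro h
    have := DFunLike.congr_fun h i
    simp [Ne.symm hij, hij] at this

end SeriesVect

/-! ### Division by the variables -/

section Peel

variable {A : GrAlg.{u}} {r : ℕ} {d : Fin r → ℤ}

theorem twist_twist_self (A : GrAlg.{u}) (e : ℤ) (a : A) : A.twist e (A.twist e a) = a := by
  rw [A.twist_twist, A.twist_congr (f := 0) (by simp), A.twist_zero]

open Classical in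
/-- The part of a power series consisting of the terms whose first variable is `ξ_i`, divided by `ξ_i`
from the left. -/
def peel (i : Fin r) : formal A d →ₗ[ℝ] formal A d :=
  liftSeries
    { toFun := fun F N => if ∀ j < i, N.1 j = 0 then A.twist (d i) (F.ext0 (Finsupp.single i 1 + N.1)) else 0
      map_add' := fun F G => by
        funext N
        change (if ∀ j < i, N.1 j = 0 then A.twist (d i) ((F + G).ext0 (Finsupp.single i 1 + N.1)) else 0) =
          (if ∀ j < i, N.1 j = 0 then A.twist (d i) (F.ext0 (Finsupp.single i 1 + N.1)) else 0) +
          (if ∀ j < i, N.1 j = 0 then A.twist (d i) (G.ext0 (Finsupp.single i 1 + N.1)) else 0)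
        rw [Series.ext0_add, map_add]
        split_ifs <;> simp
      map_smul' := fun c F => by
        funext N
        change (if ∀ j < i, N.1 j = 0 then A.twist (d i) ((c • F).ext0 (Finsupp.single i 1 + N.1)) else 0) =
          c • (if ∀ j < i, N.1 j = 0 then A.twist (d i) (F.ext0 (Finsupp.single i 1 + N.1)) else 0)
        rw [Series.ext0_smul, map_smul]
        split_ifs <;> simp } (-d i) (by
      intro k F hF N
      have h := Series.ext0_mem hF (Finsupp.single i 1 + N.1)
      change (if ∀ j < i, N.1 j = 0 then A.twist (d i) (F.ext0 (Finsupp.single i 1 + N.1)) else 0) ∈ _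
      split_ifs
      · rw [A.twist_of_mem _ h]
        refine zsmul_mem ?_ _
        rw [mdeg_add, mdeg_single, Nat.cast_one, one_mul] at h
        rwa [show k - (d i + mdeg d N.1) = k + -d i - mdeg d N.1 by ring] at h
      · exact zero_mem _)

open Classical in
theorem coeff_peel (i : Fin r) (F : formal A d) {K : Fin r →₀ ℕ} (hK : IsMono d K) :
    coeff K (peel i F) =
      if ∀ j < i, K j = 0 then A.twist (d i) (coeff (Finsupp.single i 1 + K) F) else 0 := by
  rw [coeff_of_isMono hK]; rfl

theorem peel_mem (i : Fin r) {k : ℤ} {F : formal A d} (hF : F ∈ (formal A d).gr k) :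
    peel i F ∈ (formal A d).gr (k - d i) := by
  classical
  refine mem_gr_of_coeff fun K hK => ?_
  rw [coeff_peel i F hK]
  have h := coeff_mem hF (Finsupp.single i 1 + K)
  split_ifs
  · rw [A.twist_of_mem _ h]
    refine zsmul_mem ?_ _
    rw [mdeg_add, mdeg_single, Nat.cast_one, one_mul] at h
    rwa [show k - (d i + mdeg d K) = k - d i - mdeg d K by ring] at h
  · exact zero_mem _

/-- Every power series is its constant term plus a combination of the variables. -/
theorem eq_const_add_sum_var_mul_peel (F : formal A d) :
    F = const A d (coeff 0 F) + ∑ i, var A d i * peel i F := by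
  classical
  refine formal_ext fun N hN => ?_
  rw [map_add, map_sum, coeff_const]
  by_cases h0 : N = 0
  · subst h0
    rw [if_pos rfl, Finset.sum_eq_zero, add_zero]
    intro i _
    exact coeff_var_mul_of_eq_zero i _ rfl
  · have hex : (Finset.univ.filter (fun i => N i ≠ 0)).Nonempty := by
      by_contra hne
      rw [Finset.not_nonempty_iff_eq_empty] at hne
      apply h0
      ext i
      by_contra hi
      have : i ∈ Finset.univ.filter (fun i => N i ≠ 0) := by simpa using hi
      rw [hne] at this
      simp at this
    -- at `ξ^N` only the summand of the first variable that occurs in `ξ^N` contributes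
    set i₀ := (Finset.univ.filter (fun i => N i ≠ 0)).min' hex with hi₀
    have hmem : N i₀ ≠ 0 := by
      have := Finset.min'_mem _ hex
      rw [Finset.mem_filter] at this
      exact this.2
    have hlt : ∀ j < i₀, N j = 0 := by
      intro j hj
      by_contra hne
      exact absurd (Finset.min'_le _ j (by simpa using hne)) (not_le.2 hj)
    have hdec : ∀ i, N i ≠ 0 → ∃ M, N = Finsupp.single i 1 + M := fun i hi =>
      ⟨N - Finsupp.single i 1, by
        rw [add_tsub_cancel_of_le]
        rw [Finsupp.single_le_iff]
        omega⟩
    rw [if_neg h0, zero_add, Finset.sum_eq_single i₀]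
    · obtain ⟨M, hM⟩ := hdec i₀ hmem
      rw [hM] at hN
      have hlt' : ∀ j < i₀, M j = 0 := by
        intro j hj
        have := hlt j hj
        rw [hM] at this
        simp only [Finsupp.add_apply] at this
        omega
      have hs : pastSign d i₀ M = 0 := by
        rw [pastSign, Finset.sum_eq_zero, mul_zero]
        intro j hj
        rw [Finset.mem_filter] at hj
        rw [hlt' j hj.2]
        simp
      rw [hM, coeff_var_mul i₀ _ hN, mswap_single_left, hs, sgn_zero, one_smul, coeff_peel i₀ F hN.right,
        if_pos hlt', A.twist_twist_self]
    · intro i _ hi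
      by_cases hz : N i = 0
      · exact coeff_var_mul_of_eq_zero i _ hz
      · obtain ⟨M, hM⟩ := hdec i hz
        have hi' : i₀ < i := lt_of_le_of_ne (Finset.min'_le _ i (by simpa using hz)) (Ne.symm hi)
        rw [hM] at hN
        have hne : ¬ ∀ j < i, M j = 0 := by
          intro h
          apply hmem
          rw [hM]
          simp [h i₀ hi', hi]
        rw [hM, coeff_var_mul i _ hN, coeff_peel i F hN.right, if_neg hne, map_zero, smul_zero]
    · simp

/-- A family of power series each of which is a combination, with the variables as coefficients, of other
members of the family is zero: by induction its members vanish to any order. -/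
theorem eq_zero_of_eq_sum_var_mul {ι : Type*} {Φ : ι → formal A d}
    (H : ∀ x, ∃ (y : Fin r → ι) (ε : Fin r → ℤ), Φ x = ∑ i, ε i • (var A d i * Φ (y i))) (x : ι) : Φ x = 0 := by
  have key : ∀ (N : ℕ) (x : ι) (K : Fin r →₀ ℕ), ∑ i, K i < N → coeff K (Φ x) = 0 := by
    intro N
    induction N with
    | zero => intro x K h; omega
    | succ N ih =>
      intro x K hK
      obtain ⟨y, ε, h⟩ := H x
      rw [h, map_sum]
      refine Finset.sum_eq_zero fun i _ => ?_
      rw [map_zsmul]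
      by_cases hz : K i = 0
      · rw [coeff_var_mul_of_eq_zero i _ hz, smul_zero]
      · obtain ⟨M, rfl⟩ : ∃ M, K = Finsupp.single i 1 + M :=
          ⟨K - Finsupp.single i 1, by
            rw [add_tsub_cancel_of_le]
            rw [Finsupp.single_le_iff]
            omega⟩
        by_cases hm : IsMono d (Finsupp.single i 1 + M)
        · rw [coeff_var_mul i _ hm, ih (y i) M, map_zero, smul_zero, smul_zero]
          simp only [Finsupp.add_apply, Finset.sum_add_distrib] at hK
          rw [Finset.sum_eq_single i (by intro j _ hj; simp [hj.symm]) (by simp)] at hK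
          rw [Finsupp.single_eq_same] at hK
          omega
        · rw [coeff_of_not_isMono hm, smul_zero]
  exact formal_ext fun K _ => by rw [key (∑ i, K i + 1) x K (by omega), map_zero]

theorem peel_mul_const (i : Fin r) (F : formal A d) (b : A) :
    peel i (F * const A d b) = peel i F * const A d b := by
  classical
  refine formal_ext fun K hK => ?_
  rw [coeff_peel i _ hK, coeff_mul_const, coeff_mul_const, coeff_peel i _ hK, mdeg_add, mdeg_single,
    Nat.cast_one, one_mul]
  split_ifs
  · rw [map_mul, A.twist_twist]
    exact congrArg _ (A.twist_congr (by grind) _)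
  · rw [zero_mul]

theorem peel_const_mul (i : Fin r) {j : ℤ} {a : A} (ha : a ∈ A.gr j) (F : formal A d) :
    peel i (const A d a * F) = sgn (d i * j) • (const A d a * peel i F) := by
  classical
  refine formal_ext fun K hK => ?_
  rw [coeff_peel i _ hK, coeff_const_mul, map_zsmul, coeff_const_mul, coeff_peel i _ hK]
  split_ifs
  · rw [map_mul, A.twist_of_mem _ ha, smul_mul_assoc]
  · rw [mul_zero, smul_zero]

/-- A derivation of degree `k` along a homomorphism of algebras of power series is determined by its
values on the constants and on the variables. -/
theorem derivation_eq_zero {A' : GrAlg.{v}} {φ : Hom A A'} (k : ℤ) (Δ : formal A d →ₗ[ℝ] formal A' d)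
    (hΔ : ∀ i, ∀ F ∈ (formal A d).gr i, ∀ G,
      Δ (F * G) = Δ F * φ.formalMap d G + sgn (k * i) • (φ.formalMap d F * Δ G))
    (hconst : ∀ a, Δ (const A d a) = 0) (hvar : ∀ i, Δ (var A d i) = 0) (F : formal A d) : Δ F = 0 := by
  refine eq_zero_of_eq_sum_var_mul (Φ := fun F : formal A d => Δ F) (fun F => ?_) F
  refine ⟨fun i => peel i F, fun i => sgn (k * d i), ?_⟩
  conv_lhs => rw [eq_const_add_sum_var_mul_peel F]
  rw [map_add, hconst, zero_add, map_sum]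
  refine Finset.sum_congr rfl fun i _ => ?_
  rw [hΔ _ _ (var_mem i), hvar, zero_mul, zero_add, formalMap_var]

end Peel

end GrAlg

/-! ### Smooth functions and submersions -/

section Analysis

open Topology

/-- Normal form of a submersion between vector spaces: near a point it is a linear projection in suitable
coordinates. -/
theorem exists_openPartialHomeomorph_of_surjective_fderiv {E F : Type*} [NormedAddCommGroup E]
    [NormedSpace ℝ E] [FiniteDimensional ℝ E] [NormedAddCommGroup F] [NormedSpace ℝ F] [FiniteDimensional ℝ F]
    {f : E → F} {U : Set E} (hU : IsOpen U) {a : E} (ha : a ∈ U) (hf : ContDiffOn ℝ ∞ f U)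
    (hsurj : Function.Surjective (fderiv ℝ f a)) :
    ∃ (K : Submodule ℝ E) (e : OpenPartialHomeomorph E (F × K)), a ∈ e.source ∧ e.source ⊆ U ∧
      (∀ y ∈ e.source, (e y).1 = f y) ∧ ContDiffOn ℝ ∞ e e.source ∧ ContDiffOn ℝ ∞ e.symm e.target := by
  have : CompleteSpace E := FiniteDimensional.complete ℝ E
  have : CompleteSpace F := FiniteDimensional.complete ℝ F
  set f' := fderiv ℝ f a with hf'
  obtain ⟨π, hπ⟩ := ContinuousLinearMap.ker_closedComplemented_of_finiteDimensional_range f'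
  have : CompleteSpace f'.ker := FiniteDimensional.complete ℝ _
  -- `f` together with a projection onto the kernel of its derivative is a local diffeomorphism
  let Φ : E → F × f'.ker := fun y => (f y, π y)
  have hΦ : ContDiffOn ℝ ∞ Φ U := hf.prodMk π.contDiff.contDiffOn
  have hd : HasFDerivAt Φ (f'.prod π) a :=
    ((hf.contDiffAt (hU.mem_nhds ha)).differentiableAt (by simp)).hasFDerivAt.prodMk π.hasFDerivAt
  have hbij : Function.Bijective (f'.prod π) := by
    constructor
    · rw [injective_iff_map_eq_zero]
      intro v hv
      rw [ContinuousLinearMap.prod_apply, Prod.mk_eq_zero] at hv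
      exact congrArg Subtype.val ((hπ ⟨v, hv.1⟩).symm.trans hv.2)
    · rintro ⟨u, k⟩
      obtain ⟨v, hv⟩ := hsurj u
      refine ⟨v + ((k : E) - (π v : E)), ?_⟩
      rw [ContinuousLinearMap.prod_apply]
      have h1 : f' (k : E) = 0 := k.2
      have h2 : f' (π v : E) = 0 := (π v).2
      rw [map_add, map_add, map_sub, map_sub, h1, h2, hπ, hπ, hv]
      simp
  let T : E ≃L[ℝ] F × f'.ker := (LinearEquiv.ofBijective (f'.prod π).toLinearMap hbij).toContinuousLinearEquiv
  have hT : (T : E →L[ℝ] F × f'.ker) = f'.prod π := by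
    ext v <;> rfl
  rw [← hT] at hd
  have hca : ContDiffAt ℝ ∞ Φ a := hΦ.contDiffAt (hU.mem_nhds ha)
  let e₀ := hca.toOpenPartialHomeomorph Φ hd (by simp)
  have hcont : ContinuousOn (fderiv ℝ Φ) U := hΦ.continuousOn_fderiv_of_isOpen hU (by simp)
  -- the inverse is smooth where the derivative is invertible, which is an open condition
  let S : Set E := U ∩ fderiv ℝ Φ ⁻¹' (Set.range ((↑) : (E ≃L[ℝ] F × f'.ker) → (E →L[ℝ] F × f'.ker)))
  have hS : IsOpen S := hcont.isOpen_inter_preimage hU ContinuousLinearEquiv.isOpen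
  have haS : a ∈ S := ⟨ha, T, hd.fderiv.symm⟩
  refine ⟨f'.ker, e₀.restrOpen S hS, ?_, ?_, ?_, ?_, ?_⟩
  · rw [OpenPartialHomeomorph.restrOpen_source]
    exact ⟨hca.mem_toOpenPartialHomeomorph_source hd (by simp), haS⟩
  · rw [OpenPartialHomeomorph.restrOpen_source]
    exact fun y hy => hy.2.1
  · intro y _
    rfl
  · rw [OpenPartialHomeomorph.restrOpen_source]
    exact hΦ.mono fun y hy => hy.2.1
  · intro y hy
    have hy' := (e₀.restrOpen S hS).map_target hy
    rw [OpenPartialHomeomorph.restrOpen_source] at hy'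
    obtain ⟨hyU, R, hR⟩ := hy'.2
    refine (OpenPartialHomeomorph.contDiffAt_symm (e₀.restrOpen S hS) (f₀' := R) hy ?_ ?_).contDiffWithinAt
    · rw [hR]
      exact ((hΦ.contDiffAt (hU.mem_nhds hyU)).differentiableAt (by simp)).hasFDerivAt
    · exact hΦ.contDiffAt (hU.mem_nhds hyU)

variable {m : ℕ} {M : Type w} [TopologicalSpace M]
  [ChartedSpace (EuclideanSpace ℝ (Fin m)) M] [IsManifold (𝓡 m) ∞ M]
  {n : ℕ} {X : Type v} [TopologicalSpace X]
  [ChartedSpace (EuclideanSpace ℝ (Fin n)) X] [IsManifold (𝓡 n) ∞ X]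

/-- Normal form of a submersion: near a point, the chosen chart of the target composed with the map extends
to coordinates of the source. -/
theorem exists_adapted_chart (f : C^∞⟮𝓡 m, M; 𝓡 n, X⟯) (p : M)
    (hsurj : Function.Surjective (mfderiv (𝓡 m) (𝓡 n) f p)) :
    ∃ (K : Submodule ℝ (EuclideanSpace ℝ (Fin m)))
      (e : OpenPartialHomeomorph M (EuclideanSpace ℝ (Fin n) × K)), p ∈ e.source ∧
      (∀ q ∈ e.source, f q ∈ (extChartAt (𝓡 n) (f p)).source) ∧
      (∀ q ∈ e.source, (e q).1 = extChartAt (𝓡 n) (f p) (f q)) ∧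
      ContMDiffOn (𝓡 m) 𝓘(ℝ, EuclideanSpace ℝ (Fin n) × K) ∞ e e.source ∧
      ContMDiffOn 𝓘(ℝ, EuclideanSpace ℝ (Fin n) × K) (𝓡 m) ∞ e.symm e.target := by
  set φ := extChartAt (𝓡 m) p with hφ
  set ψ := extChartAt (𝓡 n) (f p) with hψ
  have hfc : Continuous f := f.contMDiff.continuous
  let U : Set (EuclideanSpace ℝ (Fin m)) := φ.target ∩ φ.symm ⁻¹' (f ⁻¹' ψ.source)
  have hU : IsOpen U := (continuousOn_extChartAt_symm p).isOpen_inter_preimage (isOpen_extChartAt_target p)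
    ((isOpen_extChartAt_source (f p)).preimage hfc)
  have hpU : φ p ∈ U := by
    refine ⟨mem_extChartAt_target p, ?_⟩
    simp only [Set.mem_preimage]
    rw [extChartAt_to_inv p]
    exact mem_extChartAt_source (f p)
  let F : EuclideanSpace ℝ (Fin m) → EuclideanSpace ℝ (Fin n) := ψ ∘ f ∘ φ.symm
  have hF : ContDiffOn ℝ ∞ F U := by
    rw [← contMDiffOn_iff_contDiffOn]
    refine (contMDiffOn_extChartAt (n := ∞)).comp (f.contMDiff.comp_contMDiffOn
      ((contMDiffOn_extChartAt_symm p).mono Set.inter_subset_left)) ?_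
    intro y hy
    have := hy.2
    rwa [Set.mem_preimage, Set.mem_preimage, hψ, extChartAt_source] at this
  have hd : fderiv ℝ F (φ p) = mfderiv (𝓡 m) (𝓡 n) f p := by
    have h := (f.contMDiff.mdifferentiableAt (x := p) (by simp)).mfderiv
    simp only [writtenInExtChartAt, ModelWithCorners.range_eq_univ, fderivWithin_univ] at h
    exact h.symm
  obtain ⟨K, e, hae, heU, he1, he2, he3⟩ := exists_openPartialHomeomorph_of_surjective_fderiv hU hpU hF
    (by rw [hd]; exact hsurj)
  have hsrc : ∀ q ∈ ((chartAt (EuclideanSpace ℝ (Fin m)) p).trans e).source, q ∈ φ.source ∧ φ q ∈ e.source := by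
    intro q hq
    rw [OpenPartialHomeomorph.trans_source] at hq
    exact ⟨by rw [hφ, extChartAt_source]; exact hq.1, hq.2⟩
  refine ⟨K, (chartAt (EuclideanSpace ℝ (Fin m)) p).trans e, ?_, ?_, ?_, ?_, ?_⟩
  · rw [OpenPartialHomeomorph.trans_source]
    exact ⟨mem_chart_source _ p, hae⟩
  · intro q hq
    have h := (heU (hsrc q hq).2).2
    rwa [Set.mem_preimage, φ.left_inv (hsrc q hq).1] at h
  · intro q hq
    have h := he1 _ (hsrc q hq).2
    simp only [F, Function.comp_apply] at h
    rw [φ.left_inv (hsrc q hq).1] at h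
    exact h
  · refine (he2.contMDiffOn).comp ((contMDiffOn_extChartAt (I := 𝓡 m) (x := p) (n := ∞)).mono ?_) ?_
    · intro q hq
      have := (hsrc q hq).1
      rwa [hφ, extChartAt_source] at this
    · intro q hq
      exact (hsrc q hq).2
  · refine ((contMDiffOn_extChartAt_symm (I := 𝓡 m) (n := ∞) p)).comp (he3.contMDiffOn.mono ?_) ?_
    · intro z hz
      rw [OpenPartialHomeomorph.trans_target] at hz
      exact hz.1
    · intro z hz
      rw [OpenPartialHomeomorph.trans_target] at hz
      exact (heU (e.map_target hz.1)).1

/-- A function that is smooth near a point agrees near it with a smooth function. -/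
theorem exists_contMDiffMap_eventuallyEq [T2Space M] {h : M → ℝ} {U : Set M} (hU : IsOpen U)
    (hh : ContMDiffOn (𝓡 m) 𝓘(ℝ) ∞ h U) {p : M} (hp : p ∈ U) :
    ∃ H : C^∞⟮𝓡 m, M; ℝ⟯, ∀ᶠ q in 𝓝 p, H q = h q := by
  obtain ⟨f, -, hf⟩ := (SmoothBumpFunction.nhds_basis_tsupport (I := 𝓡 m) p).mem_iff.1 (hU.mem_nhds hp)
  refine ⟨⟨fun q => f q * h q, ?_⟩, ?_⟩
  · refine contMDiff_of_tsupport fun q hq => ?_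
    have hq' : q ∈ tsupport f := closure_mono (Function.support_mul_subset_left _ _) hq
    exact (f.contMDiff q).mul (hh.contMDiffAt (hU.mem_nhds (hf hq')))
  · filter_upwards [f.eventuallyEq_one] with q hq
    change f q * h q = h q
    rw [hq]
    simp

/-- Near every point of an open set, a bump function supported in it. -/
theorem exists_bump [T2Space M] {U : Set M} (hU : U ∈ 𝓝 p) :
    ∃ χ : C^∞⟮𝓡 m, M; ℝ⟯, tsupport χ ⊆ U ∧ ∀ᶠ q in 𝓝 p, χ q = 1 := by
  obtain ⟨f, -, hf⟩ := (SmoothBumpFunction.nhds_basis_tsupport (I := 𝓡 m) p).mem_iff.1 hU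
  exact ⟨⟨f, f.contMDiff⟩, hf, f.eventuallyEq_one⟩

/-- Differentials of functions in a frame of differentials: if the `dx^a` are independent at a point, then
near it the differential of every function is a combination of the `dx^a` with smooth coefficients. -/
theorem exists_frame [T2Space X] (x : Fin n → C^∞⟮𝓡 n, X; ℝ⟯) (x₀ : X)
    (hx : LinearIndependent ℝ (fun a => diffAt (x a) x₀)) :
    ∃ O : Set X, IsOpen O ∧ x₀ ∈ O ∧ ∀ g : C^∞⟮𝓡 n, X; ℝ⟯, ∀ y ∈ O, ∃ u : Fin n → C^∞⟮𝓡 n, X; ℝ⟯,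
      ∀ᶠ z in 𝓝 y, diffAt g z = ∑ a, u a z • diffAt (x a) z := by
  set E := EuclideanSpace ℝ (Fin n)
  set ψ := extChartAt (𝓡 n) x₀ with hψ
  have hloc : ∀ g : C^∞⟮𝓡 n, X; ℝ⟯, ContDiffOn ℝ ∞ (g ∘ ψ.symm) ψ.target := by
    intro g
    rw [← contMDiffOn_iff_contDiffOn]
    exact g.contMDiff.comp_contMDiffOn (contMDiffOn_extChartAt_symm x₀)
  have htgt : IsOpen ψ.target := isOpen_extChartAt_target x₀
  -- differentials at `z` in a chart: `A` is the derivative of the chart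
  have hchain : ∀ z ∈ ψ.source, ∃ A : E → E, ∀ g : C^∞⟮𝓡 n, X; ℝ⟯, ∀ v,
      diffAt g z v = fderiv ℝ (g ∘ ψ.symm) (ψ z) (A v) := by
    intro z hz
    refine ⟨(mfderiv (𝓡 n) 𝓘(ℝ, E) ψ z : E →L[ℝ] E), fun g v => ?_⟩
    have h1 : MDifferentiableAt (𝓡 n) 𝓘(ℝ, E) ψ z := by
      refine (contMDiffAt_extChartAt' (n := ∞) ?_).mdifferentiableAt (by simp)
      rwa [hψ, extChartAt_source] at hz
    have h2 : DifferentiableAt ℝ (g ∘ ψ.symm) (ψ z) :=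
      ((hloc g).contDiffAt (htgt.mem_nhds (ψ.map_source hz))).differentiableAt (by simp)
    have h3 : (g : X → ℝ) =ᶠ[𝓝 z] (g ∘ ψ.symm) ∘ ψ := by
      filter_upwards [(isOpen_extChartAt_source x₀).mem_nhds hz] with y hy
      simp only [Function.comp_apply]
      rw [ψ.left_inv hy]
    rw [diffAt, h3.mfderiv_eq, mfderiv_comp z h2.mdifferentiableAt h1, mfderiv_eq_fderiv]
    rfl
  -- the functions `x` in the chart; independence of the `dx^a` says that `xl` has an invertible derivative
  let xl : E → (Fin n → ℝ) := fun y a => x a (ψ.symm y)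
  have hxl : ContDiffOn ℝ ∞ xl ψ.target := contDiffOn_pi.2 fun a => hloc (x a)
  have hT : ∀ y ∈ ψ.target, ∀ a v, fderiv ℝ (x a ∘ ψ.symm) y v = fderiv ℝ xl y v a := by
    intro y hy a v
    have h := (hxl.contDiffAt (htgt.mem_nhds hy)).differentiableAt (by simp)
    have h' := hasFDerivAt_pi'.1 h.hasFDerivAt a
    have : HasFDerivAt (x a ∘ ψ.symm) ((ContinuousLinearMap.proj a).comp (fderiv ℝ xl y)) y := h'
    rw [this.fderiv]
    rfl
  have hψ0 : ψ x₀ ∈ ψ.target := mem_extChartAt_target x₀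
  have hsrc0 : x₀ ∈ ψ.source := mem_extChartAt_source x₀
  have hsurj : Function.Surjective (fderiv ℝ xl (ψ x₀)) := by
    by_contra hne
    have hlt : LinearMap.range (fderiv ℝ xl (ψ x₀)).toLinearMap < ⊤ :=
      lt_top_iff_ne_top.2 fun h => hne (LinearMap.range_eq_top.1 h)
    obtain ⟨c, hc, hle⟩ := Submodule.exists_le_ker_of_lt_top _ hlt
    apply hc
    have hzero : ∑ a, c (Pi.single a 1) • diffAt (x a) x₀ = 0 := by
      ext v
      have h1 : ∀ w, c (fderiv ℝ xl (ψ x₀) w) = 0 := fun w => hle ⟨w, rfl⟩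
      obtain ⟨A, hA⟩ := hchain x₀ hsrc0
      have h2 := h1 (A v)
      rw [LinearMap.pi_apply_eq_sum_univ c] at h2
      rw [ContinuousLinearMap.sum_apply, ContinuousLinearMap.zero_apply, ← h2]
      refine Finset.sum_congr rfl fun a _ => ?_
      rw [ContinuousLinearMap.smul_apply, hA (x a),
        hT _ hψ0, smul_eq_mul, smul_eq_mul, mul_comm]
      congr 3
      ext j
      simp [Pi.single_apply, eq_comm]
    have := Fintype.linearIndependent_iff.1 hx _ hzero
    ext a
    simpa using this a
  have hinj : Function.Injective (fderiv ℝ xl (ψ x₀)) :=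
    (LinearMap.injective_iff_surjective_of_finrank_eq_finrank (by simp [E])).2 hsurj
  let T₀ : E ≃L[ℝ] (Fin n → ℝ) :=
    (LinearEquiv.ofBijective (fderiv ℝ xl (ψ x₀)).toLinearMap ⟨hinj, hsurj⟩).toContinuousLinearEquiv
  have hT₀ : (T₀ : E →L[ℝ] (Fin n → ℝ)) = fderiv ℝ xl (ψ x₀) := by
    ext v
    rfl
  have hTs : ContDiffOn ℝ ∞ (fderiv ℝ xl) ψ.target := hxl.fderiv_of_isOpen htgt (by simp)
  let S : Set E := ψ.target ∩ fderiv ℝ xl ⁻¹' (Set.range ((↑) : (E ≃L[ℝ] (Fin n → ℝ)) → (E →L[ℝ] (Fin n → ℝ))))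
  have hS : IsOpen S := hTs.continuousOn.isOpen_inter_preimage htgt ContinuousLinearEquiv.isOpen
  let O : Set X := ψ.source ∩ ψ ⁻¹' S
  have hO : IsOpen O := (continuousOn_extChartAt x₀).isOpen_inter_preimage (isOpen_extChartAt_source x₀) hS
  refine ⟨O, hO, ⟨hsrc0, hψ0, T₀, hT₀⟩, fun g y hy => ?_⟩
  -- the coefficients of `dg` are the values of `dg` on the frame dual to the `dx^a`
  let ul : Fin n → E → ℝ := fun a z =>
    fderiv ℝ (g ∘ ψ.symm) z (ContinuousLinearMap.inverse (fderiv ℝ xl z) (Pi.single a 1))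
  have hul : ∀ a, ContDiffOn ℝ ∞ (ul a) S := by
    intro a z hz
    have h1 : ContDiffAt ℝ ∞ (fderiv ℝ (g ∘ ψ.symm)) z :=
      ((hloc g).fderiv_of_isOpen htgt (by simp)).contDiffAt (htgt.mem_nhds hz.1)
    obtain ⟨R, hR⟩ := hz.2
    have h2 : ContDiffAt ℝ ∞ (fun z => ContinuousLinearMap.inverse (fderiv ℝ xl z)) z := by
      have h3 := contDiffAt_map_inverse (𝕜 := ℝ) (n := ∞) R
      rw [hR] at h3
      exact h3.comp z (hTs.contDiffAt (htgt.mem_nhds hz.1))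
    exact (h1.clm_apply (h2.clm_apply contDiffAt_const)).contDiffWithinAt
  have hu : ∀ a, ∃ H : C^∞⟮𝓡 n, X; ℝ⟯, ∀ᶠ z in 𝓝 y, H z = ul a (ψ z) := by
    intro a
    refine exists_contMDiffMap_eventuallyEq (h := ul a ∘ ψ) hO ?_ hy
    refine (hul a).contMDiffOn.comp ((contMDiffOn_extChartAt (x := x₀)).mono ?_) fun z hz => hz.2
    intro z hz
    have := hz.1
    rwa [hψ, extChartAt_source] at this
  choose u hu using hu
  refine ⟨u, ?_⟩
  filter_upwards [hO.mem_nhds hy, Filter.eventually_all.2 hu] with z hz huz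
  obtain ⟨hzs, hzt, R, hR⟩ := hz
  ext v
  obtain ⟨A, hA⟩ := hchain z hzs
  set w : E := A v with hw
  have h1 : w = ∑ a, fderiv ℝ xl (ψ z) w a • ContinuousLinearMap.inverse (fderiv ℝ xl (ψ z)) (Pi.single a 1) := by
    rw [← hR, ContinuousLinearMap.inverse_equiv]
    simp only [ContinuousLinearEquiv.coe_coe, ← map_smul, ← map_sum]
    rw [ContinuousLinearEquiv.eq_symm_apply]
    ext j
    simp [Finset.sum_apply, Pi.single_apply]
  rw [hA g, ContinuousLinearMap.sum_apply, ← hw]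
  conv_lhs => rw [h1]
  rw [map_sum]
  refine Finset.sum_congr rfl fun a _ => ?_
  rw [map_smul, ContinuousLinearMap.smul_apply, hA (x a), ← hw,
    hT _ hzt, huz a, smul_eq_mul, smul_eq_mul, mul_comm]

end Analysis

/-! ### Gluing functions and vector fields on a graded manifold -/

namespace GrAlg

variable {A : GrAlg.{u}} {B : GrAlg.{v}}

/-- The component of degree `k`. -/
def component (A : GrAlg.{u}) (k : ℤ) : A →ₗ[ℝ] A :=
  (A.gr k).subtype ∘ₗ DirectSum.component ℝ ℤ (fun i => A.gr i) k ∘ₗ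
    (LinearEquiv.ofBijective (DirectSum.coeLinearMap A.gr) A.bijective_coe).symm.toLinearMap

theorem component_mem (k : ℤ) (a : A) : A.component k a ∈ A.gr k := Subtype.property _

theorem component_lof {j : ℤ} {a : A} (ha : a ∈ A.gr j) (k : ℤ) :
    A.component k a = DirectSum.component ℝ ℤ (fun i => A.gr i) k (DirectSum.lof ℝ ℤ (fun i => A.gr i) j ⟨a, ha⟩) := by
  have h : (LinearEquiv.ofBijective (DirectSum.coeLinearMap A.gr) A.bijective_coe).symm a
      = DirectSum.lof ℝ ℤ (fun i => A.gr i) j ⟨a, ha⟩ := by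
    rw [LinearEquiv.symm_apply_eq, LinearEquiv.ofBijective_apply, DirectSum.coeLinearMap_lof]
  simp only [component, LinearMap.comp_apply, LinearEquiv.coe_coe, h]
  rfl

theorem component_of_mem {k : ℤ} {a : A} (ha : a ∈ A.gr k) : A.component k a = a := by
  rw [component_lof ha, DirectSum.component.lof_self]

theorem component_of_mem_ne {j k : ℤ} (h : j ≠ k) {a : A} (ha : a ∈ A.gr j) : A.component k a = 0 := by
  rw [component_lof ha, DirectSum.component.of, dif_neg h]
  rfl

theorem eq_zero_of_component {a : A} (h : ∀ k, A.component k a = 0) : a = 0 := by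
  have : (LinearEquiv.ofBijective (DirectSum.coeLinearMap A.gr) A.bijective_coe).symm a = 0 := by
    refine DFinsupp.ext fun k => Subtype.ext ?_
    exact h k
  rwa [LinearEquiv.symm_apply_eq, map_zero] at this

theorem Hom.map_component (φ : Hom A B) (k : ℤ) (a : A) : φ (A.component k a) = B.component k (φ a) := by
  refine A.homogeneous_induction (P := fun a => φ (A.component k a) = B.component k (φ a)) (by simp) ?_ ?_ a
  · intro a b ha hb
    simp only [map_add, ha, hb]
  · intro j a ha
    by_cases h : j = k
    · subst h
      rw [component_of_mem ha, component_of_mem (φ.map_gr ha)]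
    · rw [component_of_mem_ne h ha, component_of_mem_ne h (φ.map_gr ha), map_zero]

theorem Hom.mem_gr_of_injective (φ : Hom A B) (hφ : Function.Injective φ) {k : ℤ} {a : A}
    (h : φ a ∈ B.gr k) : a ∈ A.gr k := by
  have : a = A.component k a := hφ (by rw [φ.map_component, component_of_mem h])
  rw [this]
  exact component_mem k a

/-- Transport of a vector field along an isomorphism of algebras. -/
theorem exists_vect_of_bijective (φ : Hom A B) (hφ : Function.Bijective φ) {k : ℤ} (D : Vect B k) :
    ∃ D' : Vect A k, ∀ a, φ (D' a) = D (φ a) := by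
  let e : A ≃ₗ[ℝ] B := LinearEquiv.ofBijective φ.toAlgHom.toLinearMap hφ
  have he : ∀ b, φ (e.symm b) = b := fun b => e.apply_symm_apply b
  refine ⟨⟨e.symm.toLinearMap ∘ₗ D.1 ∘ₗ φ.toAlgHom.toLinearMap, ?_, ?_⟩, fun a => he _⟩
  · intro i a ha
    refine φ.mem_gr_of_injective hφ.1 ?_
    have h : φ (e.symm (D (φ a))) = D (φ a) := he _
    exact h ▸ Vect.map_gr D (φ.map_gr ha)
  · intro i a ha b
    apply hφ.1
    change φ (e.symm (D (φ (a * b)))) =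
      φ (e.symm (D (φ a)) * b + sgn (k * i) • (a * e.symm (D (φ b))))
    rw [map_add φ.toAlgHom, map_zsmul φ.toAlgHom, he, map_mul φ.toAlgHom a b,
      Vect.leibniz D (φ.map_gr ha), map_mul φ.toAlgHom _ b, he,
      map_mul φ.toAlgHom a (e.symm (D (φ b))), he]

end GrAlg

namespace GrSheaf

open TopologicalSpace

variable {M : Type w} [TopologicalSpace M] (F : GrSheaf.{u} M)

/-- Uniqueness of gluing, for functions without a definite degree: it holds for each homogeneous component. -/
theorem eq_zero_of_res_iSup {ι : Type w} {U : Opens M} (V : ι → Opens M) (hV : ∀ i, V i ≤ U)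
    (hU : U = ⨆ i, V i) (a : F.O U) (h : ∀ i, F.res (hV i) a = 0) : a = 0 := by
  subst hU
  refine GrAlg.eq_zero_of_component fun k => ?_
  obtain ⟨g, -, hg⟩ := F.glue V k (fun _ => 0) (fun _ => zero_mem _) (fun _ _ => by rw [map_zero, map_zero])
  rw [hg _ ⟨GrAlg.component_mem k a, fun i => ?_⟩, hg 0 ⟨zero_mem _, fun i => map_zero _⟩]
  rw [GrAlg.Hom.map_component, h i, map_zero]

/-- A function that vanishes near every point is zero. -/
theorem eq_zero_of_locally {U : Opens M} (a : F.O U)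
    (h : ∀ p ∈ U, ∃ (V : Opens M) (hV : V ≤ U), p ∈ V ∧ F.res hV a = 0) : a = 0 := by
  choose V hV hp h0 using h
  refine F.eq_zero_of_res_iSup (ι := U) (fun q => V q.1 q.2) (fun q => hV q.1 q.2) ?_ a (fun q => h0 q.1 q.2)
  refine le_antisymm (fun p hpU => ?_) (iSup_le fun q => hV q.1 q.2)
  exact Opens.mem_iSup.2 ⟨⟨p, hpU⟩, hp p hpU⟩

theorem eq_zero_of_res_pair {W C : Opens M} (hc : ∀ p, p ∈ W ∨ p ∈ C) (g : F.O ⊤)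
    (h1 : F.res (le_top : W ≤ ⊤) g = 0) (h2 : F.res (le_top : C ≤ ⊤) g = 0) : g = 0 := by
  refine F.eq_zero_of_locally g fun p _ => ?_
  rcases hc p with hp | hp
  · exact ⟨W, le_top, hp, h1⟩
  · exact ⟨C, le_top, hp, h2⟩

/-- Extension by zero, when `W` and `C` cover the space. -/
theorem exists_extension {W C : Opens M} (hc : ∀ p, p ∈ W ∨ p ∈ C) {k : ℤ} {b : F.O W}
    (hb : b ∈ (F.O W).gr k) (h0 : F.res (inf_le_left : W ⊓ C ≤ W) b = 0) :
    ∃ g ∈ (F.O ⊤).gr k, F.res (le_top : W ≤ ⊤) g = b ∧ F.res (le_top : C ≤ ⊤) g = 0 := by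
  let U : ULift.{w} Bool → Opens M := fun t => if t.down then W else C
  let f : ∀ t, F.O (U t) := fun t => match t with
    | ⟨true⟩ => b
    | ⟨false⟩ => (0 : F.O C)
  have h0' : F.res (inf_le_right : C ⊓ W ≤ W) b = 0 := by
    have : F.res (le_of_eq (inf_comm _ _) : C ⊓ W ≤ W ⊓ C) (F.res (inf_le_left : W ⊓ C ≤ W) b) = 0 := by
      rw [h0, map_zero]
    rwa [F.res_res] at this
  obtain ⟨g, ⟨hg, hgf⟩, -⟩ := F.glue U k f (by
      rintro ⟨_ | _⟩
      · exact zero_mem _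
      · exact hb) (by
      rintro ⟨_ | _⟩ ⟨_ | _⟩
      · rfl
      · change F.res (inf_le_left : C ⊓ W ≤ C) 0 = F.res (inf_le_right : C ⊓ W ≤ W) b
        rw [map_zero, h0']
      · change F.res (inf_le_left : W ⊓ C ≤ W) b = F.res (inf_le_right : W ⊓ C ≤ C) 0
        rw [map_zero, h0]
      · rfl)
  have htop : (⊤ : Opens M) ≤ ⨆ i, U i := by
    intro p _
    rcases hc p with hp | hp
    · exact Opens.mem_iSup.2 ⟨⟨true⟩, hp⟩
    · exact Opens.mem_iSup.2 ⟨⟨false⟩, hp⟩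
  refine ⟨F.res htop g, (F.res htop).map_gr hg, ?_, ?_⟩
  · rw [F.res_res]
    exact hgf ⟨true⟩
  · rw [F.res_res]
    exact hgf ⟨false⟩

/-- A vector field on `W`, multiplied by a function that vanishes on `C`, extends by zero to a global vector
field, when `W` and `C` cover the space. -/
theorem exists_vect_extension {W C : Opens M} (hc : ∀ p, p ∈ W ∨ p ∈ C) {k : ℤ} (D : GrAlg.Vect (F.O W) k)
    {χ : F.O W} (hχ : χ ∈ (F.O W).gr 0) (h0 : F.res (inf_le_left : W ⊓ C ≤ W) χ = 0) :
    ∃ Z : GrAlg.Vect (F.O ⊤) k, ∀ a, F.res (le_top : W ≤ ⊤) (Z a) = χ * D (F.res le_top a) ∧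
      F.res (le_top : C ≤ ⊤) (Z a) = 0 := by
  let D' : GrAlg.Vect (F.O W) k := GrAlg.Vect.cast (zero_add k) (GrAlg.Vect.leftMul hχ D)
  have hD' : ∀ a, D' a = χ * D a := fun a => rfl
  have huniq : ∀ g g' : F.O ⊤, F.res (le_top : W ≤ ⊤) g = F.res le_top g' →
      F.res (le_top : C ≤ ⊤) g = F.res le_top g' → g = g' := by
    intro g g' h1 h2
    rw [← sub_eq_zero]
    refine F.eq_zero_of_res_pair hc _ ?_ ?_
    · rw [map_sub, h1, sub_self]
    · rw [map_sub, h2, sub_self]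
  have hhom : ∀ i, ∀ a ∈ (F.O ⊤).gr i, ∃ g ∈ (F.O ⊤).gr (i + k),
      F.res (le_top : W ≤ ⊤) g = D' (F.res le_top a) ∧ F.res (le_top : C ≤ ⊤) g = 0 := by
    intro i a ha
    refine F.exists_extension hc (GrAlg.Vect.map_gr D' ((F.res le_top).map_gr ha)) ?_
    rw [hD', map_mul, h0, zero_mul]
  have hex : ∀ a : F.O ⊤, ∃ g, F.res (le_top : W ≤ ⊤) g = D' (F.res le_top a) ∧
      F.res (le_top : C ≤ ⊤) g = 0 := by
    intro a
    refine (F.O ⊤).homogeneous_induction (P := fun a => ∃ g, F.res (le_top : W ≤ ⊤) g = D' (F.res le_top a) ∧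
      F.res (le_top : C ≤ ⊤) g = 0) ⟨0, by simp⟩ ?_ ?_ a
    · rintro a b ⟨g, h1, h2⟩ ⟨g', h1', h2'⟩
      exact ⟨g + g', by rw [map_add, map_add, map_add, h1, h1'], by rw [map_add, h2, h2', add_zero]⟩
    · intro i a ha
      obtain ⟨g, -, h⟩ := hhom i a ha
      exact ⟨g, h⟩
  choose Z hZ1 hZ2 using hex
  refine ⟨⟨{ toFun := Z, map_add' := ?_, map_smul' := ?_ }, ?_, ?_⟩, fun a => ⟨hZ1 a, hZ2 a⟩⟩
  · intro a b
    refine huniq _ _ ?_ ?_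
    · rw [map_add, hZ1, hZ1, hZ1, map_add, map_add]
    · rw [map_add, hZ2, hZ2, hZ2, add_zero]
  · intro c a
    refine huniq _ _ ?_ ?_
    · rw [map_smul, hZ1, map_smul, map_smul, RingHom.id_apply, hZ1]
    · rw [map_smul, hZ2, RingHom.id_apply, hZ2, smul_zero]
  · intro i a ha
    obtain ⟨g, hg, h1, h2⟩ := hhom i a ha
    have : Z a = g := huniq _ _ ((hZ1 a).trans h1.symm) ((hZ2 a).trans h2.symm)
    change Z a ∈ _
    rw [this]
    exact hg
  · intro i a ha b
    refine huniq _ _ ?_ ?_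
    · change F.res le_top (Z (a * b)) = F.res le_top (Z a * b + sgn (k * i) • (a * Z b))
      rw [map_add, map_zsmul, map_mul, map_mul, hZ1, hZ1, hZ1, map_mul,
        GrAlg.Vect.leibniz D' ((F.res le_top).map_gr ha)]
    · change F.res le_top (Z (a * b)) = F.res le_top (Z a * b + sgn (k * i) • (a * Z b))
      rw [map_add, map_zsmul, map_mul, map_mul, hZ2, hZ2, hZ2, zero_mul, mul_zero, smul_zero, add_zero]

end GrSheaf

/-! ### Differential forms in coordinates -/

namespace GrAlg

variable {A : GrAlg.{u}} {r : ℕ} {d : Fin r → ℤ}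

theorem list_sum_single_apply (l : List (Fin r)) (j : Fin r) :
    ((l.map fun i => Finsupp.single i 1).sum : Fin r →₀ ℕ) j = l.count j := by
  induction l with
  | nil => simp
  | cons i l ih =>
    rw [List.map_cons, List.sum_cons, Finsupp.add_apply, ih, List.count_cons, Finsupp.single_apply, add_comm]
    simp

/-- A product of distinct variables is, up to sign, a single monomial. -/
theorem coeff_list_prod_var (l : List (Fin r)) (hl : l.Nodup) :
    ∃ ε : ℤ, ε * ε = 1 ∧ ∀ L, coeff L (l.map (var A d)).prod =
      if L = (l.map fun i => Finsupp.single i 1).sum then ε • (1 : A) else 0 := by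
  classical
  induction l with
  | nil =>
    refine ⟨1, by norm_num, fun L => ?_⟩
    have := coeff_const (d := d) (1 : A) L
    rw [map_one (const A d).toAlgHom] at this
    rw [List.map_nil, List.prod_nil, List.map_nil, List.sum_nil, one_smul, this]
  | cons i l ih =>
    obtain ⟨hi, hl'⟩ := List.nodup_cons.1 hl
    obtain ⟨ε, hε, h⟩ := ih hl'
    set s : Fin r →₀ ℕ := (l.map fun i => Finsupp.single i 1).sum with hs
    have hmono : IsMono d (Finsupp.single i 1 + s) := by
      intro j _
      have := list_sum_single_apply (i :: l) j
      rw [List.map_cons, List.sum_cons, ← hs] at this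
      rw [this]
      exact List.nodup_iff_count_le_one.1 hl j
    refine ⟨sgn (mswap d (Finsupp.single i 1) s) * ε, ?_, fun L => ?_⟩
    · rw [mul_mul_mul_comm, sgn_mul_self, hε, one_mul]
    · rw [List.map_cons, List.prod_cons, List.map_cons, List.sum_cons, ← hs]
      by_cases hLi : L i = 0
      · rw [coeff_var_mul_of_eq_zero _ _ hLi, if_neg]
        rintro rfl
        simp at hLi
      · obtain ⟨M, rfl⟩ : ∃ M, L = Finsupp.single i 1 + M :=
          ⟨L - Finsupp.single i 1, (add_tsub_cancel_of_le (by
            rw [Finsupp.single_le_iff]; omega)).symm⟩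
        by_cases hM : IsMono d (Finsupp.single i 1 + M)
        · rw [coeff_var_mul _ _ hM, h]
          by_cases hMs : M = s
          · rw [if_pos hMs, if_pos (by rw [hMs]), map_zsmul, map_one (A.twist (d i)), smul_smul, hMs]
          · rw [if_neg hMs, if_neg (fun e => hMs (add_left_cancel e)), map_zero, smul_zero]
        · rw [coeff_of_not_isMono hM, if_neg]
          intro e
          rw [e] at hM
          exact hM hmono

/-- A homomorphism from an exterior algebra that takes a basis to distinct variables is injective. -/
theorem lift_exteriorAlgebra_injective (hA : (1 : A) ≠ 0) {n : ℕ} {V : Type v} [AddCommGroup V] [Module ℝ V]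
    (b : Module.Basis (Fin n) ℝ V) {σ : Fin n → Fin r} (hσ : Function.Injective σ)
    (Λ : ExteriorAlgebra ℝ V →ₐ[ℝ] formal A d)
    (hΛ : ∀ a, Λ (ExteriorAlgebra.ι ℝ (b a)) = var A d (σ a)) {w : ExteriorAlgebra ℝ V} (hw : Λ w = 0) :
    w = 0 := by
  classical
  -- the basis of the exterior algebra indexed by sets `S` is mapped to products of distinct variables
  let em : ∀ S : Finset (Fin n), Fin S.card ↪o Fin n := fun S =>
    Set.powersetCard.ofFinEmbEquiv.symm (Set.powersetCard.ofCard (rfl : S.card = S.card))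
  let l : Finset (Fin n) → List (Fin r) := fun S => List.ofFn fun i => σ (em S i)
  have hl : ∀ S, (l S).Nodup := fun S => List.nodup_ofFn.2 (hσ.comp (em S).injective)
  have hmem : ∀ S a, σ a ∈ l S ↔ a ∈ S := by
    intro S a
    rw [List.mem_ofFn', Set.mem_range]
    constructor
    · rintro ⟨i, hi⟩
      rw [← hσ hi]
      exact (Set.powersetCard.mem_range_ofFinEmbEquiv_symm_iff_mem _ _).1 ⟨i, rfl⟩
    · intro ha
      have : a ∈ Set.range (em S) :=
        (Set.powersetCard.mem_range_ofFinEmbEquiv_symm_iff_mem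
          (Set.powersetCard.ofCard (rfl : S.card = S.card)) a).2 ha
      obtain ⟨i, hi⟩ := this
      exact ⟨i, by rw [hi]⟩
  let ms : Finset (Fin n) → (Fin r →₀ ℕ) := fun S => ((l S).map fun i => Finsupp.single i 1).sum
  have hms : Function.Injective ms := by
    intro S T h
    ext a
    have := DFunLike.congr_fun h (σ a)
    simp only [ms] at this
    rw [list_sum_single_apply, list_sum_single_apply] at this
    rw [← hmem S, ← hmem T, ← List.count_pos_iff, ← List.count_pos_iff, this]
  have hbasis : ∀ S, Λ (b.ExteriorAlgebra S) = ((l S).map (var A d)).prod := by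
    intro S
    rw [ExteriorAlgebra.basis_apply_ofCard b (rfl : S.card = S.card)]
    change Λ (ExteriorAlgebra.ιMulti ℝ S.card (fun i => b (em S i))) = _
    rw [ExteriorAlgebra.ιMulti_apply, map_list_prod,
      List.map_ofFn, List.map_ofFn]
    congr 2
    funext i
    exact hΛ _
  choose ε hε h using fun S => coeff_list_prod_var (A := A) (d := d) (l S) (hl S)
  have hrepr := b.ExteriorAlgebra.sum_repr w
  have hz : ∀ S, b.ExteriorAlgebra.repr w S = 0 := by
    intro S
    have h1 : coeff (ms S) (Λ w) = b.ExteriorAlgebra.repr w S • (ε S • (1 : A)) := by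
      conv_lhs => rw [← hrepr]
      rw [map_sum, map_sum, Finset.sum_eq_single S]
      · rw [map_smul, map_smul, hbasis, h, if_pos rfl]
      · intro T _ hT
        rw [map_smul, map_smul, hbasis, h, if_neg, smul_zero]
        exact fun e => hT (hms e).symm
      · intro hS
        exact absurd (Finset.mem_univ S) hS
    rw [hw, map_zero] at h1
    have h2 : ε S • (b.ExteriorAlgebra.repr w S • (ε S • (1 : A))) = 0 := by rw [← h1, smul_zero]
    rw [smul_comm (ε S), smul_smul (ε S), hε, one_smul] at h2
    exact (smul_eq_zero.1 h2).resolve_right hA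
  rw [← hrepr]
  exact Finset.sum_eq_zero fun S _ => by rw [hz, zero_smul]

end GrAlg

section Coordinates

open Topology GrAlg

variable {n : ℕ} {X : Type v} [TopologicalSpace X] [ChartedSpace (EuclideanSpace ℝ (Fin n)) X]

theorem dfunT1_apply (f : C^∞⟮𝓡 n, X; ℝ⟯) (z : X) :
    (dfunT1 f).1 z = ExteriorAlgebra.ι ℝ (diffAt f z) := by
  change ExteriorAlgebra.ιMulti ℝ 1 (fun _ => diffAt f z) = _
  rw [ExteriorAlgebra.ιMulti_apply]
  simp

theorem funT1_apply (f : C^∞⟮𝓡 n, X; ℝ⟯) (z : X) : (funT1 f).1 z = algebraMap ℝ (CotExt n) (f z) :=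
  (Algebra.algebraMap_eq_smul_one _).symm

theorem functionsT1_ext {a b : functionsT1 n X} (h : ∀ z, a.1 z = b.1 z) : a = b := Subtype.ext (funext h)

/-- There are no differential forms of negative degree, or of degree above the dimension. -/
theorem functionsT1_eq_zero {k : ℤ} (hk : k < 0 ∨ (n : ℤ) < k) {a : functionsT1 n X}
    (ha : a ∈ (functionsT1 n X).gr k) : a = 0 := by
  refine functionsT1_ext fun z => ?_
  change a.1 z = 0
  rcases smoothForms_pointwise ha z with ⟨_, h⟩ | ⟨p, rfl, h⟩
  · exact h
  · have hp : n < p := by omega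
    have h1 : Module.finrank ℝ (⋀[ℝ]^p (EuclideanSpace ℝ (Fin n) →L[ℝ] ℝ)) = 0 := by
      rw [exteriorPower.finrank_eq, (LinearMap.toContinuousLinearMap (𝕜 := ℝ) (E := EuclideanSpace ℝ (Fin n))
        (F' := ℝ)).symm.finrank_eq, Module.finrank_linearMap_self, finrank_euclideanSpace_fin,
        Nat.choose_eq_zero_of_lt hp]
    have h2 := Module.finrank_zero_iff.1 h1
    have := Subsingleton.elim (⟨a.1 z, h⟩ : ⋀[ℝ]^p (EuclideanSpace ℝ (Fin n) →L[ℝ] ℝ)) 0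
    exact congrArg Subtype.val this

variable (x : Fin n → C^∞⟮𝓡 n, X; ℝ⟯) {r : ℕ} (deg : Fin r → ℤ)

/-- Pairs of a differential form and its expression as a polynomial in coordinates `θ^a = dx^a`, seen as a
power series in the `θ^a` and in further coordinates of degrees `deg`. -/
def coordinatePairs : Subalgebra ℝ (functionsT1 n X ×
    formal (ofComm C^∞⟮𝓡 n, X; ℝ⟯) (Fin.append (fun _ : Fin n => (1 : ℤ)) deg)) :=
  Algebra.adjoin ℝ (Set.range (fun f : C^∞⟮𝓡 n, X; ℝ⟯ => (funT1 f, const (ofComm C^∞⟮𝓡 n, X; ℝ⟯) _ f)) ∪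
    Set.range (fun a : Fin n => (dfunT1 (x a), var _ _ (Fin.castAdd r a))))

theorem funT1_pair (f : C^∞⟮𝓡 n, X; ℝ⟯) :
    (funT1 f, const (ofComm C^∞⟮𝓡 n, X; ℝ⟯) _ f) ∈ coordinatePairs x deg :=
  Algebra.subset_adjoin (Or.inl ⟨f, rfl⟩)

theorem dfunT1_pair (a : Fin n) :
    (dfunT1 (x a), var (ofComm C^∞⟮𝓡 n, X; ℝ⟯) _ (Fin.castAdd r a)) ∈ coordinatePairs x deg :=
  Algebra.subset_adjoin (Or.inr ⟨a, rfl⟩)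

/-- A multi-index without the coordinates that are not on the base. -/
def IsBasic (K : Fin (n + r) →₀ ℕ) : Prop := ∀ j : Fin r, K (Fin.natAdd n j) = 0

/-- Expressions of differential forms do not contain the coordinates that are not on the base. -/
theorem coeff_coordinatePairs {b} (hb : b ∈ coordinatePairs x deg) {K : Fin (n + r) →₀ ℕ} (hK : ¬ IsBasic K) :
    coeff K b.2 = 0 := by
  classical
  obtain ⟨j, hj⟩ := not_forall.1 hK
  have hne : ∀ L : Fin (n + r) →₀ ℕ, L (Fin.natAdd n j) = 0 → K ≠ L := by
    rintro L hL rfl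
    exact hj hL
  clear hK
  induction hb using Algebra.adjoin_induction generalizing K with
  | mem b hb =>
    rcases hb with ⟨f, rfl⟩ | ⟨a, rfl⟩
    · exact (coeff_const (A := ofComm C^∞⟮𝓡 n, X; ℝ⟯) f K).trans (if_neg (hne 0 rfl))
    · refine (coeff_var _ K).trans (if_neg (hne _ ?_))
      rw [Finsupp.single_apply, if_neg]
      intro h
      have := congrArg Fin.val h
      simp at this
      omega
  | algebraMap t =>
    have : coeff K (const (ofComm C^∞⟮𝓡 n, X; ℝ⟯) (Fin.append (fun _ : Fin n => (1 : ℤ)) deg)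
        (algebraMap ℝ _ t)) = 0 := (coeff_const _ K).trans (if_neg (hne 0 rfl))
    rwa [AlgHom.commutes] at this
  | add b c _ _ hb hc =>
    rw [Prod.snd_add, map_add, hb hj hne, hc hj hne, add_zero]
  | mul b c _ _ hb hc =>
    by_cases hmono : IsMono (Fin.append (fun _ : Fin n => (1 : ℤ)) deg) K
    · rw [Prod.snd_mul, coeff_mul hmono]
      refine Finset.sum_eq_zero fun p hp => ?_
      have h := Finset.HasAntidiagonal.mem_antidiagonal.1 hp
      by_cases h1 : p.1 (Fin.natAdd n j) = 0
      · have h2 : p.2 (Fin.natAdd n j) ≠ 0 := by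
          intro h2
          apply hj
          rw [← h, Finsupp.add_apply, h1, h2]
        rw [hc h2 (fun L hL e => h2 (by rw [e, hL])), map_zero, mul_zero, smul_zero]
      · rw [hb h1 (fun L hL e => h1 (by rw [e, hL])), zero_mul, smul_zero]
    · exact coeff_of_not_isMono hmono _

/-- The evaluation of a smooth function at a point. -/
def evalAlgHom {m : ℕ} {M : Type w} [TopologicalSpace M] [ChartedSpace (EuclideanSpace ℝ (Fin m)) M] (z : M) :
    C^∞⟮𝓡 m, M; ℝ⟯ →ₐ[ℝ] ℝ where
  toFun f := f z
  map_one' := rfl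
  map_mul' _ _ := rfl
  map_zero' := rfl
  map_add' _ _ := rfl
  commutes' _ := rfl

/-- The monomials in the base coordinates are expressions of differential forms. -/
theorem exists_pair_term {K : Fin (n + r) →₀ ℕ} (hK : IsBasic K)
    (hmono : IsMono (Fin.append (fun _ : Fin n => (1 : ℤ)) deg) K) :
    ∃ b, (b, term (ofComm C^∞⟮𝓡 n, X; ℝ⟯) _ K 1) ∈ coordinatePairs x deg := by
  classical
  obtain ⟨N, hN⟩ : ∃ N, ∑ i, K i = N := ⟨_, rfl⟩
  induction N generalizing K with
  | zero =>
    have : K = 0 := by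
      ext i
      exact (Finset.sum_eq_zero_iff.1 hN) i (Finset.mem_univ i)
    subst this
    exact ⟨1, one_mem (coordinatePairs x deg)⟩
  | succ N ih =>
    have : ∃ i, K i ≠ 0 := by
      by_contra! h
      rw [Finset.sum_eq_zero fun i _ => h i] at hN
      omega
    obtain ⟨i, hi⟩ := this
    obtain ⟨a, rfl⟩ : ∃ a, i = Fin.castAdd r a := by
      induction i using Fin.addCases with
      | left a => exact ⟨a, rfl⟩
      | right j => exact absurd (hK j) hi
    obtain ⟨M, rfl⟩ : ∃ M, K = Finsupp.single (Fin.castAdd r a) 1 + M :=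
      ⟨K - Finsupp.single _ 1, (add_tsub_cancel_of_le (by rw [Finsupp.single_le_iff]; omega)).symm⟩
    obtain ⟨b, hb⟩ := ih (K := M) (fun j => by have := hK j; simp at this; exact this.2) hmono.right (by
      simp only [Finsupp.add_apply, Finset.sum_add_distrib] at hN
      rw [Finset.sum_eq_single (Fin.castAdd r a)] at hN
      · rw [Finsupp.single_eq_same] at hN; omega
      · intro j _ hj
        rw [Finsupp.single_apply, if_neg hj.symm]
      · simp)
    refine ⟨sgn (mswap (Fin.append (fun _ : Fin n => (1 : ℤ)) deg) (Finsupp.single (Fin.castAdd r a) 1) M) •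
      (dfunT1 (x a) * b), ?_⟩
    have h := zsmul_mem (mul_mem (dfunT1_pair x deg a) hb)
      (sgn (mswap (Fin.append (fun _ : Fin n => (1 : ℤ)) deg) (Finsupp.single (Fin.castAdd r a) 1) M))
    rw [Prod.mk_mul_mk, Prod.smul_mk] at h
    convert h using 2
    refine formal_ext fun L hL => ?_
    rw [coeff_term _ _ hmono, map_zsmul]
    by_cases hLi : L (Fin.castAdd r a) = 0
    · rw [coeff_var_mul_of_eq_zero _ _ hLi, if_neg, smul_zero]
      rintro rfl
      simp at hLi
    · obtain ⟨L, rfl⟩ : ∃ M, L = Finsupp.single (Fin.castAdd r a) 1 + M :=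
        ⟨L - Finsupp.single _ 1, (add_tsub_cancel_of_le (by rw [Finsupp.single_le_iff]; omega)).symm⟩
      rw [coeff_var_mul _ _ hL, coeff_term _ _ hmono.right]
      by_cases hLM : L = M
      · rw [if_pos hLM, if_pos (by rw [hLM]), map_one ((ofComm C^∞⟮𝓡 n, X; ℝ⟯).twist _), smul_smul, hLM,
          sgn_mul_self, one_smul]
      · rw [if_neg hLM, if_neg (fun e => hLM (add_left_cancel e)), map_zero, smul_zero, smul_zero]

/-- The value of a form at a point where the `dx^a` are independent is determined by the value of its
expression. -/
theorem eq_zero_of_coordinatePairs {b} (hb : b ∈ coordinatePairs x deg) (z : X)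
    (hz : LinearIndependent ℝ (fun a => diffAt (x a) z))
    (h : ∀ K, (show C^∞⟮𝓡 n, X; ℝ⟯ from coeff K b.2) z = 0) : b.1.1 z = 0 := by
  classical
  let dd := Fin.append (fun _ : Fin n => (1 : ℤ)) deg
  let bz := basisOfLinearIndependentOfCardEqFinrank' _ hz (by
    rw [(LinearMap.toContinuousLinearMap (𝕜 := ℝ) (E := EuclideanSpace ℝ (Fin n))
        (F' := ℝ)).symm.finrank_eq, Module.finrank_linearMap_self, finrank_euclideanSpace_fin, Fintype.card_fin])
  have hbz : ∀ a, bz a = diffAt (x a) z := fun a => by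
    simp only [bz, coe_basisOfLinearIndependentOfCardEqFinrank']
  -- evaluation of the coefficients at `z` identifies the expressions with elements of an exterior algebra
  let R := ofComm ℝ
  let f : (EuclideanSpace ℝ (Fin n) →L[ℝ] ℝ) →ₗ[ℝ] formal R dd :=
    bz.constr ℝ fun a => var R dd (Fin.castAdd r a)
  have hf : ∀ a, f (bz a) = var R dd (Fin.castAdd r a) := fun a => bz.constr_basis ℝ _ a
  have hmem : ∀ v, f v ∈ (formal R dd).gr 1 := by
    intro v
    rw [← bz.sum_repr v, map_sum]
    refine Submodule.sum_mem _ fun a _ => ?_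
    rw [map_smul, hf]
    refine Submodule.smul_mem _ _ ?_
    have := var_mem (A := R) (d := dd) (Fin.castAdd r a)
    rwa [show dd (Fin.castAdd r a) = 1 from Fin.append_left _ _ _] at this
  have hsq : ∀ v, f v * f v = 0 := by
    intro v
    have := (formal R dd).comm (hmem v) (hmem v)
    rw [sgn_odd (by decide), neg_one_smul, eq_neg_iff_add_eq_zero, ← two_smul ℝ] at this
    exact (smul_eq_zero.1 this).resolve_left two_ne_zero
  let Λ := ExteriorAlgebra.lift ℝ ⟨f, hsq⟩
  have hι : ∀ v, Λ (ExteriorAlgebra.ι ℝ v) = f v := fun v => ExteriorAlgebra.lift_ι_apply ℝ f hsq v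
  let ev : Hom (ofComm C^∞⟮𝓡 n, X; ℝ⟯) R := ofCommMap (evalAlgHom z)
  have key : ∀ b ∈ coordinatePairs x deg, Λ (b.1.1 z) = ev.formalMap dd b.2 := by
    intro b hb
    induction hb using Algebra.adjoin_induction with
    | mem b hb =>
      rcases hb with ⟨f, rfl⟩ | ⟨a, rfl⟩
      · change Λ ((funT1 f).1 z) = ev.formalMap dd (const _ dd f)
        have e : ev.formalMap dd (const _ dd f) = const R dd (f z) := formalMap_const ev _
        rw [e, funT1_apply, AlgHom.commutes]
        exact (AlgHom.commutes (const R dd).toAlgHom (f z)).symm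
      · change Λ ((dfunT1 (x a)).1 z) = ev.formalMap dd (var _ dd (Fin.castAdd r a))
        rw [formalMap_var, dfunT1_apply, hι, ← hbz, hf]
    | algebraMap t => exact (AlgHom.commutes Λ t).trans (AlgHom.commutes (ev.formalMap dd).toAlgHom t).symm
    | add b c _ _ hb hc =>
      rw [Prod.snd_add, map_add, ← hb, ← hc, ← map_add]
      rfl
    | mul b c _ _ hb hc =>
      rw [Prod.snd_mul, map_mul, ← hb, ← hc, ← map_mul]
      rfl
  refine lift_exteriorAlgebra_injective (A := R) (d := dd) (one_ne_zero (α := ℝ)) bz (Fin.castAdd_injective n r) Λ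
    (fun a => by rw [hι, hf]) ?_
  rw [key b hb]
  refine formal_ext fun K _ => ?_
  rw [coeff_formalMap, map_zero]
  exact h K

/-- Every covector is the differential of a function. -/
theorem exists_diffAt_eq [T2Space X] [IsManifold (𝓡 n) ∞ X] (z : X) (φ : EuclideanSpace ℝ (Fin n) →L[ℝ] ℝ) :
    ∃ g : C^∞⟮𝓡 n, X; ℝ⟯, diffAt g z = φ := by
  obtain ⟨g, hg⟩ := exists_contMDiffMap_eventuallyEq (h := fun y => φ (extChartAt (𝓡 n) z y))
    (isOpen_extChartAt_source (I := 𝓡 n) z) (by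
      rw [extChartAt_source]
      exact φ.contDiff.contMDiff.comp_contMDiffOn (contMDiffOn_extChartAt (n := ∞)))
    (mem_extChartAt_source (I := 𝓡 n) z)
  refine ⟨g, ?_⟩
  have h := (g.contMDiff.mdifferentiableAt (x := z) (by simp)).mfderiv
  rw [diffAt, h]
  simp only [writtenInExtChartAt, ModelWithCorners.range_eq_univ, fderivWithin_univ]
  have h1 : (extChartAt 𝓘(ℝ, ℝ) (g z) ∘ g ∘ (extChartAt (𝓡 n) z).symm) =ᶠ[𝓝 (extChartAt (𝓡 n) z z)] φ := by
    have h2 : Filter.Tendsto (extChartAt (𝓡 n) z).symm (𝓝 (extChartAt (𝓡 n) z z)) (𝓝 z) := by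
      have := (continuousAt_extChartAt_symm (I := 𝓡 n) z).tendsto
      rwa [extChartAt_to_inv] at this
    filter_upwards [h2.eventually hg, (isOpen_extChartAt_target z).mem_nhds (mem_extChartAt_target z)]
      with y hy hyt
    simp only [Function.comp_apply, extChartAt_model_space_eq_id, PartialEquiv.refl_coe, id]
    rw [hy, (extChartAt (𝓡 n) z).right_inv hyt]
  rw [h1.fderiv_eq]
  exact φ.fderiv

/-- Coordinates near a point in which every form has an expression. -/
theorem exists_coordinate_nhds [T2Space X] [IsManifold (𝓡 n) ∞ X] (x₀ : X)
    (hx : LinearIndependent ℝ (fun a => diffAt (x a) x₀)) :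
    ∃ O : Set X, IsOpen O ∧ x₀ ∈ O ∧ ∀ y ∈ O, LinearIndependent ℝ (fun a => diffAt (x a) y) ∧
      ∀ b : functionsT1 n X, ∃ b' ∈ coordinatePairs x deg, ∀ᶠ z in 𝓝 y, b.1 z = b'.1.1 z := by
  obtain ⟨O, hO, hx₀, hfr⟩ := exists_frame x x₀ hx
  refine ⟨O, hO, hx₀, fun y hy => ⟨?_, fun b => ?_⟩⟩
  · refine linearIndependent_of_top_le_span_of_card_eq_finrank ?_ ?_
    · intro φ _
      obtain ⟨g, rfl⟩ := exists_diffAt_eq y φ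
      obtain ⟨u, hu⟩ := hfr g y hy
      rw [hu.self_of_nhds]
      exact Submodule.sum_mem _ fun a _ => Submodule.smul_mem _ _ (Submodule.subset_span ⟨a, rfl⟩)
    · rw [(LinearMap.toContinuousLinearMap (𝕜 := ℝ) (E := EuclideanSpace ℝ (Fin n))
        (F' := ℝ)).symm.finrank_eq, Module.finrank_linearMap_self, finrank_euclideanSpace_fin, Fintype.card_fin]
  -- the fields of exterior forms with an expression near `y` form a subalgebra that contains functions and
  -- differentials
  · let G : Subalgebra ℝ (X → CotExt n) :=
      { carrier := {α | ∃ b' ∈ coordinatePairs x deg, ∀ᶠ z in 𝓝 y, α z = b'.1.1 z}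
        mul_mem' := by
          rintro α β ⟨a, ha, h⟩ ⟨b, hb, h'⟩
          refine ⟨a * b, mul_mem ha hb, ?_⟩
          filter_upwards [h, h'] with z h1 h2
          rw [Pi.mul_apply, h1, h2]
          rfl
        add_mem' := by
          rintro α β ⟨a, ha, h⟩ ⟨b, hb, h'⟩
          refine ⟨a + b, add_mem ha hb, ?_⟩
          filter_upwards [h, h'] with z h1 h2
          rw [Pi.add_apply, h1, h2]
          rfl
        algebraMap_mem' := fun t =>
          ⟨algebraMap ℝ _ t, Subalgebra.algebraMap_mem _ t, Filter.Eventually.of_forall fun _ => rfl⟩ }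
    have hGfun : ∀ f : C^∞⟮𝓡 n, X; ℝ⟯, (fun z => algebraMap ℝ (CotExt n) (f z)) ∈ G := fun f =>
      ⟨_, funT1_pair x deg f, Filter.Eventually.of_forall fun z => (funT1_apply f z).symm⟩
    have hGd : ∀ g : C^∞⟮𝓡 n, X; ℝ⟯, (fun z => ExteriorAlgebra.ι ℝ (diffAt g z)) ∈ G := by
      intro g
      obtain ⟨u, hu⟩ := hfr g y hy
      refine ⟨∑ a, (funT1 (u a), const (ofComm C^∞⟮𝓡 n, X; ℝ⟯) _ (u a)) *
        (dfunT1 (x a), var _ _ (Fin.castAdd r a)), Subalgebra.sum_mem _ fun a _ =>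
          mul_mem (funT1_pair x deg _) (dfunT1_pair x deg a), ?_⟩
      filter_upwards [hu] with z hz
      rw [hz, map_sum, Prod.fst_sum]
      let ev : functionsT1 n X →+ CotExt n :=
        { toFun := fun a => a.1 z, map_zero' := rfl, map_add' := fun _ _ => rfl }
      change _ = ev _
      rw [map_sum]
      refine Finset.sum_congr rfl fun a _ => ?_
      rw [map_smul]
      change _ = (funT1 (u a)).1 z * (dfunT1 (x a)).1 z
      rw [funT1_apply, dfunT1_apply, Algebra.smul_def]
    have hGspan : ∀ k, ∀ η ∈ formSpan n X k, η ∈ G := by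
      intro k η hη
      refine (Submodule.span_le (p := Subalgebra.toSubmodule G)).2 ?_ hη
      rintro _ ⟨p, -, f, g, rfl⟩
      have : (fun z => f z • ExteriorAlgebra.ιMulti ℝ p (fun i => diffAt (g i) z)) =
          (fun z => algebraMap ℝ (CotExt n) (f z)) *
            (List.ofFn fun i => (fun z => ExteriorAlgebra.ι ℝ (diffAt (g i) z))).prod := by
        funext z
        rw [Pi.mul_apply, ← Algebra.smul_def]
        congr 1
        have e := map_list_prod (Pi.evalMonoidHom (fun _ : X => CotExt n) z)
          (List.ofFn fun i => (fun z => ExteriorAlgebra.ι ℝ (diffAt (g i) z)))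
        rw [List.map_ofFn] at e
        rw [ExteriorAlgebra.ιMulti_apply]
        exact e.symm
      rw [this]
      change _ ∈ G
      refine G.mul_mem (hGfun f) (list_prod_mem ?_)
      intro α hα
      rw [List.mem_ofFn'] at hα
      obtain ⟨i, rfl⟩ := hα
      exact hGd _
    have hGsm : ∀ k, ∀ α ∈ smoothForms n X k, α ∈ G := by
      intro k α hα
      obtain ⟨η, hη, h⟩ := hα y
      obtain ⟨b', hb', h'⟩ := hGspan k η hη
      refine ⟨b', hb', ?_⟩
      filter_upwards [h, h'] with z h1 h2
      rw [h1, h2]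
    exact Submodule.iSup_induction (smoothForms n X) (motive := fun α => α ∈ G) b.2
      hGsm (zero_mem _) fun a b ha hb => add_mem ha hb

end Coordinates

/-! ### Charts of a graded bundle -/

namespace GradedBundle

open Topology GrAlg TopologicalSpace

variable {n : ℕ} {X : Type v} [TopologicalSpace X] [ChartedSpace (EuclideanSpace ℝ (Fin n)) X]
  {m : ℕ} {M : Type w} [TopologicalSpace M] [ChartedSpace (EuclideanSpace ℝ (Fin m)) M]
  (E : GradedBundle.{u} n X m M)

/-- The degrees of the coordinates of `E` other than those of the body. -/
abbrev totalDeg : Fin (n + E.rank) → ℤ := Fin.append (fun _ : Fin n => (1 : ℤ)) E.deg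

/-- Pullback of functions on `X` to an open part of the body of `E`. -/
def bodyHom (V : Opens M) : C^∞⟮𝓡 n, X; ℝ⟯ →ₐ[ℝ] C^∞⟮𝓡 m, V; ℝ⟯ where
  toFun f := ⟨fun q : V => f (E.body q.1), f.contMDiff.comp (E.body.contMDiff.comp contMDiff_subtype_val)⟩
  map_one' := rfl
  map_mul' _ _ := rfl
  map_zero' := rfl
  map_add' _ _ := rfl
  commutes' _ := rfl

/-- Application of the pullback of functions from `X` to the coefficients of a series. -/
def bodySeries (V : Opens M) :
    Hom (formal (ofComm C^∞⟮𝓡 n, X; ℝ⟯) E.totalDeg) (localModel m E.totalDeg V) :=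
  (ofCommMap (E.bodyHom V)).formalMap E.totalDeg

/-- A chart of `E` over `W` with coordinates `θ^a = dx^a`, such that every form on `X` has an expression in
the `dx^a` near every point in the image of `W`. -/
structure Chart (W : Opens M) where
  Φ : GrChart m E.sheaf E.totalDeg W
  x : Fin n → C^∞⟮𝓡 n, X; ℝ⟯
  indep : ∀ q ∈ W, LinearIndependent ℝ (fun a => diffAt (x a) (E.body q))
  germ : ∀ q ∈ W, ∀ b : functionsT1 n X, ∃ b' ∈ coordinatePairs x E.deg,
    ∀ᶠ z in 𝓝 (E.body q), b.1 z = b'.1.1 z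
  map_pair : ∀ b ∈ coordinatePairs x E.deg, Φ.map W le_rfl (E.sheaf.res le_top (E.pull b.1)) =
    E.bodySeries W b.2

variable {E}

theorem localModelRes_bodySeries {U V : Opens M} (h : U ≤ V) (F) :
    localModelRes m E.totalDeg h (E.bodySeries V F) = E.bodySeries U F := by
  refine formal_ext fun K _ => ?_
  exact (coeff_formalMap (ofCommMap (restrictSmooth m h)) (E.bodySeries V F) K).trans
    ((congrArg _ (coeff_formalMap (ofCommMap (E.bodyHom V)) F K)).trans
    (coeff_formalMap (ofCommMap (E.bodyHom U)) F K).symm)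

theorem Chart.map_pair' {W : Opens M} (c : E.Chart W) {V : Opens M} (hV : V ≤ W) {b}
    (hb : b ∈ coordinatePairs c.x E.deg) :
    c.Φ.map V hV (E.sheaf.res le_top (E.pull b.1)) = E.bodySeries V b.2 := by
  rw [← E.sheaf.res_res hV le_top, c.Φ.natural hV le_rfl, c.map_pair b hb, localModelRes_bodySeries]

theorem Chart.map_injective {W : Opens M} (c : E.Chart W) {V : Opens M} (hV : V ≤ W) :
    Function.Injective (c.Φ.map V hV) := (c.Φ.bijective V hV).1

/-- Restriction of a chart. -/
def Chart.restrict {W W' : Opens M} (c : E.Chart W) (h : W' ≤ W) : E.Chart W' where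
  Φ :=
    { map := fun V hV => c.Φ.map V (hV.trans h)
      bijective := fun V hV => c.Φ.bijective V (hV.trans h)
      natural := fun hU hV a => c.Φ.natural hU (hV.trans h) a }
  x := c.x
  indep := fun q hq => c.indep q (h hq)
  germ := fun q hq => c.germ q (h hq)
  map_pair := fun _ hb => c.map_pair' h hb

variable (E) in
/-- The charts of `E`, shrunk so that all forms on `X` have expressions in the `dx^a`. -/
theorem exists_chart [T2Space X] [IsManifold (𝓡 n) ∞ X] (p : M) : ∃ W : Opens M, p ∈ W ∧ Nonempty (E.Chart W) := by
  obtain ⟨W, hpW, Φ, x, hx, hfun, hdfun⟩ := E.charts p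
  obtain ⟨O, hO, hpO, h⟩ := exists_coordinate_nhds x E.deg (E.body p) hx
  let W' : Opens M := W ⊓ ⟨E.body ⁻¹' O, hO.preimage E.body.contMDiff.continuous⟩
  have hW : W' ≤ W := inf_le_left
  have hpair : ∀ b ∈ coordinatePairs x E.deg, Φ.map W le_rfl (E.sheaf.res le_top (E.pull b.1)) =
      E.bodySeries W b.2 := by
    intro b hb
    have hc : ∀ f, E.bodySeries W (const _ _ f) = const (ofComm C^∞⟮𝓡 m, W; ℝ⟯) E.totalDeg (E.bodyHom W f) :=
      fun f => formalMap_const (ofCommMap (E.bodyHom W)) f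
    have hv : ∀ i, E.bodySeries W (var _ _ i) = var (ofComm C^∞⟮𝓡 m, W; ℝ⟯) E.totalDeg i :=
      fun i => formalMap_var (ofCommMap (E.bodyHom W)) i
    induction hb using Algebra.adjoin_induction with
    | mem b hb =>
      rcases hb with ⟨f, rfl⟩ | ⟨a, rfl⟩
      · exact (hfun f).trans (hc f).symm
      · exact (hdfun a).trans (hv _).symm
    | algebraMap t =>
      have h1 : E.pull (algebraMap ℝ _ t) = algebraMap ℝ _ t := AlgHom.commutes _ t
      have h2 : E.sheaf.res (le_top : W ≤ ⊤) (algebraMap ℝ _ t) = algebraMap ℝ _ t := AlgHom.commutes _ t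
      have h3 : Φ.map W le_rfl (algebraMap ℝ _ t) = algebraMap ℝ _ t := AlgHom.commutes _ t
      have h4 : E.bodySeries W (algebraMap ℝ _ t) = algebraMap ℝ _ t := AlgHom.commutes _ t
      change Φ.map W le_rfl (E.sheaf.res le_top (E.pull (algebraMap ℝ _ t))) = E.bodySeries W (algebraMap ℝ _ t)
      rw [h1, h2, h3, h4]
    | add b c _ _ hb hc =>
      rw [Prod.fst_add, Prod.snd_add, map_add, map_add, map_add, map_add, hb, hc]
    | mul b c _ _ hb hc =>
      rw [Prod.fst_mul, Prod.snd_mul, map_mul, map_mul, map_mul, map_mul, hb, hc]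
  refine ⟨W', ⟨hpW, hpO⟩, ⟨?_⟩⟩
  exact
    { Φ :=
        { map := fun V hV => Φ.map V (hV.trans hW)
          bijective := fun V hV => Φ.bijective V (hV.trans hW)
          natural := fun hU hV a => Φ.natural hU (hV.trans hW) a }
      x := x
      indep := fun q hq => (h _ hq.2).1
      germ := fun q hq => (h _ hq.2).2
      map_pair := by
        intro b hb
        have := Φ.natural hW le_rfl (E.sheaf.res le_top (E.pull b.1))
        rw [E.sheaf.res_res, hpair b hb, localModelRes_bodySeries] at this
        exact this }

/-- The coefficient of a function in a chart, as a smooth function. -/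
def Chart.coeff {W : Opens M} (c : E.Chart W) {V : Opens M} (hV : V ≤ W) (K : Fin (n + E.rank) →₀ ℕ)
    (a : E.sheaf.O V) : C^∞⟮𝓡 m, V; ℝ⟯ :=
  GrAlg.coeff (A := ofComm C^∞⟮𝓡 m, V; ℝ⟯) (d := E.totalDeg) K (c.Φ.map V hV a)

theorem Chart.coeff_res {W : Opens M} (c : E.Chart W) {U V : Opens M} (hU : U ≤ V) (hV : V ≤ W) (K) (a)
    (q : U) : c.coeff (hU.trans hV) K (E.sheaf.res hU a) q = c.coeff hV K a ⟨q.1, hU q.2⟩ := by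
  have h := c.Φ.natural hU hV a
  have h2 : GrAlg.coeff K (localModelRes m E.totalDeg hU (c.Φ.map V hV a)) =
    restrictSmooth m hU (c.coeff hV K a) := coeff_formalMap (ofCommMap (restrictSmooth m hU)) _ K
  have h3 : c.coeff (hU.trans hV) K (E.sheaf.res hU a) = restrictSmooth m hU (c.coeff hV K a) := by
    rw [← h2, ← h]
    rfl
  rw [h3]
  rfl

theorem Chart.coeff_zero {W : Opens M} (c : E.Chart W) {V : Opens M} (hV : V ≤ W) (K) :
    c.coeff hV K 0 = 0 := by
  have h : c.Φ.map V hV 0 = 0 := map_zero (c.Φ.map V hV).toAlgHom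
  rw [Chart.coeff, h]
  exact map_zero (GrAlg.coeff (A := ofComm C^∞⟮𝓡 m, V; ℝ⟯) (d := E.totalDeg) K)

theorem Chart.ext_coeff {W : Opens M} (c : E.Chart W) {V : Opens M} (hV : V ≤ W) {a a' : E.sheaf.O V}
    (h : ∀ K, IsMono E.totalDeg K → c.coeff hV K a = c.coeff hV K a') : a = a' :=
  c.map_injective hV (formal_ext fun K hK => h K hK)

theorem Chart.coeff_pair {W : Opens M} (c : E.Chart W) {V : Opens M} (hV : V ≤ W) {b}
    (hb : b ∈ coordinatePairs c.x E.deg) (K) (q : V) :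
    c.coeff hV K (E.sheaf.res le_top (E.pull b.1)) q =
      (show C^∞⟮𝓡 n, X; ℝ⟯ from GrAlg.coeff K b.2) (E.body q.1) := by
  have h1 : c.coeff hV K (E.sheaf.res le_top (E.pull b.1)) =
      E.bodyHom V (show C^∞⟮𝓡 n, X; ℝ⟯ from GrAlg.coeff K b.2) := by
    rw [Chart.coeff, c.map_pair' hV hb]
    exact coeff_formalMap (ofCommMap (E.bodyHom V)) b.2 K
  rw [h1]
  rfl

variable [T2Space X] [IsManifold (𝓡 n) ∞ X]

/-- The pullback of a form near a point depends only on the form near its image. -/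
theorem pull_congr {b b' : functionsT1 n X} {q : M} (h : ∀ᶠ z in 𝓝 (E.body q), b.1 z = b'.1 z) :
    ∃ V : Opens M, q ∈ V ∧ E.sheaf.res (le_top : V ≤ ⊤) (E.pull b) = E.sheaf.res le_top (E.pull b') := by
  obtain ⟨χ, hχ, h1⟩ := exists_bump (m := n) (M := X) h
  obtain ⟨O, hO1, hO, hqO⟩ := eventually_nhds_iff.1 h1
  obtain ⟨W, hqW, ⟨c⟩⟩ := E.exists_chart q
  let V : Opens M := W ⊓ ⟨E.body ⁻¹' O, hO.preimage E.body.contMDiff.continuous⟩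
  have hV : V ≤ W := inf_le_left
  refine ⟨V, ⟨hqW, hqO⟩, ?_⟩
  -- the cut-off function `χ` is `1` on `O`, so its pullback is `1` on `V`
  have hz : funT1 χ * (b - b') = 0 := by
    refine functionsT1_ext fun z => ?_
    change (funT1 χ).1 z * (b.1 z - b'.1 z) = 0
    by_cases hz : z ∈ tsupport χ
    · rw [show b.1 z = b'.1 z from hχ hz, sub_self, mul_zero]
    · rw [funT1_apply, image_eq_zero_of_notMem_tsupport hz, map_zero, zero_mul]
  have h1 : E.sheaf.res (le_top : V ≤ ⊤) (E.pull (funT1 χ)) = 1 := by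
    refine c.map_injective hV ?_
    have e1 := c.map_pair' hV (funT1_pair c.x E.deg χ)
    have e2 : E.bodySeries V (const _ _ χ) = const (ofComm C^∞⟮𝓡 m, V; ℝ⟯) E.totalDeg (E.bodyHom V χ) :=
      formalMap_const (ofCommMap (E.bodyHom V)) χ
    have e3 : E.bodyHom V χ = 1 := by
      ext q
      exact hO1 _ q.2.2
    rw [e3] at e2
    rw [map_one (c.Φ.map V hV).toAlgHom]
    exact e1.trans (e2.trans (map_one (const (ofComm C^∞⟮𝓡 m, V; ℝ⟯) E.totalDeg).toAlgHom))
  have h2 := congrArg (fun a => E.sheaf.res (le_top : V ≤ ⊤) (E.pull a)) hz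
  simp only [map_mul, h1, one_mul, map_sub, map_zero] at h2
  exact sub_eq_zero.1 h2

/-- Near every point the pullback of a form is given by an expression of the form. -/
theorem Chart.exists_pair {W : Opens M} (c : E.Chart W) (b : functionsT1 n X) {q : M} (hq : q ∈ W) :
    ∃ b' ∈ coordinatePairs c.x E.deg, (∀ᶠ z in 𝓝 (E.body q), b.1 z = b'.1.1 z) ∧ ∃ V : Opens M, ∃ _ : V ≤ W, q ∈ V ∧
      E.sheaf.res (le_top : V ≤ ⊤) (E.pull b) = E.sheaf.res le_top (E.pull b'.1) := by
  obtain ⟨b', hb', h⟩ := c.germ q hq b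
  obtain ⟨V, hqV, hV⟩ := E.pull_congr h
  refine ⟨b', hb', h, V ⊓ W, inf_le_right, ⟨hqV, hq⟩, ?_⟩
  have := congrArg (E.sheaf.res (inf_le_left : V ⊓ W ≤ V)) hV
  rwa [E.sheaf.res_res, E.sheaf.res_res] at this

/-- The coefficients of pullbacks: near every point, functions of the base point, and only
monomials in the base coordinates occur. -/
theorem Chart.coeff_pull {W : Opens M} (c : E.Chart W) (b : functionsT1 n X) (K) (q : W) :
    (¬ IsBasic K → c.coeff le_rfl K (E.sheaf.res le_top (E.pull b)) q = 0) ∧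
    ∃ f : C^∞⟮𝓡 n, X; ℝ⟯, ∀ᶠ q' in 𝓝 q, c.coeff le_rfl K (E.sheaf.res le_top (E.pull b)) q' = f (E.body q'.1) := by
  obtain ⟨b', hb', -, V, hV, hqV, h⟩ := c.exists_pair b q.2
  have key : ∀ q' : W, q'.1 ∈ V → c.coeff le_rfl K (E.sheaf.res le_top (E.pull b)) q' =
      (show C^∞⟮𝓡 n, X; ℝ⟯ from GrAlg.coeff K b'.2) (E.body q'.1) := by
    intro q' hq'
    have h1 := c.coeff_res hV le_rfl K (E.sheaf.res (le_top : W ≤ ⊤) (E.pull b)) ⟨q'.1, hq'⟩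
    rw [E.sheaf.res_res, h, c.coeff_pair _ hb'] at h1
    exact h1.symm
  refine ⟨fun hK => ?_, (show C^∞⟮𝓡 n, X; ℝ⟯ from GrAlg.coeff K b'.2), ?_⟩
  · rw [key q hqV, coeff_coordinatePairs _ _ hb' hK]
    rfl
  · have : ∀ᶠ q' : W in 𝓝 q, q'.1 ∈ V := continuous_subtype_val.continuousAt.eventually (V.2.mem_nhds hqV)
    filter_upwards [this] with q' hq'
    exact key q' hq'

/-- A form vanishes at the points over which its pullback vanishes. -/
theorem eq_zero_of_res_pull {b : functionsT1 n X} {V : Opens M} (h : E.sheaf.res (le_top : V ≤ ⊤) (E.pull b) = 0)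
    {q : M} (hq : q ∈ V) : b.1 (E.body q) = 0 := by
  obtain ⟨W, hqW, ⟨c⟩⟩ := E.exists_chart q
  obtain ⟨b', hb', hbb', V', hV', hqV', h'⟩ := c.exists_pair b hqW
  rw [hbb'.self_of_nhds]
  refine eq_zero_of_coordinatePairs c.x E.deg hb' _ (c.indep q hqW) fun K => ?_
  rw [← c.coeff_pair ((inf_le_left : V' ⊓ V ≤ V').trans hV') hb' K ⟨q, hqV', hq⟩]
  have h1 := congrArg (E.sheaf.res (inf_le_left : V' ⊓ V ≤ V')) h'
  have h2 := congrArg (E.sheaf.res (inf_le_right : V' ⊓ V ≤ V)) h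
  rw [E.sheaf.res_res, E.sheaf.res_res] at h1
  rw [E.sheaf.res_res, map_zero] at h2
  rw [← h1, h2, c.coeff_zero]
  rfl

variable (E) in
/-- `π^*` is injective, as `π` is surjective. -/
theorem pull_injective : Function.Injective E.pull := by
  intro b b' h
  have h0 : E.pull (b - b') = 0 := by rw [map_sub, h, sub_self]
  refine sub_eq_zero.1 (functionsT1_ext fun z => ?_)
  obtain ⟨q, rfl⟩ := (E.fibres_connected z).nonempty
  exact eq_zero_of_res_pull (V := ⊤) (by rw [h0, map_zero]) (Opens.mem_top q)

variable (E) in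
/-- The base coordinates are odd, so only finitely many monomials contain no others. -/
theorem finite_isBasic : Set.Finite {K : Fin (n + E.rank) →₀ ℕ | IsMono E.totalDeg K ∧ IsBasic K} := by
  refine (Set.finite_Iic (Finsupp.equivFunOnFinite.symm fun _ => 1)).subset ?_
  rintro K ⟨hK, hb⟩ i
  induction i using Fin.addCases with
  | left a => exact hK _ (by rw [totalDeg, Fin.append_left]; exact odd_one)
  | right j => rw [hb j]; exact Nat.zero_le _

/-- A function whose coefficients in a chart are those of a form on the base is a pullback. -/
theorem Chart.exists_pull_eq {W : Opens M} (c : E.Chart W) {V : Opens M} (hV : V ≤ W) (F : E.sheaf.O ⊤)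
    (g : (Fin (n + E.rank) →₀ ℕ) → C^∞⟮𝓡 n, X; ℝ⟯)
    (h : ∀ K, IsMono E.totalDeg K → ¬ IsBasic K → c.coeff hV K (E.sheaf.res le_top F) = 0)
    (h' : ∀ K, IsMono E.totalDeg K → IsBasic K → c.coeff hV K (E.sheaf.res le_top F) = E.bodyHom V (g K)) :
    ∃ b : functionsT1 n X, E.sheaf.res (le_top : V ≤ ⊤) F = E.sheaf.res le_top (E.pull b) := by
  classical
  have hfin := E.finite_isBasic
  choose! e he using fun (K : Fin (n + E.rank) →₀ ℕ) (hK : IsMono E.totalDeg K ∧ IsBasic K) =>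
    exists_pair_term c.x E.deg hK.2 hK.1
  let B := ∑ K ∈ hfin.toFinset, (funT1 (g K), const (ofComm C^∞⟮𝓡 n, X; ℝ⟯) E.totalDeg (g K)) *
    (e K, term (ofComm C^∞⟮𝓡 n, X; ℝ⟯) E.totalDeg K 1)
  have hB : B ∈ coordinatePairs c.x E.deg := Subalgebra.sum_mem _ fun K hK =>
    Subalgebra.mul_mem _ (funT1_pair c.x E.deg _) (he K (hfin.mem_toFinset.1 hK))
  have hcoeff : ∀ L, GrAlg.coeff L B.2 =
      if IsMono E.totalDeg L ∧ IsBasic L then (show (ofComm C^∞⟮𝓡 n, X; ℝ⟯) from g L) else 0 := by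
    intro L
    rw [Prod.snd_sum, map_sum]
    have : ∀ K ∈ hfin.toFinset, GrAlg.coeff L ((funT1 (g K), const (ofComm C^∞⟮𝓡 n, X; ℝ⟯) E.totalDeg (g K)) *
        (e K, term (ofComm C^∞⟮𝓡 n, X; ℝ⟯) E.totalDeg K 1)).2 =
        if L = K then (show (ofComm C^∞⟮𝓡 n, X; ℝ⟯) from g K) else 0 := by
      intro K hK
      refine (coeff_const_mul (A := ofComm C^∞⟮𝓡 n, X; ℝ⟯) (g K) _ L).trans ?_
      rw [coeff_term _ _ (hfin.mem_toFinset.1 hK).1]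
      split_ifs
      · exact mul_one (show (ofComm C^∞⟮𝓡 n, X; ℝ⟯) from g K)
      · exact mul_zero (show (ofComm C^∞⟮𝓡 n, X; ℝ⟯) from g K)
    rw [Finset.sum_congr rfl this, Finset.sum_ite_eq]
    simp only [hfin.mem_toFinset]
    rfl
  refine ⟨B.1, c.ext_coeff hV fun K hK => ?_⟩
  by_cases hb : IsBasic K
  · rw [h' K hK hb]
    ext q
    rw [c.coeff_pair hV hB, hcoeff, if_pos ⟨hK, hb⟩]
    rfl
  · rw [h K hK hb]
    ext q
    rw [c.coeff_pair hV hB, hcoeff, if_neg fun h => hb h.2]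
    rfl

end GradedBundle

/-! ### Functions killed by the vertical vector fields -/

namespace GrAlg

theorem mem_ofComm_zero {R : Type u} [CommRing R] [Algebra ℝ R] (a : R) : a ∈ (ofComm R).gr 0 := by
  change a ∈ (if (0 : ℤ) = 0 then (⊤ : Submodule ℝ R) else ⊥)
  rw [if_pos rfl]
  trivial

theorem ofComm_twist {R : Type u} [CommRing R] [Algebra ℝ R] (e : ℤ) (a : ofComm R) :
    (ofComm R).twist e a = a := by
  rw [(ofComm R).twist_of_mem e (mem_ofComm_zero (R := R) a), mul_zero, sgn_zero, one_smul]

/-- A derivation of a commutative algebra as a vector field of degree `0`. -/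
def Vect.ofDerivation {R : Type u} [CommRing R] [Algebra ℝ R] (δ : R →ₗ[ℝ] R)
    (h : ∀ a b, δ (a * b) = δ a * b + a * δ b) : Vect (ofComm R) 0 :=
  ⟨δ, by
    constructor
    · intro i a ha
      change δ a ∈ (if i + 0 = 0 then (⊤ : Submodule ℝ R) else ⊥)
      change a ∈ (if i = 0 then (⊤ : Submodule ℝ R) else ⊥) at ha
      rw [add_zero]
      split_ifs with hi
      · trivial
      · rw [if_neg hi] at ha
        have h0 : δ a = 0 := by
          rw [show (a : R) = 0 from (Submodule.mem_bot ℝ).1 ha]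
          exact map_zero δ
        exact (Submodule.mem_bot ℝ).2 h0
    · intro i a ha b
      rw [zero_mul, sgn_zero, one_smul]
      exact h a b⟩

end GrAlg

section FibreDerivative

open Topology TopologicalSpace GrAlg

variable {m : ℕ} {M : Type w} [TopologicalSpace M] [ChartedSpace (EuclideanSpace ℝ (Fin m)) M]

open Classical in
/-- Extension by zero of a function on an open set. -/
def extendZero {W : Opens M} (G : C^∞⟮𝓡 m, W; ℝ⟯) (q : M) : ℝ := if h : q ∈ W then G ⟨q, h⟩ else 0

theorem extendZero_of_mem {W : Opens M} (G : C^∞⟮𝓡 m, W; ℝ⟯) (q : W) : extendZero G q.1 = G q := dif_pos q.2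

theorem contMDiffOn_extendZero [IsManifold (𝓡 m) ∞ M] {W : Opens M} (G : C^∞⟮𝓡 m, W; ℝ⟯) :
    ContMDiffOn (𝓡 m) 𝓘(ℝ) ∞ (extendZero G) W := by
  intro q hq
  have h1 : ContMDiffAt (𝓡 m) 𝓘(ℝ) ∞ (fun q' : W => extendZero G q'.1) ⟨q, hq⟩ := by
    have : (fun q' : W => extendZero G q'.1) = G := funext fun q' => extendZero_of_mem G q'
    rw [this]
    exact G.contMDiff _
  exact ((contMDiffAt_subtype_iff (U := W) (f := extendZero G) (x := ⟨q, hq⟩)).1 h1).contMDiffWithinAt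

variable {E : Type*} [NormedAddCommGroup E] [NormedSpace ℝ E]

theorem contDiffOn_extendZero_symm [IsManifold (𝓡 m) ∞ M] (e : OpenPartialHomeomorph M E)
    (hes : ContMDiffOn 𝓘(ℝ, E) (𝓡 m) ∞ e.symm e.target)
    {W : Opens M} (G : C^∞⟮𝓡 m, W; ℝ⟯) :
    ContDiffOn ℝ ∞ (extendZero G ∘ e.symm) (e.target ∩ e.symm ⁻¹' W) := by
  rw [← contMDiffOn_iff_contDiffOn]
  exact (contMDiffOn_extendZero G).comp (hes.mono Set.inter_subset_left) fun y hy => hy.2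

/-- The coordinate vector field in the direction `v` of coordinates `e` on an open set. -/
theorem exists_directional_derivation [IsManifold (𝓡 m) ∞ M] (e : OpenPartialHomeomorph M E)
    (he : ContMDiffOn (𝓡 m) 𝓘(ℝ, E) ∞ e e.source) (hes : ContMDiffOn 𝓘(ℝ, E) (𝓡 m) ∞ e.symm e.target)
    (W : Opens M) (hW : ∀ q ∈ W, q ∈ e.source) (v : E) :
    ∃ δ : Vect (ofComm C^∞⟮𝓡 m, W; ℝ⟯) 0, ∀ (G : C^∞⟮𝓡 m, W; ℝ⟯) (q : W),
      (show C^∞⟮𝓡 m, W; ℝ⟯ from δ G) q = fderiv ℝ (extendZero G ∘ e.symm) (e q.1) v := by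
  let T : Set E := e.target ∩ e.symm ⁻¹' W
  have hT : IsOpen T := e.isOpen_inter_preimage_symm W.2
  have heT : ∀ q ∈ W, e q ∈ T := fun q hq => ⟨e.map_source (hW q hq), by
    rw [Set.mem_preimage, e.left_inv (hW q hq)]; exact hq⟩
  have hd : ∀ (G : C^∞⟮𝓡 m, W; ℝ⟯), ∀ q ∈ W, DifferentiableAt ℝ (extendZero G ∘ e.symm) (e q) := fun G q hq =>
    ((contDiffOn_extendZero_symm e hes G).contDiffAt (hT.mem_nhds (heT q hq))).differentiableAt (by simp)
  let D : C^∞⟮𝓡 m, W; ℝ⟯ → C^∞⟮𝓡 m, W; ℝ⟯ := fun G =>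
    ⟨fun q : W => fderiv ℝ (extendZero G ∘ e.symm) (e q.1) v, by
      have h1 : ContDiffOn ℝ ∞ (fun y => fderiv ℝ (extendZero G ∘ e.symm) y v) T :=
        ((contDiffOn_extendZero_symm e hes G).fderiv_of_isOpen hT (by simp)).clm_apply contDiffOn_const
      have h2 : ContMDiffOn (𝓡 m) 𝓘(ℝ) ∞ (fun q : M => fderiv ℝ (extendZero G ∘ e.symm) (e q) v) W :=
        h1.contMDiffOn.comp (he.mono hW) heT
      exact h2.comp_contMDiff contMDiff_subtype_val fun q => q.2⟩
  have hev : ∀ (q : W), ∀ᶠ y in 𝓝 (e q.1), e.symm y ∈ W := fun q =>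
    (hT.mem_nhds (heT q.1 q.2)) |> fun h => Filter.mem_of_superset h fun y hy => hy.2
  have hval : ∀ (G : C^∞⟮𝓡 m, W; ℝ⟯) (q : W), (extendZero G ∘ e.symm) (e q.1) = G q := by
    intro G q
    rw [Function.comp_apply, e.left_inv (hW q.1 q.2), extendZero_of_mem]
  have hmem : ∀ (G : C^∞⟮𝓡 m, W; ℝ⟯) (y : E) (h : e.symm y ∈ W), (extendZero G ∘ e.symm) y = G ⟨e.symm y, h⟩ :=
    fun G y h => extendZero_of_mem G ⟨_, h⟩
  let δ : C^∞⟮𝓡 m, W; ℝ⟯ →ₗ[ℝ] C^∞⟮𝓡 m, W; ℝ⟯ :=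
    { toFun := D
      map_add' := by
        intro G H
        ext q
        change fderiv ℝ (extendZero (G + H) ∘ e.symm) (e q.1) v =
          fderiv ℝ (extendZero G ∘ e.symm) (e q.1) v + fderiv ℝ (extendZero H ∘ e.symm) (e q.1) v
        have h : extendZero (G + H) ∘ e.symm =ᶠ[𝓝 (e q.1)] (extendZero G ∘ e.symm) + (extendZero H ∘ e.symm) := by
          filter_upwards [hev q] with y hy
          rw [Pi.add_apply, hmem _ y hy, hmem _ y hy, hmem _ y hy]
          rfl
        rw [h.fderiv_eq, fderiv_add (hd G q.1 q.2) (hd H q.1 q.2)]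
        rfl
      map_smul' := by
        intro t G
        ext q
        change fderiv ℝ (extendZero (t • G) ∘ e.symm) (e q.1) v = t • fderiv ℝ (extendZero G ∘ e.symm) (e q.1) v
        have h : extendZero (t • G) ∘ e.symm =ᶠ[𝓝 (e q.1)] t • (extendZero G ∘ e.symm) := by
          filter_upwards [hev q] with y hy
          rw [Pi.smul_apply, hmem _ y hy, hmem _ y hy]
          rfl
        rw [h.fderiv_eq, fderiv_const_smul (hd G q.1 q.2)]
        rfl }
  refine ⟨Vect.ofDerivation δ ?_, fun G q => rfl⟩
  intro G H
  ext q
  change fderiv ℝ (extendZero (G * H) ∘ e.symm) (e q.1) v =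
    fderiv ℝ (extendZero G ∘ e.symm) (e q.1) v * H q + G q * fderiv ℝ (extendZero H ∘ e.symm) (e q.1) v
  have h : extendZero (G * H) ∘ e.symm =ᶠ[𝓝 (e q.1)] (extendZero G ∘ e.symm) * (extendZero H ∘ e.symm) := by
    filter_upwards [hev q] with y hy
    rw [Pi.mul_apply, hmem _ y hy, hmem _ y hy, hmem _ y hy]
    rfl
  rw [h.fderiv_eq, fderiv_mul (hd G q.1 q.2) (hd H q.1 q.2), hval, hval]
  simp only [ContinuousLinearMap.add_apply, ContinuousLinearMap.smul_apply, smul_eq_mul]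
  ring

end FibreDerivative

namespace GradedBundle

open Topology GrAlg TopologicalSpace

variable {n : ℕ} {X : Type v} [TopologicalSpace X] [ChartedSpace (EuclideanSpace ℝ (Fin n)) X]
  [T2Space X] [IsManifold (𝓡 n) ∞ X]
  {m : ℕ} {M : Type w} [TopologicalSpace M] [ChartedSpace (EuclideanSpace ℝ (Fin m)) M]
  [T2Space M] [IsManifold (𝓡 m) ∞ M]
  {E : GradedBundle.{u} n X m M}

/-- A function killed by the global vertical vector fields is killed, near `p`, by those of the chart: after
multiplication by a bump function the latter extend to global vertical vector fields. -/
theorem Chart.exists_nhds_forall_vertical {W : Opens M} (c : E.Chart W) {p : M} (hp : p ∈ W) :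
    ∃ V : Opens M, ∃ hV : V ≤ W, p ∈ V ∧ ∀ (l : ℤ) (D : Vect (localModel m E.totalDeg W) l),
      (∀ b, D (c.Φ.map W le_rfl (E.sheaf.res le_top (E.pull b))) = 0) →
      ∀ F : E.sheaf.O ⊤, (∀ Z : Vect (E.sheaf.O ⊤) l, IsVertical E.pull Z → Z F = 0) →
      ∀ (K) (q : V), (show C^∞⟮𝓡 m, W; ℝ⟯ from
        GrAlg.coeff (A := ofComm C^∞⟮𝓡 m, W; ℝ⟯) (d := E.totalDeg) K
          (D (c.Φ.map W le_rfl (E.sheaf.res le_top F)))) ⟨q.1, hV q.2⟩ = 0 := by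
  classical
  obtain ⟨χ, hχ, h1⟩ := exists_bump (m := m) (M := M) (W.2.mem_nhds hp)
  obtain ⟨V₀, hV1, hV₀, hpV⟩ := eventually_nhds_iff.1 h1
  refine ⟨W ⊓ ⟨V₀, hV₀⟩, inf_le_left, ⟨hp, hpV⟩, fun l D hD F hF K q => ?_⟩
  let χW : C^∞⟮𝓡 m, W; ℝ⟯ := ⟨fun q => χ q.1, χ.contMDiff.comp contMDiff_subtype_val⟩
  let cχ : localModel m E.totalDeg W := const (ofComm C^∞⟮𝓡 m, W; ℝ⟯) E.totalDeg χW
  obtain ⟨χ', hχ'⟩ := (c.Φ.bijective W le_rfl).2 cχ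
  have hχ'0 : χ' ∈ (E.sheaf.O W).gr 0 := by
    refine (c.Φ.map W le_rfl).mem_gr_of_injective (c.Φ.bijective W le_rfl).1 ?_
    rw [hχ']
    exact (const (ofComm C^∞⟮𝓡 m, W; ℝ⟯) E.totalDeg).map_gr (mem_ofComm_zero χW)
  let C : Opens M := ⟨(tsupport χ)ᶜ, (isClosed_tsupport χ).isOpen_compl⟩
  have hWC : ∀ q, q ∈ W ∨ q ∈ C := by
    intro q
    by_cases hq : q ∈ tsupport χ
    · exact Or.inl (hχ hq)
    · exact Or.inr hq
  have hres : E.sheaf.res (inf_le_left : W ⊓ C ≤ W) χ' = 0 := by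
    refine c.ext_coeff inf_le_left fun K hK => ?_
    ext q
    rw [c.coeff_res inf_le_left le_rfl, c.coeff_zero]
    have e1 : c.coeff le_rfl K χ' = if K = 0 then χW else 0 := by
      rw [Chart.coeff, hχ']
      exact coeff_const (A := ofComm C^∞⟮𝓡 m, W; ℝ⟯) χW K
    rw [e1]
    split_ifs
    · exact image_eq_zero_of_notMem_tsupport (f := χ) q.2.2
    · rfl
  -- `χ D`, extended by zero, is vertical
  obtain ⟨D', hD'⟩ := exists_vect_of_bijective (c.Φ.map W le_rfl) (c.Φ.bijective W le_rfl) D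
  obtain ⟨Z, hZ⟩ := E.sheaf.exists_vect_extension hWC D' hχ'0 hres
  have hvert : IsVertical E.pull Z := by
    intro b
    refine E.sheaf.eq_zero_of_res_pair hWC _ ?_ (hZ _).2
    rw [(hZ _).1]
    have : D' (E.sheaf.res le_top (E.pull b)) = 0 := by
      refine (c.Φ.bijective W le_rfl).1 ?_
      rw [hD', hD, map_zero]
    rw [this, mul_zero]
  have h2 := (hZ F).1
  rw [hF Z hvert, map_zero] at h2
  have h3 := congrArg (c.Φ.map W le_rfl) h2
  rw [map_zero (c.Φ.map W le_rfl).toAlgHom, map_mul (c.Φ.map W le_rfl).toAlgHom, hχ', hD'] at h3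
  have h4 := (congrArg (GrAlg.coeff (A := ofComm C^∞⟮𝓡 m, W; ℝ⟯) (d := E.totalDeg) K) h3).trans
    (coeff_const_mul (A := ofComm C^∞⟮𝓡 m, W; ℝ⟯) χW _ K)
  have h5 : (0 : ℝ) = χ q.1 * _ := congrArg (fun G : C^∞⟮𝓡 m, W; ℝ⟯ => G ⟨q.1, q.2.1⟩)
    ((map_zero (GrAlg.coeff (A := ofComm C^∞⟮𝓡 m, W; ℝ⟯) (d := E.totalDeg) K)).symm.trans h4)
  rw [hV1 _ q.2.2] at h5
  exact (h5.trans (one_mul _)).symm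

end GradedBundle

namespace GradedBundle

open Topology GrAlg TopologicalSpace

variable {n : ℕ} {X : Type v} [TopologicalSpace X] [ChartedSpace (EuclideanSpace ℝ (Fin n)) X]
  [T2Space X] [IsManifold (𝓡 n) ∞ X]
  {m : ℕ} {M : Type w} [TopologicalSpace M] [ChartedSpace (EuclideanSpace ℝ (Fin m)) M]
  [T2Space M] [IsManifold (𝓡 m) ∞ M]
  {E : GradedBundle.{u} n X m M}

/-- A function killed by the vertical vector fields does not depend on the graded fibre coordinates. -/
theorem Chart.coeff_eq_zero_of_vertical {W : Opens M} (c : E.Chart W) {V : Opens M} (hV : V ≤ W)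
    (hvert : ∀ (l : ℤ) (D : Vect (localModel m E.totalDeg W) l),
      (∀ b, D (c.Φ.map W le_rfl (E.sheaf.res le_top (E.pull b))) = 0) →
      ∀ F : E.sheaf.O ⊤, (∀ Z : Vect (E.sheaf.O ⊤) l, IsVertical E.pull Z → Z F = 0) →
      ∀ (K) (q : V), (show C^∞⟮𝓡 m, W; ℝ⟯ from
        GrAlg.coeff (A := ofComm C^∞⟮𝓡 m, W; ℝ⟯) (d := E.totalDeg) K
          (D (c.Φ.map W le_rfl (E.sheaf.res le_top F)))) ⟨q.1, hV q.2⟩ = 0)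
    {F : E.sheaf.O ⊤} (hF : ∀ (l : ℤ) (Z : Vect (E.sheaf.O ⊤) l), IsVertical E.pull Z → Z F = 0)
    {K : Fin (n + E.rank) →₀ ℕ} (hK : IsMono E.totalDeg K) (hb : ¬ IsBasic K) (q : V) :
    c.coeff le_rfl K (E.sheaf.res le_top F) ⟨q.1, hV q.2⟩ = 0 := by
  obtain ⟨j, hj⟩ := not_forall.1 hb
  set i := Fin.natAdd n j with hi
  obtain ⟨L, rfl⟩ : ∃ L, K = L + Finsupp.single i 1 :=
    ⟨K - Finsupp.single i 1, (tsub_add_cancel_of_le (by rw [Finsupp.single_le_iff]; omega)).symm⟩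
  have hL := hK.left
  -- `∂/∂ξ_i` is vertical, as pullbacks do not contain the fibre coordinate `ξ_i`
  let D := partialVect (ofComm C^∞⟮𝓡 m, W; ℝ⟯) E.totalDeg i
  have hD : ∀ L, IsMono E.totalDeg L → ∀ G, GrAlg.coeff L (D G) =
      (((L i + 1 : ℕ) : ℤ) * sgn (pastSign E.totalDeg i L)) • GrAlg.coeff (L + Finsupp.single i 1) G := by
    intro L hL G
    rw [coeff_partialVect _ _ _ _ hL, ofComm_twist]
  have h := hvert _ D (fun b => formal_ext fun K' hK' => ?_) F (hF _) L q
  · have h1 : (((L i + 1 : ℕ) : ℤ) * sgn (pastSign E.totalDeg i L)) •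
      (c.coeff le_rfl (L + Finsupp.single i 1) (E.sheaf.res le_top F) ⟨q.1, hV q.2⟩) = 0 :=
        (map_zsmul (evalAlgHom (⟨q.1, hV q.2⟩ : W)) _ (c.coeff le_rfl (L + Finsupp.single i 1)
          (E.sheaf.res le_top F))).symm.trans
        ((congrArg (fun G : C^∞⟮𝓡 m, W; ℝ⟯ => G ⟨q.1, hV q.2⟩) (hD L hL _)).symm.trans h)
    rw [smul_eq_zero] at h1
    refine h1.resolve_left (mul_ne_zero (by positivity) fun h0 => ?_)
    have := sgn_mul_self (pastSign E.totalDeg i L)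
    rw [h0] at this
    simp at this
  · refine (hD K' hK' _).trans (Eq.trans ?_ (map_zero (GrAlg.coeff K')).symm)
    have h0 : c.coeff le_rfl (K' + Finsupp.single i 1) (E.sheaf.res le_top (E.pull b)) = 0 := by
      ext q'
      refine (c.coeff_pull b _ q').1 fun hbas => ?_
      have := hbas j
      rw [← hi, Finsupp.add_apply, Finsupp.single_eq_same] at this
      omega
    have h1 := congrArg (fun G : ofComm C^∞⟮𝓡 m, W; ℝ⟯ =>
      (((K' i + 1 : ℕ) : ℤ) * sgn (pastSign E.totalDeg i K')) • G) h0
    exact h1.trans (smul_zero (A := ofComm C^∞⟮𝓡 m, W; ℝ⟯) _)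

/-- A function killed by the vertical vector fields is near every point the pullback of a form. -/
theorem exists_pull_eq_near {F : E.sheaf.O ⊤}
    (hF : ∀ (l : ℤ) (Z : Vect (E.sheaf.O ⊤) l), IsVertical E.pull Z → Z F = 0) (p : M) :
    ∃ b : functionsT1 n X, ∃ V : Opens M, p ∈ V ∧
      E.sheaf.res (le_top : V ≤ ⊤) F = E.sheaf.res le_top (E.pull b) := by
  obtain ⟨W₀, hpW₀, ⟨c₀⟩⟩ := E.exists_chart p
  obtain ⟨K, e, hpe, hsrc, hfst, he, hes⟩ := exists_adapted_chart E.body p (E.submersion p)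
  set ψ := extChartAt (𝓡 n) (E.body p) with hψ
  let W : Opens M := W₀ ⊓ ⟨e.source, e.open_source⟩
  let c : E.Chart W := c₀.restrict inf_le_left
  have hWe : ∀ q ∈ W, q ∈ e.source := fun q hq => hq.2
  obtain ⟨V, hV, hpV, hvert⟩ := c.exists_nhds_forall_vertical (p := p) ⟨hpW₀, hpe⟩
  let G : (Fin (n + E.rank) →₀ ℕ) → C^∞⟮𝓡 m, W; ℝ⟯ := fun L => c.coeff le_rfl L (E.sheaf.res le_top F)
  -- the coefficients do not depend on the fibre coordinates of the body
  have hder : ∀ L, ∀ q ∈ V, ∀ k : K, fderiv ℝ (extendZero (G L) ∘ e.symm) (e q) (0, k) = 0 := by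
    intro L q hq k
    obtain ⟨δ, hδ⟩ := exists_directional_derivation e he hes W hWe ((0, k) : EuclideanSpace ℝ (Fin n) × K)
    -- the derivative along the fibre is vertical, as the coefficients of pullbacks are functions of the base point
    let D : Vect (localModel m E.totalDeg W) 0 := GrAlg.extend E.totalDeg δ
    have h := hvert 0 D (fun b => formal_ext fun K' hK' => ?_) F (hF 0) L ⟨q, hq⟩
    · have h1 : GrAlg.coeff L (D (c.Φ.map W le_rfl (E.sheaf.res le_top F))) = δ (G L) := coeff_extend _ δ _ L
      exact (hδ (G L) ⟨q, hV hq⟩).symm.trans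
        ((congrArg (fun G : C^∞⟮𝓡 m, W; ℝ⟯ => G ⟨q, hV hq⟩) h1).symm.trans h)
    · refine (coeff_extend _ δ _ K').trans (Eq.trans ?_ (map_zero (GrAlg.coeff K')).symm)
      set H : C^∞⟮𝓡 m, W; ℝ⟯ := c.coeff le_rfl K' (E.sheaf.res le_top (E.pull b)) with hH
      change (show C^∞⟮𝓡 m, W; ℝ⟯ from δ H) = 0
      ext q'
      rw [hδ H q']
      obtain ⟨-, f, hf⟩ := c.coeff_pull b K' q'
      have hq's := hWe q'.1 q'.2
      have hqt : e q'.1 ∈ e.target ∩ e.symm ⁻¹' W := ⟨e.map_source hq's, by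
        rw [Set.mem_preimage, e.left_inv hq's]; exact q'.2⟩
      have hdiff : DifferentiableAt ℝ (extendZero H ∘ e.symm) (e q'.1) :=
        ((contDiffOn_extendZero_symm e hes H).contDiffAt
          ((e.isOpen_inter_preimage_symm W.2).mem_nhds hqt)).differentiableAt (by simp)
      rw [← hdiff.lineDeriv_eq_fderiv, lineDeriv]
      have hconst : (fun t : ℝ => (extendZero H ∘ e.symm) (e q'.1 + t • ((0, k) : EuclideanSpace ℝ (Fin n) × K)))
          =ᶠ[𝓝 0] fun _ => f (ψ.symm (e q'.1).1) := by
        obtain ⟨O, hO1, hO, hqO⟩ := eventually_nhds_iff.1 hf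
        obtain ⟨O', hO', rfl⟩ := isOpen_induced_iff.1 hO
        have hcont : ContinuousAt (fun t : ℝ => e q'.1 + t • ((0, k) : EuclideanSpace ℝ (Fin n) × K)) 0 := by
          fun_prop
        have hopen : IsOpen (e.target ∩ e.symm ⁻¹' ((W : Set M) ∩ O')) :=
          e.isOpen_inter_preimage_symm (W.2.inter hO')
        have hmem : e q'.1 + (0 : ℝ) • ((0, k) : EuclideanSpace ℝ (Fin n) × K) ∈
            e.target ∩ e.symm ⁻¹' ((W : Set M) ∩ O') := by
          rw [zero_smul, add_zero]
          refine ⟨hqt.1, hqt.2, ?_⟩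
          rw [e.left_inv hq's]
          exact hqO
        filter_upwards [hcont.eventually (hopen.mem_nhds hmem)] with t ht
        set y := e q'.1 + t • ((0, k) : EuclideanSpace ℝ (Fin n) × K) with hy
        have h1 : (extendZero H ∘ e.symm) y = H ⟨e.symm y, ht.2.1⟩ := extendZero_of_mem H ⟨_, ht.2.1⟩
        have hys : e.symm y ∈ e.source := e.map_target ht.1
        rw [h1, hO1 ⟨e.symm y, ht.2.1⟩ ht.2.2]
        have h2 := hfst _ hys
        rw [e.right_inv ht.1] at h2
        have h3 : y.1 = (e q'.1).1 := by simp [hy]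
        rw [← h3, h2, ψ.left_inv (hsrc _ hys)]
      rw [hconst.deriv_eq, deriv_const]
      rfl
  -- a box around the point
  let T : Set (EuclideanSpace ℝ (Fin n) × K) := e.target ∩ e.symm ⁻¹' V
  have hT : IsOpen T := e.isOpen_inter_preimage_symm V.2
  have hpT : e p ∈ T := ⟨e.map_source hpe, by rw [Set.mem_preimage, e.left_inv hpe]; exact hpV⟩
  obtain ⟨ε, hε, hball⟩ := Metric.isOpen_iff.1 hT _ hpT
  have hdiffT : ∀ L, ∀ y ∈ T, DifferentiableAt ℝ (extendZero (G L) ∘ e.symm) y := fun L y hy =>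
    ((contDiffOn_extendZero_symm e hes (G L)).contDiffAt
      ((e.isOpen_inter_preimage_symm W.2).mem_nhds ⟨hy.1, hV hy.2⟩)).differentiableAt (by simp)
  have hconst : ∀ L, ∀ y ∈ Metric.ball (e p) ε, (extendZero (G L) ∘ e.symm) y =
      (extendZero (G L) ∘ e.symm) (y.1, (e p).2) := by
    intro L y hy
    rw [← ball_prod_same] at hy
    have hin : ∀ k ∈ Metric.ball (e p).2 ε, (y.1, k) ∈ T := fun k hk => hball (by
      rw [← ball_prod_same]; exact ⟨hy.1, hk⟩)
    have hd : ∀ k ∈ Metric.ball (e p).2 ε,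
        HasFDerivAt (fun k : K => (extendZero (G L) ∘ e.symm) (y.1, k)) (0 : K →L[ℝ] ℝ) k := by
      intro k hk
      have h1 := (hdiffT L _ (hin k hk)).hasFDerivAt.comp k
        (hasFDerivAt_prodMk_right (𝕜 := ℝ) y.1 k)
      have h2 : (fderiv ℝ (extendZero (G L) ∘ e.symm) (y.1, k)).comp
          (ContinuousLinearMap.inr ℝ (EuclideanSpace ℝ (Fin n)) K) = 0 := by
        ext k'
        have hk' := hin k hk
        have := hder L _ hk'.2 k'
        rw [e.right_inv hk'.1] at this
        exact this
      rw [h2] at h1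
      exact h1
    refine Metric.isOpen_ball.is_const_of_fderiv_eq_zero (𝕜 := ℝ)
      (f := fun k : K => (extendZero (G L) ∘ e.symm) (y.1, k))
      (convex_ball _ _).isPreconnected (fun k hk => (hd k hk).differentiableAt.differentiableWithinAt)
      (fun k hk => (hd k hk).fderiv) hy.2 (Metric.mem_ball_self hε)
  -- the coefficients along a section are functions on the base
  let S : Set X := ψ.source ∩ ψ ⁻¹' ((fun z => (z, (e p).2)) ⁻¹' T)
  have hS : IsOpen S := (continuousOn_extChartAt (E.body p)).isOpen_inter_preimage (isOpen_extChartAt_source _)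
    (hT.preimage (by fun_prop))
  have hpfst : ψ (E.body p) = (e p).1 := (hfst p hpe).symm
  have hpS : E.body p ∈ S := ⟨mem_extChartAt_source _, by
    rw [Set.mem_preimage, Set.mem_preimage, hpfst]
    exact hpT⟩
  have hfun : ∀ L, ∃ f : C^∞⟮𝓡 n, X; ℝ⟯, ∀ᶠ z in 𝓝 (E.body p),
      f z = (extendZero (G L) ∘ e.symm) (ψ z, (e p).2) := by
    intro L
    refine exists_contMDiffMap_eventuallyEq (h := fun z => (extendZero (G L) ∘ e.symm) (ψ z, (e p).2)) hS ?_ hpS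
    have h1 : ContDiffOn ℝ ∞ (fun z => (extendZero (G L) ∘ e.symm) (z, (e p).2)) ((fun z => (z, (e p).2)) ⁻¹' T) :=
      (contDiffOn_extendZero_symm e hes (G L)).comp (contDiff_id.prodMk contDiff_const).contDiffOn
        fun z hz => ⟨hz.1, hV hz.2⟩
    refine h1.contMDiffOn.comp ((contMDiffOn_extChartAt (n := ∞)).mono ?_) fun z hz => hz.2
    intro z hz
    have := hz.1
    rwa [hψ, extChartAt_source] at this
  choose f hf using hfun
  have hev : ∀ᶠ q in 𝓝 p, q ∈ V ∧ e q ∈ Metric.ball (e p) ε ∧ q ∈ e.source ∧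
      ∀ L ∈ {L : Fin (n + E.rank) →₀ ℕ | IsMono E.totalDeg L ∧ IsBasic L},
        f L (E.body q) = (extendZero (G L) ∘ e.symm) (ψ (E.body q), (e p).2) := by
    refine (V.2.mem_nhds hpV |> fun h => (h : ∀ᶠ q in 𝓝 p, q ∈ V)).and (Filter.Eventually.and ?_
      (Filter.Eventually.and (e.open_source.mem_nhds hpe) ?_))
    · exact (e.continuousAt hpe).eventually (Metric.ball_mem_nhds _ hε)
    · rw [Filter.eventually_all_finite E.finite_isBasic]
      exact fun L _ => E.body.contMDiff.continuous.continuousAt.eventually (hf L)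
  obtain ⟨V', hV'1, hV', hpV'⟩ := eventually_nhds_iff.1 hev
  have hVW : (⟨V', hV'⟩ : Opens M) ≤ W := fun q hq => hV (hV'1 q hq).1
  have hcoeff : ∀ L (q : (⟨V', hV'⟩ : Opens M)), c.coeff hVW L (E.sheaf.res le_top F) q = G L ⟨q.1, hVW q.2⟩ := by
    intro L q
    have := c.coeff_res hVW le_rfl L (E.sheaf.res le_top F) q
    rwa [E.sheaf.res_res] at this
  obtain ⟨b, hb⟩ := c.exists_pull_eq hVW F f (fun L hL hLb => by
      ext q
      rw [hcoeff]
      exact c.coeff_eq_zero_of_vertical hV hvert hF hL hLb ⟨q.1, (hV'1 q.1 q.2).1⟩) (fun L hL hLb => by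
      ext q
      obtain ⟨h1, h2, h3, h4⟩ := hV'1 q.1 q.2
      rw [hcoeff]
      change _ = f L (E.body q.1)
      rw [h4 L ⟨hL, hLb⟩, ← hfst _ h3, ← hconst L _ h2, Function.comp_apply, e.left_inv h3]
      exact (extendZero_of_mem (G L) ⟨q.1, hVW q.2⟩).symm)
  exact ⟨b, ⟨V', hV'⟩, hpV', hb⟩

variable (E) in
/-- The submersion of bodies is open. -/
theorem eventually_exists_body_eq {p : M} {V : Set M} (hV : V ∈ 𝓝 p) :
    ∀ᶠ z in 𝓝 (E.body p), ∃ q ∈ V, E.body q = z := by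
  obtain ⟨K, e, hpe, hsrc, hfst, he, hes⟩ := exists_adapted_chart E.body p (E.submersion p)
  set ψ := extChartAt (𝓡 n) (E.body p) with hψ
  have hpfst : ψ (E.body p) = (e p).1 := (hfst p hpe).symm
  have h1 : ContinuousAt (fun z => (ψ z, (e p).2)) (E.body p) :=
    (continuousAt_extChartAt (E.body p)).prodMk continuousAt_const
  have h2 : (ψ (E.body p), (e p).2) = e p := by rw [hpfst]
  have h3 : ∀ᶠ y in 𝓝 (e p), y ∈ e.target ∧ e.symm y ∈ V := by
    refine (e.open_target.mem_nhds (e.map_source hpe) |> fun h => (h : ∀ᶠ y in 𝓝 (e p), y ∈ e.target)).and ?_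
    refine (e.continuousAt_symm (e.map_source hpe)).eventually ?_
    rw [e.left_inv hpe]
    exact hV
  rw [← h2] at h3
  filter_upwards [h1.eventually h3, (isOpen_extChartAt_source (I := 𝓡 n) (E.body p)).mem_nhds
    (mem_extChartAt_source _)] with z hz hzs
  refine ⟨_, hz.2, ?_⟩
  have hs := e.map_target hz.1
  refine ψ.injOn (hsrc _ hs) hzs ?_
  rw [← hfst _ hs, e.right_inv hz.1]

/-- A function of degree `k` killed by the vertical vector fields is the pullback of a form of degree `k`: the
fibres of `π` are connected, so the forms found near the points of a fibre agree. -/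
theorem exists_pull_eq_of_vertical {k : ℤ} {F : E.functions} (hFk : F ∈ E.functions.gr k)
    (hF : ∀ (l : ℤ) (Z : Vect E.functions l), IsVertical E.pull Z → Z F = 0) :
    ∃ b ∈ (functionsT1 n X).gr k, E.pull b = F := by
  have hloc : ∀ p : M, ∃ b ∈ (functionsT1 n X).gr k, ∃ V : Opens M, p ∈ V ∧
      E.sheaf.res (le_top : V ≤ ⊤) F = E.sheaf.res le_top (E.pull b) := by
    intro p
    obtain ⟨b, V, hp, h⟩ := exists_pull_eq_near hF p
    refine ⟨(functionsT1 n X).component k b, component_mem k b, V, hp, ?_⟩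
    rw [Hom.map_component, Hom.map_component, ← h, component_of_mem ((E.sheaf.res le_top).map_gr hFk)]
  choose h hk V hpV hres using hloc
  -- the forms found near two points of `E` agree over the common part
  have hagree : ∀ p q r, r ∈ V p → r ∈ V q → (h p).1 (E.body r) = (h q).1 (E.body r) := by
    intro p q r hp hq
    have h1 := congrArg (E.sheaf.res (inf_le_left : V p ⊓ V q ≤ V p)) (hres p)
    have h2 := congrArg (E.sheaf.res (inf_le_right : V p ⊓ V q ≤ V q)) (hres q)
    rw [E.sheaf.res_res, E.sheaf.res_res] at h1 h2
    have h3 : E.sheaf.res (le_top : V p ⊓ V q ≤ ⊤) (E.pull (h p - h q)) = 0 := by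
      rw [map_sub, map_sub, ← h1, ← h2, sub_self]
    exact sub_eq_zero.1 (eq_zero_of_res_pull (b := h p - h q) h3 ⟨hp, hq⟩)
  have hfib : ∀ p q, E.body p = E.body q → (h p).1 (E.body p) = (h q).1 (E.body p) := by
    intro p q hpq
    -- the value at the base point is locally constant along the fibre
    refine (E.fibres_connected (E.body p)).isPreconnected.induction₂'
      (fun q q' => (h q).1 (E.body p) = (h q').1 (E.body p)) ?_ (fun _ _ _ _ _ _ h1 h2 => h1.trans h2)
      (show p ∈ E.body ⁻¹' {E.body p} from rfl) (show q ∈ E.body ⁻¹' {E.body p} from hpq.symm)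
    intro r _
    filter_upwards [mem_nhdsWithin_of_mem_nhds ((V r).2.mem_nhds (hpV r)), self_mem_nhdsWithin] with r' hr' hr's
    have := hagree r r' r' hr' (hpV r')
    rw [show E.body r' = E.body p from hr's] at this
    exact ⟨this, this.symm⟩
  -- the global form takes at `z` the value of the form found near some point over `z`
  choose s hs using fun z => (E.fibres_connected z).nonempty
  have hα : ∀ p, ∀ᶠ z in 𝓝 (E.body p), (h (s z)).1 z = (h p).1 z := by
    intro p
    filter_upwards [E.eventually_exists_body_eq ((V p).2.mem_nhds (hpV p))] with z ⟨q, hq, hqz⟩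
    have h1 : E.body (s z) = z := hs z
    have h2 := hfib (s z) q (h1.trans hqz.symm)
    have h3 := hagree q p q (hpV q) hq
    rw [h1] at h2
    rw [hqz] at h3
    exact h2.trans h3
  have hαk : (fun z => (h (s z)).1 z) ∈ smoothForms n X k := by
    intro z
    obtain ⟨η, hη, h1⟩ := hk (s z) z
    refine ⟨η, hη, ?_⟩
    have h2 := hα (s z)
    rw [show E.body (s z) = z from hs z] at h2
    filter_upwards [h1, h2] with y hy1 hy2
    rw [hy2]
    exact hy1
  let α : functionsT1 n X := ⟨_, Submodule.mem_iSup_of_mem k hαk⟩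
  refine ⟨α, hαk, ?_⟩
  refine sub_eq_zero.1 (E.sheaf.eq_zero_of_locally _ fun p _ => ?_)
  obtain ⟨V', hpV', hV'⟩ := E.pull_congr (b := α) (b' := h p) (hα p)
  refine ⟨V' ⊓ V p, le_top, ⟨hpV', hpV p⟩, ?_⟩
  have h1 := congrArg (E.sheaf.res (inf_le_left : V' ⊓ V p ≤ V')) hV'
  have h2 := congrArg (E.sheaf.res (inf_le_right : V' ⊓ V p ≤ V p)) (hres p)
  rw [E.sheaf.res_res, E.sheaf.res_res] at h1 h2
  rw [map_sub, h1, h2, sub_self]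

end GradedBundle

/-! ### Two-forms and their differentials -/

theorem sgn_sq (m : ℤ) : sgn m ^ 2 = 1 := by rw [sq, sgn_mul_self]
theorem sgn_one : sgn 1 = -1 := sgn_odd odd_one

namespace GrAlg

variable {A : GrAlg.{u}}

/-- The function `i_Z i_Y i_X η`. -/
def contract3 {k l r : ℤ} (X : Vect A k) (Y : Vect A l) (Z : Vect A r) (η : Form A 3) : A := η k X l Y r Z

theorem diff_two_apply (om : Form A 2) {k l r : ℤ} (X : Vect A k) (Y : Vect A l) (Z : Vect A r) :
    contract3 X Y Z (diff om) = (
      sgn (k * (l + 1)) • (sgn (k * (r + 1)) • (X (contract2 Z Y om) - contract2 (bracket X Z) Y om)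
        - contract2 Z (bracket X Y) om)
      - sgn k • (sgn (l * (r + 1)) • (Y (contract2 Z X om) - contract2 (bracket Y Z) X om)
        - sgn l • Z (contract2 Y X om))) := rfl

theorem contract2_twoForm (i : ℤ) (a : A) (j : ℤ) (g h : A) {k l : ℤ} (Y : Vect A k) (X : Vect A l) :
    contract2 X Y (twoForm i a j g h) = sgn ((k + l) * i) • (a * (sgn ((l + 1) * (j + k)) • (Y g * X h)
    + sgn ((k + 1) * (j + 1)) • (X g * Y h))) := rfl

/-- The differential of `a dg dh`, by Cartan's formula: the terms with second derivatives cancel, and what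
remains is the antisymmetrisation of `X a · Y g · Z h`. -/
theorem diff_twoForm {i j t : ℤ} {a g h : A} (ha : a ∈ A.gr i) (hg : g ∈ A.gr j) (hh : h ∈ A.gr t)
    {k l r : ℤ} (X : Vect A k) (Y : Vect A l) (Z : Vect A r) :
    contract3 X Y Z (diff (twoForm i a j g h)) = (
      sgn ((l + 1) * (i + k) + (r + 1) * (i + k + j + l)) • (X a * (Y g * Z h))
      + sgn ((l + 1) * (i + k + j + 1) + (r + 1) * (i + k)) • (X a * (Z g * Y h))
      + sgn ((k + 1) * (i + 1) + (r + 1) * (i + l + j + k)) • (Y a * (X g * Z h))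
      + sgn ((k + 1) * (i + 1) + (l + 1) * (i + 1 + j + k)) • (Z a * (X g * Y h))
      + sgn ((k + 1) * (i + j) + (r + 1) * (i + l)) • (Y a * (Z g * X h))
      + sgn ((k + 1) * (i + j) + (l + 1) * (i + 1)) • (Z a * (Y g * X h))) := by
  rw [diff_two_apply]
  simp only [contract2_twoForm, bracket_apply]
  simp only [map_zsmul, map_add, Vect.leibniz X ha, Vect.leibniz Y ha, Vect.leibniz Z ha,
    Vect.leibniz X (Vect.map_gr Y hg), Vect.leibniz X (Vect.map_gr Z hg),
    Vect.leibniz Y (Vect.map_gr X hg), Vect.leibniz Y (Vect.map_gr Z hg),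
    Vect.leibniz Z (Vect.map_gr X hg), Vect.leibniz Z (Vect.map_gr Y hg)]
  simp only [mul_sub, sub_mul, mul_add, add_mul, smul_sub, smul_add, mul_smul_comm, smul_mul_assoc, smul_smul, ← sgn_add]
  -- each coefficient is an identity between products of the signs of single degrees
  match_scalars
  all_goals
    simp only [mul_one, one_mul, mul_add, add_mul, sgn_add, sgn_one]
    ring_nf
    try simp only [sgn_sq, mul_one, one_mul]
    try ring_nf
    try simp only [sgn_sq, mul_one, one_mul]
    try ring_nf

variable {B : GrAlg.{v}}

/-- Two maps that are additive and agree on generators agree on the subgroup generated by them. -/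
theorem eq_on_closure {G H : Type*} [AddGroup G] [AddCommGroup H] {s : Set G} {f f' : G → H}
    (hf : ∀ a b, f (a + b) = f a + f b) (hf' : ∀ a b, f' (a + b) = f' a + f' b)
    (h : ∀ a ∈ s, f a = f' a) {a : G} (ha : a ∈ AddSubgroup.closure s) : f a = f' a :=
  (AddSubgroup.closure_le (K := (AddMonoidHom.mk' f hf).eqLocus (AddMonoidHom.mk' f' hf'))).2 h ha

/-- The function `i_X θ`. -/
def contract1 {k : ℤ} (X : Vect A k) (θ : Form A 1) : A := contract X θ

theorem contract2_add (om om' : Form A 2) {k l : ℤ} (Y : Vect A k) (X : Vect A l) :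
    contract2 X Y (om + om') = contract2 X Y om + contract2 X Y om' := rfl

theorem contract3_diff_add (om om' : Form A 2) {k l r : ℤ} (X : Vect A k) (Y : Vect A l) (Z : Vect A r) :
    contract3 X Y Z (diff (om + om')) = contract3 X Y Z (diff om) + contract3 X Y Z (diff om') := by
  simp only [diff_two_apply, contract2_add, map_add, smul_add, smul_sub]
  abel

/-- The symmetry of a two-form as a bilinear form. -/
theorem contract2_comm {m : ℤ} {om : Form A 2} (hom : om ∈ Omega2 A m) {k l : ℤ} (Y : Vect A k) (X : Vect A l) :
    contract2 X Y om = sgn ((k + 1) * (l + 1)) • contract2 Y X om := by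
  refine eq_on_closure (f := fun om => contract2 X Y om) (fun _ _ => rfl)
    (f' := fun om => sgn ((k + 1) * (l + 1)) • contract2 Y X om)
    (fun _ _ => by rw [contract2_add, smul_add]) ?_ hom
  rintro _ ⟨i, j, t, a, ha, g, hg, h, hh, -, rfl⟩
  simp only [contract2_twoForm, smul_add, mul_add, mul_smul_comm, smul_smul, ← sgn_add]
  rw [add_comm]
  congr 1 <;> exact sgn_smul_congr (by grind) _

theorem contract_mem_Omega1 {m : ℤ} {om : Form A 2} (hom : om ∈ Omega2 A m) {k : ℤ} (Y : Vect A k) :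
    contract Y om ∈ Omega1 A (m + k) := by
  induction hom using AddSubgroup.closure_induction with
  | mem om h =>
    obtain ⟨i, j, t, a, ha, g, hg, h, hh, rfl, rfl⟩ := h
    have e : contract Y (twoForm i a j g h) =
        sgn ((k + 1) * i) • oneForm (i + (j + k)) (a * Y g) h +
        sgn ((k + 1) * i + (j + 1) * (t + 1)) • oneForm (i + (t + k)) (a * Y h) g := by
      funext l X
      change sgn ((k + l) * i) • (a * (sgn ((l + 1) * (j + k)) • (Y g * X h) + sgn ((k + 1) * (j + 1)) • (X g * Y h)))
        = sgn ((k + 1) * i) • (sgn ((l + 1) * (i + (j + k))) • (a * Y g * X h)) +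
        sgn ((k + 1) * i + (j + 1) * (t + 1)) • (sgn ((l + 1) * (i + (t + k))) • (a * Y h * X g))
      rw [mul_assoc, mul_assoc, A.comm (Vect.map_gr Y hh) (Vect.map_gr X hg)]
      simp only [smul_add, mul_add, mul_smul_comm, smul_smul, ← sgn_add]
      congr 1 <;> exact sgn_smul_congr (by grind) _
    rw [e]
    refine add_mem (zsmul_mem (AddSubgroup.subset_closure ?_) _) (zsmul_mem (AddSubgroup.subset_closure ?_) _)
    · exact ⟨_, t, _, A.mul_mem ha (Vect.map_gr Y hg), h, hh, by ring, rfl⟩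
    · exact ⟨_, j, _, A.mul_mem ha (Vect.map_gr Y hh), g, hg, by ring, rfl⟩
  | zero => exact zero_mem _
  | add om om' _ _ h h' => exact add_mem h h'
  | neg om _ h => exact neg_mem h

theorem diff_eq_oneForm (L : A) : diff (p := 0) L = oneForm 0 1 L := by
  funext k X
  change X L = sgn ((k + 1) * 0) • (1 * X L)
  rw [mul_zero, sgn_zero, one_smul, one_mul]

theorem ideal1_apply {π : Hom B A} {m : ℤ} {θ : Form A 1} (h : θ ∈ Ideal1 π m) {k : ℤ} {Z : Vect A k}
    (hZ : IsVertical π Z) : @Eq A (contract Z θ) 0 := by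
  refine eq_on_closure (H := A) (f := fun θ : Form A 1 => contract Z θ) (fun _ _ => rfl) (f' := fun _ => 0)
    (fun _ _ => (add_zero _).symm) ?_ h
  rintro _ ⟨i, j, a, -, b, -, -, rfl⟩
  change sgn ((k + 1) * i) • (a * Z (π b)) = 0
  rw [hZ, mul_zero, smul_zero]

theorem ideal2_apply {π : Hom B A} {m : ℤ} {η : Form A 2} (h : η ∈ Ideal2 π m) {k l : ℤ} {Y : Vect A k} {Z : Vect A l}
    (hY : IsVertical π Y) (hZ : IsVertical π Z) : contract2 Z Y η = 0 := by
  refine eq_on_closure (f := fun η : Form A 2 => contract2 Z Y η) (fun _ _ => rfl) (f' := fun _ => 0)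
    (fun _ _ => (add_zero _).symm) ?_ h
  rintro _ ⟨i, j, t, a, -, g, -, b, -, -, rfl⟩
  rw [contract2_twoForm, hY, hZ]
  simp

theorem IsVertical.bracket {π : Hom B A} {k l : ℤ} {Y : Vect A k} {Z : Vect A l} (hY : IsVertical π Y)
    (hZ : IsVertical π Z) : IsVertical π (bracket Y Z) := by
  intro b
  rw [bracket_apply, hY, hZ, map_zero, map_zero, smul_zero, sub_zero]

/-- The value of `i_V om` on a vertical vector field, for a hamiltonian vector field `V`. -/
theorem contract2_of_hamiltonian {π : Hom B A} {m : ℤ} {om : Form A 2} {k : ℤ} {V : Vect A k} {J : A}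
    (h : contract V om + diff (p := 0) J ∈ Ideal1 π m) {l : ℤ} {Z : Vect A l} (hZ : IsVertical π Z) :
    contract2 Z V om = - Z J :=
  eq_neg_of_add_eq_zero_left (ideal1_apply h hZ)

/-! ### Forms along a homomorphism

A homomorphism `p : A → B` is the pullback of functions along a map, and derivations along `p` are the vector
fields along that map. A two-form `om` over `A` is defined on vector fields over `A` only; the value of its
pullback on vector fields over `B` needs `om` on vector fields along the map. As `om` is a sum of forms
`a dg dh`, such values exist, but they depend on the presentation of the sum as long as the vector fields along
the map are not known to be combinations of those over `A`. Hence a form is carried together with its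
continuation to vector fields along `p`, as a pair or triple. Vector fields along `p` are encoded as linear
maps, with the degree as a separate argument. -/

/-- The linear map underlying a homomorphism. -/
def Hom.lin (p : Hom A B) : A →ₗ[ℝ] B := p.toAlgHom.toLinearMap

/-- Derivations of degree `k` along a homomorphism `p`: vector fields along the corresponding map. -/
structure IsDerAlong (p : Hom A B) (k : ℤ) (x : A →ₗ[ℝ] B) : Prop where
  map_gr : ∀ {i a}, a ∈ A.gr i → x a ∈ B.gr (i + k)
  leibniz : ∀ {i a}, a ∈ A.gr i → ∀ b, x (a * b) = x a * p b + sgn (k * i) • (p a * x b)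

theorem Vect.isDerAlong_comp_lin (p : Hom A B) {k : ℤ} (X : Vect B k) : IsDerAlong p k (X.1 ∘ₗ p.lin) where
  map_gr ha := Vect.map_gr X (p.map_gr ha)
  leibniz {i a} ha b := by
    change X (p (a * b)) = X (p a) * p b + sgn (k * i) • (p a * X (p b))
    rw [map_mul p.toAlgHom, Vect.leibniz X (p.map_gr ha)]

theorem Vect.isDerAlong_lin_comp (p : Hom A B) {k : ℤ} (X : Vect A k) : IsDerAlong p k (p.lin ∘ₗ X.1) where
  map_gr ha := p.map_gr (Vect.map_gr X ha)
  leibniz {i a} ha b := by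
    change p (X (a * b)) = p (X a) * p b + sgn (k * i) • (p a * p (X b))
    rw [Vect.leibniz X ha, map_add, map_zsmul, map_mul p.toAlgHom, map_mul p.toAlgHom]

section Along

variable (p : Hom A B)

/-- The one-form `a dg` along `p`, as a function of vector fields along `p`. -/
def oneAlong (i : ℤ) (a g : A) (k : ℤ) (x : A →ₗ[ℝ] B) : B := sgn ((k + 1) * i) • (p a * x g)

/-- The two-form `a dg dh` along `p`, given by the formula for `twoForm`. -/
def twoAlong (i : ℤ) (a : A) (j : ℤ) (g h : A) (k : ℤ) (y : A →ₗ[ℝ] B) (l : ℤ) (x : A →ₗ[ℝ] B) : B :=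
  sgn ((k + l) * i) • (p a * (sgn ((l + 1) * (j + k)) • (y g * x h) + sgn ((k + 1) * (j + 1)) • (x g * y h)))

/-- The three-form `da dg dh` along `p`, given by the formula of `diff_twoForm`. -/
def threeAlong (i : ℤ) (a : A) (j : ℤ) (g h : A) (k : ℤ) (x : A →ₗ[ℝ] B) (l : ℤ) (y : A →ₗ[ℝ] B) (r : ℤ)
    (z : A →ₗ[ℝ] B) : B :=
  sgn ((l + 1) * (i + k) + (r + 1) * (i + k + j + l)) • (x a * (y g * z h))
  + sgn ((l + 1) * (i + k + j + 1) + (r + 1) * (i + k)) • (x a * (z g * y h))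
  + sgn ((k + 1) * (i + 1) + (r + 1) * (i + l + j + k)) • (y a * (x g * z h))
  + sgn ((k + 1) * (i + 1) + (l + 1) * (i + 1 + j + k)) • (z a * (x g * y h))
  + sgn ((k + 1) * (i + j) + (r + 1) * (i + l)) • (y a * (z g * x h))
  + sgn ((k + 1) * (i + j) + (l + 1) * (i + 1)) • (z a * (y g * x h))

/-- Pairs of a one-form of degree `m` and the corresponding one-form along `p`. -/
def Pull1 (m : ℤ) : AddSubgroup (Form A 1 × (ℤ → (A →ₗ[ℝ] B) → B)) :=
  AddSubgroup.closure {q | ∃ i j : ℤ, ∃ a ∈ A.gr i, ∃ g ∈ A.gr j, i + j = m ∧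
    q = (oneForm i a g, oneAlong p i a g)}

/-- Triples of a two-form of degree `m`, the corresponding two-form along `p`, and its differential. -/
def Pull2 (m : ℤ) : AddSubgroup (Form A 2 × (ℤ → (A →ₗ[ℝ] B) → ℤ → (A →ₗ[ℝ] B) → B) ×
    (ℤ → (A →ₗ[ℝ] B) → ℤ → (A →ₗ[ℝ] B) → ℤ → (A →ₗ[ℝ] B) → B)) :=
  AddSubgroup.closure {q | ∃ i j t : ℤ, ∃ a ∈ A.gr i, ∃ g ∈ A.gr j, ∃ h ∈ A.gr t, i + j + t = m ∧
    q = (twoForm i a j g h, twoAlong p i a j g h, threeAlong i a j g h)}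

theorem mem_pull1 {i j m : ℤ} {a g : A} (ha : a ∈ A.gr i) (hg : g ∈ A.gr j) (h : i + j = m) :
    (oneForm i a g, oneAlong p i a g) ∈ Pull1 p m :=
  AddSubgroup.subset_closure ⟨i, j, a, ha, g, hg, h, rfl⟩

theorem exists_pull2 {m : ℤ} {om : Form A 2} (hom : om ∈ Omega2 A m) : ∃ q ∈ Pull2 p m, q.1 = om := by
  induction hom using AddSubgroup.closure_induction with
  | mem om h =>
    obtain ⟨i, j, t, a, ha, g, hg, h, hh, e, rfl⟩ := h
    exact ⟨_, AddSubgroup.subset_closure ⟨i, j, t, a, ha, g, hg, h, hh, e, rfl⟩, rfl⟩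
  | zero => exact ⟨0, zero_mem _, rfl⟩
  | add om om' _ _ h h' =>
    obtain ⟨q, hq, rfl⟩ := h
    obtain ⟨q', hq', rfl⟩ := h'
    exact ⟨q + q', add_mem hq hq', rfl⟩
  | neg om _ h =>
    obtain ⟨q, hq, rfl⟩ := h
    exact ⟨-q, neg_mem hq, rfl⟩

/-- The form on `B` given by a one-form along `p`. -/
def toForm1 (S : ℤ → (A →ₗ[ℝ] B) → B) : Form B 1 := fun k X => S k (X.1 ∘ₗ p.lin)

/-- The form on `B` given by a two-form along `p`. -/
def toForm2 (R : ℤ → (A →ₗ[ℝ] B) → ℤ → (A →ₗ[ℝ] B) → B) : Form B 2 := fun k Y l X =>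
  R k (Y.1 ∘ₗ p.lin) l (X.1 ∘ₗ p.lin)

variable {p}

/-- Multiplication of a vector field along `p` by a function. -/
def lmul (c : B) (x : A →ₗ[ℝ] B) : A →ₗ[ℝ] B := LinearMap.mulLeft ℝ c ∘ₗ x

theorem lmul_apply (c : B) (x : A →ₗ[ℝ] B) (a : A) : lmul c x a = c * x a := rfl

theorem mul_mul_comm_left {i e : ℤ} {a c : B} (ha : a ∈ B.gr i) (hc : c ∈ B.gr e) (b : B) :
    a * (c * b) = sgn (i * e) • (c * (a * b)) := by
  rw [← mul_assoc, B.comm ha hc, smul_mul_assoc, mul_assoc]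

section One

variable {m : ℤ} {q : Form A 1 × (ℤ → (A →ₗ[ℝ] B) → B)} (hq : q ∈ Pull1 p m)
include hq

theorem pull1_add (k : ℤ) (x y : A →ₗ[ℝ] B) : q.2 k (x + y) = q.2 k x + q.2 k y := by
  refine eq_on_closure (f := fun q => q.2 k (x + y)) (fun _ _ => rfl) (f' := fun q => q.2 k x + q.2 k y)
    (fun a b => add_add_add_comm (a.2 k x) (b.2 k x) (a.2 k y) (b.2 k y)) ?_ hq
  rintro _ ⟨i, j, a, -, g, -, -, rfl⟩
  simp only [oneAlong, LinearMap.add_apply, mul_add, smul_add]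

theorem pull1_lmul (k : ℤ) {e : ℤ} {c : B} (hc : c ∈ B.gr e) (x : A →ₗ[ℝ] B) :
    q.2 k (lmul c x) = c * q.2 (k - e) x := by
  refine eq_on_closure (f := fun q => q.2 k (lmul c x)) (fun _ _ => rfl) (f' := fun q => c * q.2 (k - e) x)
    (fun a b => mul_add c (a.2 (k - e) x) (b.2 (k - e) x)) ?_ hq
  rintro _ ⟨i, j, a, ha, g, -, -, rfl⟩
  simp only [oneAlong, lmul_apply]
  rw [mul_mul_comm_left (p.map_gr ha) hc, mul_smul_comm, smul_smul, ← sgn_add]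
  exact sgn_smul_congr (by grind) _

theorem pull1_lin (k : ℤ) (X : Vect A k) : q.2 k (p.lin ∘ₗ X.1) = p (contract1 X q.1) := by
  refine eq_on_closure (f := fun q => q.2 k (p.lin ∘ₗ X.1)) (fun _ _ => rfl)
    (f' := fun q => p (contract1 X q.1))
    (fun a b => map_add p.toAlgHom _ _) ?_ hq
  rintro _ ⟨i, j, a, ha, g, -, -, rfl⟩
  change sgn ((k + 1) * i) • (p a * p (X g)) = p (sgn ((k + 1) * i) • (a * X g))
  rw [map_zsmul, map_mul p.toAlgHom]

end One

section Two

variable {m : ℤ} {q : Form A 2 × (ℤ → (A →ₗ[ℝ] B) → ℤ → (A →ₗ[ℝ] B) → B) ×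
    (ℤ → (A →ₗ[ℝ] B) → ℤ → (A →ₗ[ℝ] B) → ℤ → (A →ₗ[ℝ] B) → B)} (hq : q ∈ Pull2 p m)
include hq

theorem pull2_add_left (k : ℤ) (y y' : A →ₗ[ℝ] B) (l : ℤ) (x : A →ₗ[ℝ] B) :
    q.2.1 k (y + y') l x = q.2.1 k y l x + q.2.1 k y' l x := by
  refine eq_on_closure (f := fun q => q.2.1 k (y + y') l x) (fun _ _ => rfl)
    (f' := fun q => q.2.1 k y l x + q.2.1 k y' l x)
    (fun a b => add_add_add_comm (a.2.1 k y l x) (b.2.1 k y l x) (a.2.1 k y' l x) (b.2.1 k y' l x)) ?_ hq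
  rintro _ ⟨i, j, t, a, -, g, -, h, -, -, rfl⟩
  simp only [twoAlong, LinearMap.add_apply, mul_add, add_mul, smul_add]
  abel

theorem pull2_add_right (k : ℤ) (y : A →ₗ[ℝ] B) (l : ℤ) (x x' : A →ₗ[ℝ] B) :
    q.2.1 k y l (x + x') = q.2.1 k y l x + q.2.1 k y l x' := by
  refine eq_on_closure (f := fun q => q.2.1 k y l (x + x')) (fun _ _ => rfl)
    (f' := fun q => q.2.1 k y l x + q.2.1 k y l x')
    (fun a b => add_add_add_comm (a.2.1 k y l x) (b.2.1 k y l x) (a.2.1 k y l x') (b.2.1 k y l x')) ?_ hq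
  rintro _ ⟨i, j, t, a, -, g, -, h, -, -, rfl⟩
  simp only [twoAlong, LinearMap.add_apply, mul_add, add_mul, smul_add]
  abel

theorem pull2_lmul_left (k : ℤ) {e : ℤ} {c : B} (hc : c ∈ B.gr e) (y : A →ₗ[ℝ] B)
    {l : ℤ} {x : A →ₗ[ℝ] B} (hx : IsDerAlong p l x) :
    q.2.1 k (lmul c y) l x = sgn ((l + 1) * e) • (c * q.2.1 (k - e) y l x) := by
  refine eq_on_closure (f := fun q => q.2.1 k (lmul c y) l x) (fun _ _ => rfl)
    (f' := fun q => sgn ((l + 1) * e) • (c * q.2.1 (k - e) y l x))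
    (fun a b => by
      rw [← smul_add, ← mul_add]
      rfl) ?_ hq
  rintro _ ⟨i, j, t, a, ha, g, hg, h, -, -, rfl⟩
  simp only [twoAlong, lmul_apply, mul_add, smul_add, mul_smul_comm, mul_assoc]
  rw [mul_mul_comm_left (hx.map_gr hg) hc, mul_mul_comm_left (p.map_gr ha) hc]
  simp only [mul_smul_comm]
  rw [mul_mul_comm_left (p.map_gr ha) hc]
  simp only [smul_smul, ← sgn_add]
  congr 1 <;> exact sgn_smul_congr (by grind) _

theorem pull2_lmul_right {k : ℤ} {y : A →ₗ[ℝ] B} (hy : IsDerAlong p k y) (l : ℤ) {e : ℤ} {c : B}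
    (hc : c ∈ B.gr e) (x : A →ₗ[ℝ] B) :
    q.2.1 k y l (lmul c x) = c * q.2.1 k y (l - e) x := by
  refine eq_on_closure (f := fun q => q.2.1 k y l (lmul c x)) (fun _ _ => rfl)
    (f' := fun q => c * q.2.1 k y (l - e) x)
    (fun a b => by
      rw [← mul_add]
      rfl) ?_ hq
  rintro _ ⟨i, j, t, a, ha, g, hg, h, -, -, rfl⟩
  simp only [twoAlong, lmul_apply, mul_add, smul_add, mul_smul_comm, mul_assoc]
  rw [mul_mul_comm_left (hy.map_gr hg) hc, mul_mul_comm_left (p.map_gr ha) hc]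
  simp only [mul_smul_comm]
  rw [mul_mul_comm_left (p.map_gr ha) hc]
  simp only [smul_smul, ← sgn_add]
  congr 1 <;> exact sgn_smul_congr (by grind) _

theorem pull2_lin (k : ℤ) (Y : Vect A k) (l : ℤ) (X : Vect A l) :
    q.2.1 k (p.lin ∘ₗ Y.1) l (p.lin ∘ₗ X.1) = p (contract2 X Y q.1) := by
  refine eq_on_closure (f := fun q => q.2.1 k (p.lin ∘ₗ Y.1) l (p.lin ∘ₗ X.1)) (fun _ _ => rfl)
    (f' := fun q => p (contract2 X Y q.1))
    (fun a b => by rw [← map_add]; rfl) ?_ hq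
  rintro _ ⟨i, j, t, a, ha, g, hg, h, -, -, rfl⟩
  rw [contract2_twoForm]
  change sgn ((k + l) * i) • (p a * (sgn ((l + 1) * (j + k)) • (p (Y g) * p (X h)) +
    sgn ((k + 1) * (j + 1)) • (p (X g) * p (Y h)))) = _
  simp only [map_zsmul, map_mul p.toAlgHom, map_add]

/-- The contraction of a two-form with `p ∘ Y` agrees, on vector fields along `p`, with a one-form
along `p` that corresponds to `i_Y` of the two-form. -/
theorem pull2_contract (k : ℤ) (Y : Vect A k) :
    ∃ S, (contract Y q.1, S) ∈ Pull1 p (m + k) ∧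
      ∀ l x, IsDerAlong p l x → q.2.1 k (p.lin ∘ₗ Y.1) l x = S l x := by
  induction hq using AddSubgroup.closure_induction with
  | mem q h =>
    obtain ⟨i, j, t, a, ha, g, hg, h, hh, rfl, rfl⟩ := h
    have e : contract Y (twoForm i a j g h) =
        sgn ((k + 1) * i) • oneForm (i + (j + k)) (a * Y g) h +
        sgn ((k + 1) * i + (j + 1) * (t + 1)) • oneForm (i + (t + k)) (a * Y h) g := by
      funext l X
      change sgn ((k + l) * i) • (a * (sgn ((l + 1) * (j + k)) • (Y g * X h) + sgn ((k + 1) * (j + 1)) • (X g * Y h)))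
        = sgn ((k + 1) * i) • (sgn ((l + 1) * (i + (j + k))) • (a * Y g * X h)) +
        sgn ((k + 1) * i + (j + 1) * (t + 1)) • (sgn ((l + 1) * (i + (t + k))) • (a * Y h * X g))
      rw [mul_assoc, mul_assoc, A.comm (Vect.map_gr Y hh) (Vect.map_gr X hg)]
      simp only [smul_add, mul_add, mul_smul_comm, smul_smul, ← sgn_add]
      congr 1 <;> exact sgn_smul_congr (by grind) _
    refine ⟨sgn ((k + 1) * i) • oneAlong p (i + (j + k)) (a * Y g) h +
          sgn ((k + 1) * i + (j + 1) * (t + 1)) • oneAlong p (i + (t + k)) (a * Y h) g, ?_, ?_⟩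
    · rw [e]
      exact add_mem
        (zsmul_mem (mem_pull1 p (A.mul_mem ha (Vect.map_gr Y hg)) hh (by ring)) (sgn ((k + 1) * i)))
        (zsmul_mem (mem_pull1 p (A.mul_mem ha (Vect.map_gr Y hh)) hg (by ring))
          (sgn ((k + 1) * i + (j + 1) * (t + 1))))
    · intro l x hx
      change sgn ((k + l) * i) • (p a * (sgn ((l + 1) * (j + k)) • (p (Y g) * x h) +
          sgn ((k + 1) * (j + 1)) • (x g * p (Y h))))
        = sgn ((k + 1) * i) • (sgn ((l + 1) * (i + (j + k))) • (p (a * Y g) * x h)) +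
        sgn ((k + 1) * i + (j + 1) * (t + 1)) • (sgn ((l + 1) * (i + (t + k))) • (p (a * Y h) * x g))
      rw [map_mul p.toAlgHom, map_mul p.toAlgHom, mul_assoc, mul_assoc,
        B.comm (p.map_gr (Vect.map_gr Y hh)) (hx.map_gr hg)]
      simp only [smul_add, mul_add, mul_smul_comm, smul_smul, ← sgn_add]
      congr 1 <;> exact sgn_smul_congr (by grind) _
  | zero => exact ⟨0, zero_mem _, fun _ _ _ => rfl⟩
  | add q q' _ _ h h' =>
    obtain ⟨S, hS, e⟩ := h
    obtain ⟨S', hS', e'⟩ := h'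
    exact ⟨S + S', add_mem hS hS', fun l x hx => congrArg₂ (· + ·) (e l x hx) (e' l x hx)⟩
  | neg q _ h =>
    obtain ⟨S, hS, e⟩ := h
    exact ⟨-S, neg_mem hS, fun l x hx => congrArg Neg.neg (e l x hx)⟩

theorem toForm2_mem : toForm2 p q.2.1 ∈ Omega2 B m := by
  induction hq using AddSubgroup.closure_induction with
  | mem q h =>
    obtain ⟨i, j, t, a, ha, g, hg, h, hh, e, rfl⟩ := h
    exact AddSubgroup.subset_closure
      ⟨i, j, t, p a, p.map_gr ha, p g, p.map_gr hg, p h, p.map_gr hh, e, rfl⟩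
  | zero => exact zero_mem _
  | add q q' _ _ h h' => exact add_mem h h'
  | neg q _ h => exact neg_mem h

/-- The third component of a triple gives the differential of the pulled back two-form. -/
theorem diff_toForm2 {k l r : ℤ} (X : Vect B k) (Y : Vect B l) (Z : Vect B r) :
    contract3 X Y Z (diff (toForm2 p q.2.1)) =
      q.2.2 k (X.1 ∘ₗ p.lin) l (Y.1 ∘ₗ p.lin) r (Z.1 ∘ₗ p.lin) := by
  induction hq using AddSubgroup.closure_induction with
  | mem q h =>
    obtain ⟨i, j, t, a, ha, g, hg, h, hh, -, rfl⟩ := h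
    exact diff_twoForm (p.map_gr ha) (p.map_gr hg) (p.map_gr hh) X Y Z
  | zero =>
    have h := contract3_diff_add (0 : Form B 2) 0 X Y Z
    rw [add_zero, left_eq_add] at h
    exact h
  | add a b _ _ ha hb =>
    exact (contract3_diff_add (toForm2 p a.2.1) (toForm2 p b.2.1) X Y Z).trans (congrArg₂ (· + ·) ha hb)
  | neg a _ ha =>
    have h := contract3_diff_add (toForm2 p a.2.1) (-toForm2 p a.2.1) X Y Z
    have h0 := contract3_diff_add (0 : Form B 2) 0 X Y Z
    rw [add_zero, left_eq_add] at h0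
    rw [add_neg_cancel, h0, eq_comm, ha] at h
    exact (neg_eq_of_add_eq_zero_right h).symm

theorem pull3_lin {k l r : ℤ} (X : Vect A k) (Y : Vect A l) (Z : Vect A r) :
    q.2.2 k (p.lin ∘ₗ X.1) l (p.lin ∘ₗ Y.1) r (p.lin ∘ₗ Z.1) = p (contract3 X Y Z (diff q.1)) := by
  refine eq_on_closure (f := fun q => q.2.2 k (p.lin ∘ₗ X.1) l (p.lin ∘ₗ Y.1) r (p.lin ∘ₗ Z.1))
    (f' := fun q => p (contract3 X Y Z (diff q.1))) (fun _ _ => rfl) (fun a b => ?_) ?_ hq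
  · rw [← map_add, ← contract3_diff_add]
    rfl
  · rintro _ ⟨i, j, t, a, ha, g, hg, h, hh, -, rfl⟩
    rw [diff_twoForm ha hg hh X Y Z]
    simp only [map_add, map_zsmul, map_mul p.toAlgHom]
    rfl

theorem pull3_add₁ (k : ℤ) (x x' : A →ₗ[ℝ] B) (l : ℤ) (y : A →ₗ[ℝ] B) (r : ℤ) (z : A →ₗ[ℝ] B) :
    q.2.2 k (x + x') l y r z = q.2.2 k x l y r z + q.2.2 k x' l y r z := by
  refine eq_on_closure (f := fun q => q.2.2 k (x + x') l y r z) (fun _ _ => rfl)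
    (f' := fun q => q.2.2 k x l y r z + q.2.2 k x' l y r z) (fun a b => add_add_add_comm _ _ _ _) ?_ hq
  rintro _ ⟨i, j, t, a, -, g, -, h, -, -, rfl⟩
  simp only [threeAlong, LinearMap.add_apply, mul_add, add_mul, smul_add]
  abel

theorem pull3_add₂ (k : ℤ) (x : A →ₗ[ℝ] B) (l : ℤ) (y y' : A →ₗ[ℝ] B) (r : ℤ) (z : A →ₗ[ℝ] B) :
    q.2.2 k x l (y + y') r z = q.2.2 k x l y r z + q.2.2 k x l y' r z := by
  refine eq_on_closure (f := fun q => q.2.2 k x l (y + y') r z) (fun _ _ => rfl)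
    (f' := fun q => q.2.2 k x l y r z + q.2.2 k x l y' r z) (fun a b => add_add_add_comm _ _ _ _) ?_ hq
  rintro _ ⟨i, j, t, a, -, g, -, h, -, -, rfl⟩
  simp only [threeAlong, LinearMap.add_apply, mul_add, add_mul, smul_add]
  abel

theorem pull3_add₃ (k : ℤ) (x : A →ₗ[ℝ] B) (l : ℤ) (y : A →ₗ[ℝ] B) (r : ℤ) (z z' : A →ₗ[ℝ] B) :
    q.2.2 k x l y r (z + z') = q.2.2 k x l y r z + q.2.2 k x l y r z' := by
  refine eq_on_closure (f := fun q => q.2.2 k x l y r (z + z')) (fun _ _ => rfl)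
    (f' := fun q => q.2.2 k x l y r z + q.2.2 k x l y r z') (fun a b => add_add_add_comm _ _ _ _) ?_ hq
  rintro _ ⟨i, j, t, a, -, g, -, h, -, -, rfl⟩
  simp only [threeAlong, LinearMap.add_apply, mul_add, add_mul, smul_add]
  abel

theorem pull3_lmul₁ (k : ℤ) {e : ℤ} {c : B} (hc : c ∈ B.gr e) (x : A →ₗ[ℝ] B)
    {l : ℤ} {y : A →ₗ[ℝ] B} (hy : IsDerAlong p l y) {r : ℤ} {z : A →ₗ[ℝ] B} (hz : IsDerAlong p r z) :
    q.2.2 k (lmul c x) l y r z = sgn (e * (l + r)) • (c * q.2.2 (k - e) x l y r z) := by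
  refine eq_on_closure (f := fun q => q.2.2 k (lmul c x) l y r z) (fun _ _ => rfl)
    (f' := fun q => sgn (e * (l + r)) • (c * q.2.2 (k - e) x l y r z))
    (fun a b => by
      rw [← smul_add, ← mul_add]
      rfl) ?_ hq
  rintro _ ⟨i, j, t, a, ha, g, hg, h, hh, -, rfl⟩
  simp only [threeAlong, lmul_apply, mul_add, smul_add, mul_smul_comm, mul_assoc, smul_smul,
    mul_mul_comm_left (hz.map_gr hg) hc, mul_mul_comm_left (hy.map_gr hg) hc,
    mul_mul_comm_left (hz.map_gr ha) hc, mul_mul_comm_left (hy.map_gr ha) hc, ← sgn_add]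
  congr 1; congr 1; congr 1; congr 1; congr 1
  all_goals exact sgn_smul_congr (by grind) _

theorem pull3_lmul₂ {k : ℤ} {x : A →ₗ[ℝ] B} (hx : IsDerAlong p k x) (l : ℤ) {e : ℤ} {c : B}
    (hc : c ∈ B.gr e) (y : A →ₗ[ℝ] B) {r : ℤ} {z : A →ₗ[ℝ] B} (hz : IsDerAlong p r z) :
    q.2.2 k x l (lmul c y) r z = sgn (e * (r + 1)) • (c * q.2.2 k x (l - e) y r z) := by
  refine eq_on_closure (f := fun q => q.2.2 k x l (lmul c y) r z) (fun _ _ => rfl)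
    (f' := fun q => sgn (e * (r + 1)) • (c * q.2.2 k x (l - e) y r z))
    (fun a b => by
      rw [← smul_add, ← mul_add]
      rfl) ?_ hq
  rintro _ ⟨i, j, t, a, ha, g, hg, h, hh, -, rfl⟩
  simp only [threeAlong, lmul_apply, mul_add, smul_add, mul_smul_comm, mul_assoc, smul_smul,
    mul_mul_comm_left (hz.map_gr hg) hc, mul_mul_comm_left (hx.map_gr hg) hc,
    mul_mul_comm_left (hz.map_gr ha) hc, mul_mul_comm_left (hx.map_gr ha) hc, ← sgn_add]
  congr 1; congr 1; congr 1; congr 1; congr 1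
  all_goals exact sgn_smul_congr (by grind) _

theorem pull3_lmul₃ {k : ℤ} {x : A →ₗ[ℝ] B} (hx : IsDerAlong p k x) {l : ℤ} {y : A →ₗ[ℝ] B}
    (hy : IsDerAlong p l y) (r : ℤ) {e : ℤ} {c : B} (hc : c ∈ B.gr e) (z : A →ₗ[ℝ] B) :
    q.2.2 k x l y r (lmul c z) = c * q.2.2 k x l y (r - e) z := by
  refine eq_on_closure (f := fun q => q.2.2 k x l y r (lmul c z)) (fun _ _ => rfl)
    (f' := fun q => c * q.2.2 k x l y (r - e) z)
    (fun a b => by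
      rw [← mul_add]
      rfl) ?_ hq
  rintro _ ⟨i, j, t, a, ha, g, hg, h, hh, -, rfl⟩
  simp only [threeAlong, lmul_apply, mul_add, mul_smul_comm, mul_assoc, smul_smul,
    mul_mul_comm_left (hy.map_gr hg) hc, mul_mul_comm_left (hx.map_gr hg) hc,
    mul_mul_comm_left (hy.map_gr ha) hc, mul_mul_comm_left (hx.map_gr ha) hc, ← sgn_add]
  congr 1; congr 1; congr 1; congr 1; congr 1
  all_goals exact sgn_smul_congr (by grind) _

end Two
end Along
end GrAlg

/-! ### Vector fields along the projection that forgets formal variables -/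

namespace GrAlg

variable {A : GrAlg.{u}} {B : GrAlg.{v}}

theorem IsDerAlong.lmul {p : Hom A B} {k e m : ℤ} {x : A →ₗ[ℝ] B} (hx : IsDerAlong p k x) {c : B}
    (hc : c ∈ B.gr e) (h : e + k = m) : IsDerAlong p m (lmul c x) where
  map_gr {i a} ha := by
    have h1 := B.mul_mem hc (hx.map_gr ha)
    rwa [show e + (i + k) = i + m by rw [← h]; ring] at h1
  leibniz {i a} ha b := by
    simp only [lmul_apply, hx.leibniz ha, mul_add, mul_smul_comm]
    rw [mul_mul_comm_left (p.map_gr ha) hc, smul_smul, ← sgn_add, mul_assoc]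
    congr 1
    refine sgn_smul_congr ?_ _
    rw [← h]
    grind

/-- A vector field along the identity is a vector field. -/
def IsDerAlong.toVect {p : Hom A A} (hp : ∀ a, p a = a) {k : ℤ} {x : A →ₗ[ℝ] A} (hx : IsDerAlong p k x) :
    Vect A k :=
  ⟨x, fun _ _ ha => hx.map_gr ha, fun i a ha b => by rw [hx.leibniz ha, hp, hp]⟩

/-- A one-form along `p` is determined, on vector fields along `p`, by the corresponding form. -/
def IsDense (p : Hom A B) : Prop :=
  ∀ m S, ((0 : Form A 1), S) ∈ Pull1 p m → ∀ k x, IsDerAlong p k x → S k x = 0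

theorem isDense_of_forall_eq {p : Hom A A} (hp : ∀ a, p a = a) : IsDense p := by
  intro m S hS k x hx
  have h := pull1_lin hS k (hx.toVect hp)
  have e : p.lin ∘ₗ (hx.toVect hp).1 = x := LinearMap.ext fun a => hp _
  rw [e] at h
  exact h.trans (map_zero p.toAlgHom)

section Formal

variable {r : ℕ} {d : Fin r → ℤ}

/-- The constant term, in the formal variables, of a vector field along the projection. -/
def IsDerAlong.constTerm {k : ℤ} {x : A →ₗ[ℝ] formal A d} (hx : IsDerAlong (const A d) k x) : Vect A k :=
  ⟨coeff 0 ∘ₗ x, fun i a ha => by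
    have h := coeff_mem (hx.map_gr ha) 0
    rwa [mdeg_zero, sub_zero] at h, fun i a ha b => by
    rw [LinearMap.comp_apply, hx.leibniz ha, map_add, map_zsmul, coeff_mul_const, coeff_const_mul,
      mdeg_zero, A.twist_zero]
    rfl⟩

theorem IsDerAlong.peel {k : ℤ} {x : A →ₗ[ℝ] formal A d} (hx : IsDerAlong (const A d) k x) (i : Fin r) :
    IsDerAlong (const A d) (k - d i) (peel i ∘ₗ x) where
  map_gr {j a} ha := by
    have h := peel_mem i (hx.map_gr ha)
    rwa [add_sub_assoc] at h
  leibniz {j a} ha b := by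
    rw [LinearMap.comp_apply, hx.leibniz ha, map_add, map_zsmul, peel_mul_const, peel_const_mul i ha,
      smul_smul, ← sgn_add]
    exact congrArg _ (sgn_smul_congr (by grind) _)

/-- Every vector field along the projection is one of the base plus a combination, with the formal variables as
coefficients, of vector fields along the projection. -/
theorem IsDerAlong.eq_add_sum {k : ℤ} {x : A →ₗ[ℝ] formal A d} (hx : IsDerAlong (const A d) k x) :
    x = (const A d).lin ∘ₗ hx.constTerm.1 + ∑ i, GrAlg.lmul (var A d i) (GrAlg.peel i ∘ₗ x) := by
  ext1 a
  rw [LinearMap.add_apply, LinearMap.sum_apply]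
  exact eq_const_add_sum_var_mul_peel (x a)

/-- A tensorial expression in vector fields along the projection that vanishes on the vector fields of
the base vanishes: by iteration of `IsDerAlong.eq_add_sum` its values vanish to any order in the variables. -/
theorem eq_zero_of_lmul_var (T : ℤ → (A →ₗ[ℝ] formal A d) → formal A d)
    (hadd : ∀ k x y, T k (x + y) = T k x + T k y) (ε : ℤ → Fin r → ℤ)
    (hmul : ∀ k i x, T k (lmul (var A d i) x) = ε k i • (var A d i * T (k - d i) x))
    (hlin : ∀ k (X : Vect A k), T k ((const A d).lin ∘ₗ X.1) = 0) {k : ℤ} {x : A →ₗ[ℝ] formal A d}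
    (hx : IsDerAlong (const A d) k x) : T k x = 0 := by
  refine eq_zero_of_eq_sum_var_mul
    (ι := Σ k, {x : A →ₗ[ℝ] formal A d // IsDerAlong (const A d) k x})
    (Φ := fun y => T y.1 y.2.1) ?_ ⟨k, x, hx⟩
  rintro ⟨k, x, hx⟩
  refine ⟨fun i => ⟨k - d i, _, hx.peel i⟩, fun i => ε k i, ?_⟩
  change T k x = ∑ i, ε k i • (var A d i * T (k - d i) (peel i ∘ₗ x))
  conv_lhs => rw [hx.eq_add_sum]
  rw [hadd, hlin, zero_add]
  refine (map_sum (AddMonoidHom.mk' (T k) (hadd k)) _ _).trans (Finset.sum_congr rfl fun i _ => ?_)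
  exact hmul k i _

theorem isDense_const : IsDense (const A d) := by
  intro m S hS k x hx
  refine eq_zero_of_lmul_var S (fun k x y => pull1_add hS k x y) (fun _ _ => 1) (fun k i x => ?_)
    (fun k X => ?_) hx
  · rw [one_smul]
    exact pull1_lmul hS k (var_mem i) x
  · exact (pull1_lin hS k X).trans (map_zero (const A d).toAlgHom)

/-- The pullback of a closed two-form along the projection is closed: its differential vanishes on vector fields
of the base, hence on all vector fields along the projection, one argument after the other. -/
theorem diff_toForm2_const {m : ℤ} {q : Form A 2 ×
    (ℤ → (A →ₗ[ℝ] formal A d) → ℤ → (A →ₗ[ℝ] formal A d) → formal A d) ×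
    (ℤ → (A →ₗ[ℝ] formal A d) → ℤ → (A →ₗ[ℝ] formal A d) → ℤ → (A →ₗ[ℝ] formal A d) → formal A d)}
    (hq : q ∈ Pull2 (const A d) m) (h : diff q.1 = 0) : diff (toForm2 (const A d) q.2.1) = 0 := by
  have h0 : ∀ k (X : Vect A k) l (Y : Vect A l) r (Z : Vect A r),
      q.2.2 k ((const A d).lin ∘ₗ X.1) l ((const A d).lin ∘ₗ Y.1) r ((const A d).lin ∘ₗ Z.1) = 0 := by
    intro k X l Y r Z
    rw [pull3_lin hq, h]
    exact map_zero (const A d).toAlgHom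
  have h1 : ∀ k (X : Vect A k) l (Y : Vect A l) r z, IsDerAlong (const A d) r z →
      q.2.2 k ((const A d).lin ∘ₗ X.1) l ((const A d).lin ∘ₗ Y.1) r z = 0 := by
    intro k X l Y r z hz
    refine eq_zero_of_lmul_var _ (fun r z z' => pull3_add₃ hq k _ l _ r z z') (fun _ _ => 1)
      (fun r i z => ?_) (fun r Z => h0 k X l Y r Z) hz
    rw [one_smul]
    exact pull3_lmul₃ hq (Vect.isDerAlong_lin_comp _ X) (Vect.isDerAlong_lin_comp _ Y) r (var_mem i) z
  have h2 : ∀ k (X : Vect A k) l y r z, IsDerAlong (const A d) l y → IsDerAlong (const A d) r z →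
      q.2.2 k ((const A d).lin ∘ₗ X.1) l y r z = 0 := by
    intro k X l y r z hy hz
    refine eq_zero_of_lmul_var (fun l y => q.2.2 k ((const A d).lin ∘ₗ X.1) l y r z)
      (fun l y y' => pull3_add₂ hq k _ l y y' r z) (fun _ i => sgn (d i * (r + 1)))
      (fun l i y => ?_) (fun l Y => h1 k X l Y r z hz) hy
    exact pull3_lmul₂ hq (Vect.isDerAlong_lin_comp _ X) l (var_mem i) y hz
  funext k X l Y r Z
  refine (diff_toForm2 hq X Y Z).trans ?_
  have hY := Vect.isDerAlong_comp_lin (const A d) Y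
  have hZ := Vect.isDerAlong_comp_lin (const A d) Z
  exact eq_zero_of_lmul_var (fun k x => q.2.2 k x l (Y.1 ∘ₗ (const A d).lin) r (Z.1 ∘ₗ (const A d).lin))
    (fun k x x' => pull3_add₁ hq k x x' l _ r _) (fun _ i => sgn (d i * (l + r)))
    (fun k i x => pull3_lmul₁ hq k (var_mem i) x hY hZ) (fun k X => h2 k X l _ r _ hY hZ)
    (Vect.isDerAlong_comp_lin (const A d) X)

end Formal

/-! ### The pullback of a two-form -/

theorem isPullback_toForm2 {p : Hom A B} {m : ℤ} {q : Form A 2 ×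
    (ℤ → (A →ₗ[ℝ] B) → ℤ → (A →ₗ[ℝ] B) → B) ×
    (ℤ → (A →ₗ[ℝ] B) → ℤ → (A →ₗ[ℝ] B) → ℤ → (A →ₗ[ℝ] B) → B)} (hq : q ∈ Pull2 p m) :
    IsPullback p q.1 (toForm2 p q.2.1) := by
  intro k Y Y' l Z Z' hY hZ
  have eY : Y'.1 ∘ₗ p.lin = p.lin ∘ₗ Y.1 := LinearMap.ext hY
  have eZ : Z'.1 ∘ₗ p.lin = p.lin ∘ₗ Z.1 := LinearMap.ext hZ
  change q.2.1 k (Y'.1 ∘ₗ p.lin) l (Z'.1 ∘ₗ p.lin) = _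
  rw [eY, eZ, pull2_lin hq]

theorem toForm2_of_forall_eq {p : Hom A A} (hp : ∀ a, p a = a) {m : ℤ} {q : Form A 2 ×
    (ℤ → (A →ₗ[ℝ] A) → ℤ → (A →ₗ[ℝ] A) → A) ×
    (ℤ → (A →ₗ[ℝ] A) → ℤ → (A →ₗ[ℝ] A) → ℤ → (A →ₗ[ℝ] A) → A)} (hq : q ∈ Pull2 p m) :
    toForm2 p q.2.1 = q.1 := by
  funext k Y l X
  refine (isPullback_toForm2 hq k Y Y l X X (fun a => ?_) (fun a => ?_)).trans (hp _) <;> rw [hp, hp]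

theorem diff_mem_pull1 {p : Hom A B} {m : ℤ} {J : A} (hJ : J ∈ A.gr m) :
    (diff (p := 0) J, fun _ x => x J) ∈ Pull1 p m := by
  have h := mem_pull1 p A.one_mem hJ (zero_add m)
  have e : oneAlong p 0 1 J = fun _ x => x J := by
    funext k x
    rw [oneAlong, mul_zero, sgn_zero, one_smul, map_one p.toAlgHom, one_mul]
  rwa [e, ← diff_eq_oneForm] at h

/-- Forms in the ideal of the base pull back to forms in the ideal of the base. -/
theorem exists_pull1_ideal {C : GrAlg.{w}} {C' : GrAlg.{w}} {p : Hom A B} {π : Hom C A} {π' : Hom C' B} {p₀ : Hom C C'}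
    (hπ : ∀ b, p (π b) = π' (p₀ b)) {m : ℤ} {ι : Form A 1} (h : ι ∈ Ideal1 π m) :
    ∃ S, (ι, S) ∈ Pull1 p m ∧ toForm1 p S ∈ Ideal1 π' m := by
  induction h using AddSubgroup.closure_induction with
  | mem q h =>
    obtain ⟨i, j, a, ha, b, hb, e, rfl⟩ := h
    refine ⟨_, mem_pull1 p ha (π.map_gr hb) e, AddSubgroup.subset_closure
      ⟨i, j, p a, p.map_gr ha, p₀ b, p₀.map_gr hb, e, ?_⟩⟩
    funext k X
    change sgn ((k + 1) * i) • (p a * X (p (π b))) = sgn ((k + 1) * i) • (p a * X (π' (p₀ b)))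
    rw [hπ]
  | zero => exact ⟨0, zero_mem _, zero_mem _⟩
  | add q q' _ _ h h' =>
    obtain ⟨S, hS, e⟩ := h
    obtain ⟨S', hS', e'⟩ := h'
    exact ⟨S + S', add_mem hS hS', add_mem e e'⟩
  | neg q _ h =>
    obtain ⟨S, hS, e⟩ := h
    exact ⟨-S, neg_mem hS, neg_mem e⟩

/-- If `i_V om + dJ` is in the ideal of the base, then so is its continuation to vector fields along `p`. -/
theorem exists_hamiltonian_along {C : GrAlg.{w}} {C' : GrAlg.{w}} {p : Hom A B} (hp : IsDense p) {π : Hom C A} {π' : Hom C' B}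
    {p₀ : Hom C C'} (hπ : ∀ b, p (π b) = π' (p₀ b)) {m m' k : ℤ} {q : Form A 2 ×
    (ℤ → (A →ₗ[ℝ] B) → ℤ → (A →ₗ[ℝ] B) → B) ×
    (ℤ → (A →ₗ[ℝ] B) → ℤ → (A →ₗ[ℝ] B) → ℤ → (A →ₗ[ℝ] B) → B)} (hq : q ∈ Pull2 p m) {V : Vect A k} {J : A}
    (hm : m + k = m') (hJ : J ∈ A.gr m') (h : contract V q.1 + diff (p := 0) J ∈ Ideal1 π m') :
    ∃ S, toForm1 p S ∈ Ideal1 π' m' ∧ ∀ l x, IsDerAlong p l x →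
      q.2.1 k (p.lin ∘ₗ V.1) l x + x J = S l x := by
  obtain ⟨S, hS, hS'⟩ := exists_pull1_ideal (p := p) hπ h
  obtain ⟨R, hR, hR'⟩ := pull2_contract hq k V
  refine ⟨S, hS', fun l x hx => ?_⟩
  subst hm
  have h1 := sub_mem (add_mem hR (diff_mem_pull1 hJ)) hS
  have h2 := hp _ (R + (fun _ x => x J) - S) (by
    have e : ((contract V q.1, R) + (diff (p := 0) J, fun _ x => x J) - (contract V q.1 + diff (p := 0) J, S) :
        Form A 1 × (ℤ → (A →ₗ[ℝ] B) → B)) = (0, R + (fun _ x => x J) - S) :=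
      Prod.ext (sub_self _) rfl
    rwa [e] at h1) l x hx
  rw [hR' l x hx]
  exact sub_eq_zero.1 h2

end GrAlg

/-! ### Gauging of symmetries with hamiltonian currents

The elements `c` are of degrees `1 - |α|` in the target `A'` of `p : A → A'`. For the projection that forgets the
variables of `g[1]` they are these variables; for the identity of `A` they are pullbacks of forms on the base. -/

namespace GrAlg

variable {A : GrAlg.{u}} {B : GrAlg.{v}}

/-- The product of a one-form with a function `c` of degree `e`. -/
def smul1 (e : ℤ) (c : A) (θ : Form A 1) : Form A 1 := fun l X => (sgn ((l + 1) * e) • (c * contract1 X θ) : A)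

theorem smul1_mem {π : Hom B A} {m m' e : ℤ} {c : A} (hc : c ∈ A.gr e) {θ : Form A 1} (hθ : θ ∈ Ideal1 π m)
    (h : e + m = m') : smul1 e c θ ∈ Ideal1 π m' := by
  subst h
  induction hθ using AddSubgroup.closure_induction with
  | mem q h =>
    obtain ⟨i, j, a, ha, b, hb, rfl, rfl⟩ := h
    refine AddSubgroup.subset_closure ⟨e + i, j, c * a, A.mul_mem hc ha, b, hb, by ring, ?_⟩
    funext k X
    change sgn ((k + 1) * e) • (c * (sgn ((k + 1) * i) • (a * X (π b)))) =
      sgn ((k + 1) * (e + i)) • (c * a * X (π b))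
    rw [mul_smul_comm, smul_smul, ← sgn_add, mul_assoc, mul_add]
  | zero =>
    convert zero_mem (Ideal1 π (e + m))
    funext k X
    change sgn ((k + 1) * e) • (c * (0 : A)) = 0
    rw [mul_zero, smul_zero]
  | add q q' _ _ h h' =>
    convert add_mem h h'
    funext k X
    change sgn ((k + 1) * e) • (c * (contract1 X q + contract1 X q')) =
      sgn ((k + 1) * e) • (c * contract1 X q) + sgn ((k + 1) * e) • (c * contract1 X q')
    rw [mul_add, smul_add]
  | neg q _ h =>
    convert neg_mem h
    funext k X
    change sgn ((k + 1) * e) • (c * -contract1 X q) = -(sgn ((k + 1) * e) • (c * contract1 X q))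
    rw [mul_neg, smul_neg]

section Two

variable {p : Hom A B} {m : ℤ} {q : Form A 2 × (ℤ → (A →ₗ[ℝ] B) → ℤ → (A →ₗ[ℝ] B) → B) ×
    (ℤ → (A →ₗ[ℝ] B) → ℤ → (A →ₗ[ℝ] B) → ℤ → (A →ₗ[ℝ] B) → B)} (hq : q ∈ Pull2 p m)
include hq

theorem pull2_sum_left {ι : Type*} (s : Finset ι) (k : ℤ) (y : ι → A →ₗ[ℝ] B) (l : ℤ) (x : A →ₗ[ℝ] B) :
    q.2.1 k (∑ i ∈ s, y i) l x = ∑ i ∈ s, q.2.1 k (y i) l x :=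
  map_sum (AddMonoidHom.mk' (fun y => q.2.1 k y l x) fun y y' => pull2_add_left hq k y y' l x) y s

theorem pull2_sum_right {ι : Type*} (s : Finset ι) (k : ℤ) (y : A →ₗ[ℝ] B) (l : ℤ) (x : ι → A →ₗ[ℝ] B) :
    q.2.1 k y l (∑ i ∈ s, x i) = ∑ i ∈ s, q.2.1 k y l (x i) :=
  map_sum (AddMonoidHom.mk' (fun x => q.2.1 k y l x) fun x x' => pull2_add_right hq k y l x x') x s

end Two

end GrAlg

namespace GradedLie

open GrAlg

variable {s : ℕ} (g : GradedLie s)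

section Gauging

variable {A : GrAlg.{u}} {A' : GrAlg.{u}} {C : GrAlg.{v}} {C' : GrAlg.{v}}
  {p : Hom A A'} (hp : IsDense p) {π : Hom C A} {π' : Hom C' A'} {p₀ : Hom C C'}
  (hπ : ∀ b, p (π b) = π' (p₀ b)) {n : ℤ} {q : Form A 2 × (ℤ → (A →ₗ[ℝ] A') → ℤ → (A →ₗ[ℝ] A') → A') ×
    (ℤ → (A →ₗ[ℝ] A') → ℤ → (A →ₗ[ℝ] A') → ℤ → (A →ₗ[ℝ] A') → A')} (hq : q ∈ Pull2 p (n - 1))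
  {Q : Vect A 1} {L : A} (hL : L ∈ A.gr n) (hQ : contract Q q.1 + diff (p := 0) L ∈ Ideal1 π n)
  {V : ∀ α, Vect A (g.deg α)} {J : Fin s → A}
  (hJ : ∀ α, J α ∈ A.gr (n - 1 + g.deg α))
  (hV : ∀ α, contract (V α) q.1 + diff (p := 0) (J α) ∈ Ideal1 π (n - 1 + g.deg α))
  {c : Fin s → A'} (hc : ∀ α, c α ∈ A'.gr (g.ghost α))
  {Q' : Vect A' 1} (hQ' : ∀ a, Q' (p a) = p (Q a) + ∑ α, c α * p (V α a))

include hQ'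

/-- `Q'` as a vector field along `p`: `Q` plus the combination of the `V_α` with coefficients `c^α`. -/
theorem comp_lin_eq : Q'.1 ∘ₗ p.lin = p.lin ∘ₗ Q.1 + ∑ α, lmul (c α) (p.lin ∘ₗ (V α).1) := by
  ext1 a
  rw [LinearMap.add_apply, LinearMap.sum_apply]
  exact hQ' a

include hp hπ hq hL hQ hJ hV hc in
/-- The gauged vector field is hamiltonian: `i_Q' om'` is a combination of the forms `i_Q om` and
`i_V om` with coefficients `1` and `c`, and `dc` is in the ideal of the base. -/
theorem hamiltonian_gauging {c₀ : Fin s → C'} (hc₀ : ∀ α, c₀ α ∈ C'.gr (g.ghost α)) (hcc : ∀ α, c α = π' (c₀ α)) :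
    contract Q' (toForm2 p q.2.1) + diff (p := 0) (p L - g.coupling c fun α => p (J α)) ∈ Ideal1 π' n := by
  obtain ⟨S₀, hS₀, e₀⟩ := exists_hamiltonian_along hp hπ hq (by ring) hL hQ
  choose S hS e using fun α => exists_hamiltonian_along hp hπ hq rfl (hJ α) (hV α)
  have key : contract Q' (toForm2 p q.2.1) + diff (p := 0) (p L - g.coupling c fun α => p (J α)) =
      toForm1 p S₀ + ∑ α, (smul1 (g.ghost α) (c α) (toForm1 p (S α)) +
        sgn (g.deg α + 1 + g.deg α * (n - 1 + g.deg α)) •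
          oneForm (n - 1 + g.deg α) (p (J α)) (π' (c₀ α))) := by
    funext l X
    have hx := Vect.isDerAlong_comp_lin p X
    have h1 : q.2.1 1 (Q'.1 ∘ₗ p.lin) l (X.1 ∘ₗ p.lin) = q.2.1 1 (p.lin ∘ₗ Q.1) l (X.1 ∘ₗ p.lin) +
        ∑ α, sgn ((l + 1) * g.ghost α) • (c α * q.2.1 (g.deg α) (p.lin ∘ₗ (V α).1) l (X.1 ∘ₗ p.lin)) := by
      rw [comp_lin_eq g hQ', pull2_add_left hq, pull2_sum_left hq]
      congr 1
      refine Finset.sum_congr rfl fun α _ => ?_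
      rw [pull2_lmul_left hq 1 (hc α) _ hx, show 1 - g.ghost α = g.deg α by rw [ghost]; ring]
    have h2 : X (g.coupling c fun α => p (J α)) = ∑ α, sgn (g.deg α) • (X (c α) * p (J α) +
        sgn (l * g.ghost α) • (c α * X (p (J α)))) := by
      rw [coupling, map_sum]
      refine Finset.sum_congr rfl fun α _ => ?_
      rw [map_zsmul, Vect.leibniz X (hc α)]
    have hsum : ∀ (F : Fin s → Form A' 1), @Eq A' ((∑ α, F α) l X) (∑ α, contract1 X (F α)) := fun F =>
      map_sum (AddMonoidHom.mk' (fun F : Form A' 1 => contract1 X F) fun _ _ => rfl) F Finset.univ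
    have h3 : (∑ α, contract1 X (smul1 (g.ghost α) (c α) (toForm1 p (S α)) +
        sgn (g.deg α + 1 + g.deg α * (n - 1 + g.deg α)) •
          oneForm (n - 1 + g.deg α) (p (J α)) (π' (c₀ α)))) =
        ∑ α, (sgn ((l + 1) * g.ghost α) • (c α * S α l (X.1 ∘ₗ p.lin)) +
          sgn (g.deg α + 1 + g.deg α * (n - 1 + g.deg α)) • (sgn ((l + 1) * (n - 1 + g.deg α)) •
            (p (J α) * X (π' (c₀ α))))) := rfl
    change q.2.1 1 (Q'.1 ∘ₗ p.lin) l (X.1 ∘ₗ p.lin) + X (p L - g.coupling c fun α => p (J α)) =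
      S₀ l (X.1 ∘ₗ p.lin) + _
    rw [hsum, h3, h1, map_sub, h2, ← e₀ l _ hx]
    change _ = _ + X (p L) + _
    -- the terms `c dJ` cancel, and the terms `dc J` remain
    have h4 : ∀ α, sgn ((l + 1) * g.ghost α) • (c α * q.2.1 (g.deg α) (p.lin ∘ₗ (V α).1) l (X.1 ∘ₗ p.lin)) -
        sgn (g.deg α) • (X (c α) * p (J α) + sgn (l * g.ghost α) • (c α * X (p (J α)))) =
        sgn ((l + 1) * g.ghost α) • (c α * S α l (X.1 ∘ₗ p.lin)) +
          sgn (g.deg α + 1 + g.deg α * (n - 1 + g.deg α)) • (sgn ((l + 1) * (n - 1 + g.deg α)) •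
            (p (J α) * X (π' (c₀ α)))) := by
      intro α
      rw [← e α l _ hx]
      change _ = sgn ((l + 1) * g.ghost α) • (c α * (_ + X (p (J α)))) + _
      rw [A'.comm (Vect.map_gr X (hc α)) (p.map_gr (hJ α)), ← hcc]
      have s1 : sgn (g.deg α + 1 + g.deg α * (n - 1 + g.deg α)) * sgn ((l + 1) * (n - 1 + g.deg α)) =
          -(sgn (g.deg α) * sgn ((g.ghost α + l) * (n - 1 + g.deg α))) := by
        rw [← sgn_add, ← sgn_add, ← neg_one_mul, ← sgn_one, ← sgn_add, ghost]
        exact sgn_congr (by grind)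
      have s2 : sgn ((l + 1) * g.ghost α) = -(sgn (g.deg α) * sgn (l * g.ghost α)) := by
        rw [← sgn_add, ← neg_one_mul, ← sgn_one, ← sgn_add, ghost]
        exact sgn_congr (by grind)
      rw [smul_smul, s1]
      simp only [smul_add, mul_add, smul_smul, neg_smul]
      have s3 : sgn ((l + 1) * g.ghost α) • (c α * X (p (J α))) =
        -((sgn (g.deg α) * sgn (l * g.ghost α)) • (c α * X (p (J α)))) := by rw [s2, neg_smul]
      rw [s3]
      abel
    rw [← Finset.sum_congr rfl fun α _ => h4 α, Finset.sum_sub_distrib]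
    abel
  rw [key]
  refine add_mem hS₀ (sum_mem fun α _ => add_mem (smul1_mem (hc α) (hS α) (by rw [ghost]; ring)) (zsmul_mem ?_ _))
  exact AddSubgroup.subset_closure ⟨_, _, _, p.map_gr (hJ α), _, hc₀ α, by rw [ghost]; ring, rfl⟩

include hq hQ hV hc in
/-- The master equation of the gauged vector field holds up to the anomaly: the terms linear in the `c` are
`i_V i_Q om + V L`, which vanish as `V` is vertical, and the quadratic terms combine to the anomaly. -/
theorem master_gauging (hom : q.1 ∈ Omega2 A (n - 1)) (hvert : ∀ α, IsVertical π (V α))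
    (hm : master Q q.1 L = 0) (hQJ : ∀ α, Q (J α) = 0) (hQc : ∀ γ, Q' (c γ) = g.quadratic c γ) :
    master Q' (toForm2 p q.2.1) (p L - g.coupling c fun α => p (J α)) +
      g.anomaly c (fun α β => p (sgn (g.deg α) • V α (J β) - ∑ γ, g.U α β γ • J γ)) = 0 := by
  have hVL : ∀ α, contract2 (V α) Q q.1 = -V α L := fun α => contract2_of_hamiltonian hQ (hvert α)
  have hLV : ∀ α, contract2 Q (V α) q.1 = -V α L := by
    intro α
    rw [contract2_comm hom, hVL]
    rw [sgn_even (by grind), one_smul]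
  have hVV : ∀ α β, contract2 (V β) (V α) q.1 = -V β (J α) := fun α β => contract2_of_hamiltonian (hV α) (hvert β)
  have hd : ∀ α, IsDerAlong p 1 (lmul (c α) (p.lin ∘ₗ (V α).1)) := fun α =>
    (Vect.isDerAlong_lin_comp p (V α)).lmul (hc α) (by rw [ghost]; ring)
  have hg : ∀ α, 1 - g.ghost α = g.deg α := fun α => by rw [ghost]; ring
  -- the values of the pulled back form on `Q` and the `c^α V_α`
  have t1 : ∀ α, q.2.1 1 (p.lin ∘ₗ Q.1) 1 (lmul (c α) (p.lin ∘ₗ (V α).1)) = -(c α * p (V α L)) := by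
    intro α
    rw [pull2_lmul_right hq (Vect.isDerAlong_lin_comp p Q) 1 (hc α), hg, pull2_lin hq, hVL, map_neg, mul_neg]
  have t2 : ∀ α, q.2.1 1 (lmul (c α) (p.lin ∘ₗ (V α).1)) 1 (p.lin ∘ₗ Q.1) = -(c α * p (V α L)) := by
    intro α
    rw [pull2_lmul_left hq 1 (hc α) _ (Vect.isDerAlong_lin_comp p Q), hg, pull2_lin hq, hLV, map_neg, mul_neg,
      sgn_even (by grind), one_smul]
  have t3 : ∀ α β, q.2.1 1 (lmul (c α) (p.lin ∘ₗ (V α).1)) 1 (lmul (c β) (p.lin ∘ₗ (V β).1)) =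
      -(c α * c β * p (V β (J α))) := by
    intro α β
    rw [pull2_lmul_right hq (hd α) 1 (hc β), hg,
      pull2_lmul_left hq 1 (hc α) _ (Vect.isDerAlong_lin_comp p (V β)), hg, pull2_lin hq, hVV, map_neg,
      mul_smul_comm, mul_neg, mul_neg, ← mul_assoc, A'.comm (hc β) (hc α), smul_mul_assoc, smul_neg,
      smul_smul, ← sgn_add, sgn_even (by rw [ghost, ghost]; grind), one_smul]
  have hw : contract2 Q' Q' (toForm2 p q.2.1) = p (contract2 Q Q q.1) - 2 • ∑ α, c α * p (V α L) -
      ∑ α, ∑ β, c α * c β * p (V β (J α)) := by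
    change q.2.1 1 (Q'.1 ∘ₗ p.lin) 1 (Q'.1 ∘ₗ p.lin) = _
    rw [comp_lin_eq g hQ', pull2_add_left hq, pull2_add_right hq, pull2_add_right hq, pull2_sum_left hq,
      pull2_sum_left hq, pull2_sum_right hq, pull2_lin hq, Finset.sum_congr rfl fun α _ => t1 α,
      Finset.sum_congr rfl fun α _ => t2 α,
      Finset.sum_congr rfl fun α _ => (pull2_sum_right hq _ _ _ _ _).trans (Finset.sum_congr rfl fun β _ => t3 α β)]
    simp only [Finset.sum_neg_distrib]
    rw [two_smul]
    abel
  have hv : Q' (p L - g.coupling c fun α => p (J α)) = p (Q L) + ∑ α, c α * p (V α L) -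
      ∑ γ, sgn (g.deg γ) • (g.quadratic c γ * p (J γ)) + ∑ α, ∑ β, c α * c β * p (V β (J α)) := by
    rw [map_sub, hQ', coupling, map_sum]
    have t : ∀ α, Q' (sgn (g.deg α) • (c α * p (J α))) = sgn (g.deg α) • (g.quadratic c α * p (J α)) -
        ∑ β, c α * c β * p (V β (J α)) := by
      intro α
      rw [map_zsmul, Vect.leibniz Q' (hc α), hQc, hQ', hQJ, map_zero p.toAlgHom, zero_add, smul_add,
        smul_smul, ← sgn_add, sgn_odd (m := g.deg α + 1 * g.ghost α) (by rw [ghost]; grind), neg_smul, one_smul,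
        Finset.mul_sum]
      simp only [mul_assoc]
      abel
    rw [Finset.sum_congr rfl fun α _ => t α, Finset.sum_sub_distrib]
    abel
  -- the part of the anomaly that comes from `V_α J_β`, after exchange of `c^α` and `c^β`
  have hsw : ∑ α, ∑ β, sgn (g.deg β * (g.deg α + 1)) • (c α * c β * p (sgn (g.deg α) • V α (J β))) =
      -∑ α, ∑ β, c α * c β * p (V β (J α)) := by
    rw [Finset.sum_comm, ← Finset.sum_neg_distrib]
    refine Finset.sum_congr rfl fun α _ => ?_
    rw [← Finset.sum_neg_distrib]
    refine Finset.sum_congr rfl fun β _ => ?_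
    rw [map_zsmul, A'.comm (hc β) (hc α), smul_mul_assoc, mul_smul_comm, smul_smul, smul_smul, ← sgn_add,
      ← sgn_add, sgn_odd (by rw [ghost, ghost]; grind), neg_smul, one_smul]
  -- the part that comes from the structure constants is the action of `d_g⁰` on the `c`
  have hqu : ∑ γ, sgn (g.deg γ) • (g.quadratic c γ * p (J γ)) =
      -((1 / 2 : ℝ) • ∑ α, ∑ β, sgn (g.deg β * (g.deg α + 1)) • (c α * c β * p (∑ γ, g.U α β γ • J γ))) := by
    simp only [quadratic, neg_mul, smul_mul_assoc, smul_neg, Finset.sum_neg_distrib, Finset.sum_mul,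
      Finset.smul_sum, map_sum, Finset.mul_sum]
    congr 1
    rw [Finset.sum_comm]
    refine Finset.sum_congr rfl fun α _ => ?_
    rw [Finset.sum_comm]
    refine Finset.sum_congr rfl fun β _ => Finset.sum_congr rfl fun γ _ => ?_
    rw [map_smul p.toAlgHom, mul_smul_comm]
    by_cases hU : g.U α β γ = 0
    · simp [hU]
    rw [g.degree α β γ hU]
    simp only [← Int.cast_smul_eq_zsmul ℝ, smul_smul]
    congr 1
    have : sgn (g.deg α + g.deg β) * sgn (g.deg α * (1 + g.deg β)) = sgn (g.deg β * (g.deg α + 1)) := by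
      rw [← sgn_add]
      exact sgn_congr (by grind)
    rw [← this]
    push_cast
    ring
  have hpm : (1 / 2 : ℝ) • p (contract2 Q Q q.1) + p (Q L) = 0 := by
    have := congrArg p.toAlgHom hm
    rwa [master, map_add, map_smul, map_zero] at this
  have han : g.anomaly c (fun α β => p (sgn (g.deg α) • V α (J β) - ∑ γ, g.U α β γ • J γ)) =
      -((1 / 2 : ℝ) • ∑ α, ∑ β, c α * c β * p (V β (J α))) +
      ∑ γ, sgn (g.deg γ) • (g.quadratic c γ * p (J γ)) := by
    rw [hqu, anomaly]
    simp only [map_sub, mul_sub, smul_sub, Finset.sum_sub_distrib]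
    rw [hsw, smul_neg]
    abel
  rw [master, hw, hv, han]
  have e : ∀ x y z t r : A', (1 / 2 : ℝ) • x + y = 0 →
      (1 / 2 : ℝ) • (x - 2 • z - t) + (y + z - r + t) + (-((1 / 2 : ℝ) • t) + r) = 0 := by
    intro x y z t r h
    rw [eq_neg_of_add_eq_zero_right h]
    module
  exact e _ _ _ _ _ hpm

end Gauging

end GradedLie

/-! ### The Chevalley–Eilenberg differential -/

theorem sum_rotate {ι M : Type*} [Fintype ι] [AddCommMonoid M] (F : ι → ι → ι → M) :
    ∑ a, ∑ b, ∑ c, F a b c = ∑ b, ∑ c, ∑ a, F a b c := by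
  rw [Finset.sum_comm]
  exact Finset.sum_congr rfl fun b _ => Finset.sum_comm

namespace GradedLie

open GrAlg

variable {s : ℕ} (g : GradedLie s)

section Quadratic

variable {A : GrAlg.{u}} {B : GrAlg.{v}}

theorem map_quadratic (φ : Hom A B) (c : Fin s → A) (γ : Fin s) :
    φ (g.quadratic c γ) = g.quadratic (fun α => φ (c α)) γ := by
  simp only [quadratic, map_neg, map_smul, map_sum, map_mul]

theorem map_anomaly (φ : Hom A B) (c : Fin s → A) (f : Fin s → Fin s → A) :
    φ (g.anomaly c f) = g.anomaly (fun α => φ (c α)) (fun α β => φ (f α β)) := by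
  simp only [anomaly, map_smul, map_zsmul, map_sum, map_mul]

theorem quadratic_mem {c : Fin s → A} (hc : ∀ α, c α ∈ A.gr (g.ghost α)) (γ : Fin s) :
    g.quadratic c γ ∈ A.gr (2 - g.deg γ) := by
  refine neg_mem (Submodule.smul_mem _ _ (sum_mem fun α _ => sum_mem fun β _ => ?_))
  by_cases h : g.U α β γ = 0
  · rw [h, mul_zero, zero_smul]
    exact zero_mem _
  · refine Submodule.smul_mem _ _ ?_
    have := A.mul_mem (hc α) (hc β)
    rwa [show g.ghost α + g.ghost β = 2 - g.deg γ by rw [g.degree α β γ h, ghost, ghost]; ring] at this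

/-- The coefficients of the iterated bracket `[[e_α, e_β], e_ε]`. -/
def iterated (γ α β ε : Fin s) : ℝ := ∑ δ, g.U α β δ * g.U δ ε γ

/-- The Jacobi identity in cyclic form, from the Leibniz form `[e_α, [e_β, e_ε]] = [[e_α, e_β], e_ε] ± …`. -/
theorem cyclic_jacobi (γ α β ε : Fin s) :
    (sgn (g.deg α * g.deg ε) : ℝ) * g.iterated γ α β ε + (sgn (g.deg α * g.deg β) : ℝ) * g.iterated γ β ε α +
      (sgn (g.deg ε * g.deg β) : ℝ) * g.iterated γ ε α β = 0 := by
  have h := g.jacobi α β ε γ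
  have h1 : ∑ δ, g.U β ε δ * g.U α δ γ =
      -((sgn (g.deg α * g.deg β + g.deg α * g.deg ε) : ℝ) * g.iterated γ β ε α) := by
    rw [iterated, Finset.mul_sum, ← Finset.sum_neg_distrib]
    refine Finset.sum_congr rfl fun δ _ => ?_
    by_cases h : g.U β ε δ = 0
    · rw [h]; ring
    · rw [g.antisymm α δ γ, g.degree β ε δ h, mul_add]
      ring
  have h2 : ∑ δ, g.U α ε δ * g.U β δ γ =
      (sgn (g.deg β * g.deg α + g.deg β * g.deg ε + g.deg α * g.deg ε) : ℝ) * g.iterated γ ε α β := by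
    rw [iterated, Finset.mul_sum]
    refine Finset.sum_congr rfl fun δ _ => ?_
    by_cases h : g.U α ε δ = 0
    · have := g.antisymm ε α δ
      rw [h] at this ⊢
      rw [this]
      ring
    · rw [g.antisymm β δ γ, g.degree α ε δ h, g.antisymm α ε δ, mul_add, sgn_add (_ + _)]
      push_cast
      ring
  rw [h1, h2] at h
  change _ = g.iterated γ α β ε + _ at h
  rw [← mul_assoc, ← Int.cast_mul, ← sgn_add] at h
  have e1 : sgn (g.deg α * g.deg β + g.deg α * g.deg ε) = sgn (g.deg α * g.deg β) * sgn (g.deg α * g.deg ε) :=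
    sgn_add _ _
  have e2 : sgn (g.deg α * g.deg β + (g.deg β * g.deg α + g.deg β * g.deg ε + g.deg α * g.deg ε)) =
      sgn (g.deg ε * g.deg β) * sgn (g.deg α * g.deg ε) := by
    rw [← sgn_add]
    exact sgn_congr (by grind)
  rw [e1, e2] at h
  push_cast at h
  have hs : (sgn (g.deg α * g.deg ε) : ℝ) * (sgn (g.deg α * g.deg ε) : ℝ) = 1 := by
    exact_mod_cast sgn_mul_self _
  linear_combination (-(sgn (g.deg α * g.deg ε) : ℝ)) * h -
    ((sgn (g.deg α * g.deg β) : ℝ) * g.iterated γ β ε α +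
      (sgn (g.deg ε * g.deg β) : ℝ) * g.iterated γ ε α β) * hs

/-- The Jacobi identity makes the cubic expression in the `c` vanish: each of the three cyclic rotations of the
indices gives the same sum, and the three summands add up to zero. -/
theorem cubic_eq_zero {c : Fin s → A} (hc : ∀ α, c α ∈ A.gr (g.ghost α)) (γ : Fin s) :
    ∑ α, ∑ β, ∑ ε, ((sgn (g.deg β + g.deg α * g.deg β + g.deg α * g.deg ε + g.deg β * g.deg ε) : ℝ) *
      g.iterated γ α β ε) • (c α * c β * c ε) = 0 := by
  let T : Fin s → Fin s → Fin s → A := fun α β ε =>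
    ((sgn (g.deg β + g.deg α * g.deg β + g.deg α * g.deg ε + g.deg β * g.deg ε) : ℝ) *
      g.iterated γ α β ε) • (c α * c β * c ε)
  have hT : ∀ α β ε, T α β ε + T β ε α + T ε α β = 0 := by
    intro α β ε
    have e1 : c β * c ε * c α = sgn (g.deg β + g.deg ε + g.deg α * g.deg β + g.deg α * g.deg ε) • (c α * c β * c ε) := by
      rw [A.comm (A.mul_mem (hc β) (hc ε)) (hc α), mul_assoc]
      exact sgn_smul_congr (by rw [ghost, ghost, ghost]; grind) _
    have e2 : c ε * c α * c β = sgn (g.deg α + g.deg β + g.deg ε * g.deg α + g.deg ε * g.deg β) • (c α * c β * c ε) := by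
      rw [mul_assoc, A.comm (hc ε) (A.mul_mem (hc α) (hc β))]
      exact sgn_smul_congr (by rw [ghost, ghost, ghost]; grind) _
    have e0 := g.cyclic_jacobi γ α β ε
    simp only [T]
    rw [e1, e2, ← Int.cast_smul_eq_zsmul ℝ, ← Int.cast_smul_eq_zsmul ℝ, smul_smul, smul_smul, ← add_smul, ← add_smul]
    convert zero_smul ℝ _ using 2
    have s1 : sgn (g.deg β + g.deg α * g.deg β + g.deg α * g.deg ε + g.deg β * g.deg ε) =
        sgn (g.deg β + g.deg α * g.deg β + g.deg β * g.deg ε) * sgn (g.deg α * g.deg ε) := by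
      rw [← sgn_add]; exact sgn_congr (by grind)
    have s2 : sgn (g.deg ε + g.deg β * g.deg ε + g.deg β * g.deg α + g.deg ε * g.deg α) *
        sgn (g.deg β + g.deg ε + g.deg α * g.deg β + g.deg α * g.deg ε) =
        sgn (g.deg β + g.deg α * g.deg β + g.deg β * g.deg ε) * sgn (g.deg α * g.deg β) := by
      rw [← sgn_add, ← sgn_add]; exact sgn_congr (by grind)
    have s3 : sgn (g.deg α + g.deg ε * g.deg α + g.deg ε * g.deg β + g.deg α * g.deg β) *
        sgn (g.deg α + g.deg β + g.deg ε * g.deg α + g.deg ε * g.deg β) =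
        sgn (g.deg β + g.deg α * g.deg β + g.deg β * g.deg ε) * sgn (g.deg ε * g.deg β) := by
      rw [← sgn_add, ← sgn_add]; exact sgn_congr (by grind)
    have s2' := congrArg (Int.cast (R := ℝ)) s2
    have s3' := congrArg (Int.cast (R := ℝ)) s3
    rw [s1]
    push_cast at s2' s3' ⊢
    linear_combination (sgn (g.deg β + g.deg α * g.deg β + g.deg β * g.deg ε) : ℝ) * e0 +
      g.iterated γ β ε α * s2' + g.iterated γ ε α β * s3'
  have h1 : ∑ α, ∑ β, ∑ ε, T β ε α = ∑ α, ∑ β, ∑ ε, T α β ε := sum_rotate fun α β ε => T β ε α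
  have h2 : ∑ α, ∑ β, ∑ ε, T ε α β = ∑ α, ∑ β, ∑ ε, T α β ε := (sum_rotate T).symm
  have h3 : ∑ α, ∑ β, ∑ ε, T α β ε + ∑ α, ∑ β, ∑ ε, T β ε α + ∑ α, ∑ β, ∑ ε, T ε α β = 0 := by
    simp only [← Finset.sum_add_distrib, hT, Finset.sum_const_zero]
  rw [h1, h2] at h3
  have h4 : (3 : ℝ) • ∑ α, ∑ β, ∑ ε, T α β ε = 0 := by
    rw [← h3]; module
  exact (smul_eq_zero.1 h4).resolve_left (by norm_num)

/-- Substitution of the quadratic expression for one factor of a quadratic expression gives the cubic one. -/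
theorem sum_quadratic_mul (c : Fin s → A) (γ : Fin s) : ∑ α, ∑ β, ((sgn (g.deg α * (1 + g.deg β)) : ℝ) * g.U α β γ) • (g.quadratic c α * c β) =
      -((1 / 2 : ℝ) • ∑ α, ∑ β, ∑ ε,
        ((sgn (g.deg β + g.deg α * g.deg β + g.deg α * g.deg ε + g.deg β * g.deg ε) : ℝ) *
      g.iterated γ α β ε) • (c α * c β * c ε)) := by
    have r : ∑ α, ∑ β, ∑ ε,
        ((sgn (g.deg β + g.deg α * g.deg β + g.deg α * g.deg ε + g.deg β * g.deg ε) : ℝ) *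
        g.iterated γ α β ε) • (c α * c β * c ε) =
        ∑ δ, ∑ ε, ∑ α, ∑ β, ((sgn (g.deg β + g.deg α * g.deg β + g.deg α * g.deg ε + g.deg β * g.deg ε) : ℝ) *
        (g.U α β δ * g.U δ ε γ)) • (c α * c β * c ε) := by
      rw [Finset.sum_comm, ← sum_rotate]
      simp only [iterated, Finset.mul_sum, Finset.sum_smul]
      conv_rhs => rw [Finset.sum_comm]
      refine Finset.sum_congr rfl fun ε _ => ?_
      rw [sum_rotate]
      exact Finset.sum_comm
    rw [r, Finset.smul_sum, ← Finset.sum_neg_distrib]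
    refine Finset.sum_congr rfl fun δ _ => ?_
    rw [Finset.smul_sum, ← Finset.sum_neg_distrib]
    refine Finset.sum_congr rfl fun ε _ => ?_
    rw [quadratic, neg_mul, smul_mul_assoc, smul_neg, smul_comm, Finset.sum_mul, Finset.smul_sum]
    congr 2
    refine Finset.sum_congr rfl fun α _ => ?_
    rw [Finset.sum_mul, Finset.smul_sum]
    refine Finset.sum_congr rfl fun β _ => ?_
    rw [smul_mul_assoc, smul_smul]
    by_cases h : g.U α β δ = 0
    · simp [h]
    congr 1
    have e : sgn (g.deg δ * (1 + g.deg ε)) * sgn (g.deg α * (1 + g.deg β)) =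
        sgn (g.deg β + g.deg α * g.deg β + g.deg α * g.deg ε + g.deg β * g.deg ε) := by
      rw [g.degree α β δ h, ← sgn_add]
      exact sgn_congr (by grind)
    rw [← e]
    push_cast
    ring

/-- A derivation that takes the `c` to the quadratic expressions annihilates the latter. -/
theorem apply_quadratic {c : Fin s → A} (hc : ∀ α, c α ∈ A.gr (g.ghost α)) {D : Vect A 1}
    (hD : ∀ γ, D (c γ) = g.quadratic c γ) (γ : Fin s) : D (g.quadratic c γ) = 0 := by
  have h1 : D (g.quadratic c γ) = -((1 / 2 : ℝ) • (
      (∑ α, ∑ β, ((sgn (g.deg α * (1 + g.deg β)) : ℝ) * g.U α β γ) • (g.quadratic c α * c β)) +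
      ∑ α, ∑ β, ((sgn (g.deg α * (1 + g.deg β)) : ℝ) * g.U α β γ) •
        (sgn (1 * g.ghost α) • (c α * g.quadratic c β)))) := by
    rw [quadratic]
    simp only [map_neg, map_smul, map_sum, Vect.leibniz D (hc _), hD, smul_add, Finset.sum_add_distrib]
  -- by antisymmetry the two terms of the Leibniz rule agree
  have h2 : ∑ α, ∑ β, ((sgn (g.deg α * (1 + g.deg β)) : ℝ) * g.U α β γ) •
        (sgn (1 * g.ghost α) • (c α * g.quadratic c β)) =
      ∑ α, ∑ β, ((sgn (g.deg α * (1 + g.deg β)) : ℝ) * g.U α β γ) • (g.quadratic c α * c β) := by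
    rw [Finset.sum_comm]
    refine Finset.sum_congr rfl fun α _ => Finset.sum_congr rfl fun β _ => ?_
    rw [A.comm (hc β) (g.quadratic_mem hc α), ← Int.cast_smul_eq_zsmul ℝ, ← Int.cast_smul_eq_zsmul ℝ, smul_smul, smul_smul,
      g.antisymm β α γ]
    congr 1
    have e : sgn (g.deg β * (1 + g.deg α)) * sgn (g.deg β * g.deg α) * sgn (1 * g.ghost β) *
        sgn (g.ghost β * (2 - g.deg α)) = - sgn (g.deg α * (1 + g.deg β)) := by
      rw [← sgn_add, ← sgn_add, ← sgn_add, ← neg_one_mul, ← sgn_one, ← sgn_add, ghost]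
      exact sgn_congr (by grind)
    have e' := congrArg (Int.cast (R := ℝ)) e
    push_cast at e'
    linear_combination (-g.U α β γ) * e'
  have h3 := g.sum_quadratic_mul c γ
  rw [h1, h2, h3, g.cubic_eq_zero hc]
  simp

end Quadratic

/-! ### The vector fields on the products with `g[1]` -/

section Gauge

variable {A : GrAlg.{u}}

/-- The vector field `Q + c^α V_α + d_g⁰` on the product with `g[1]`. -/
def gauge (Q : Vect A 1) (V : ∀ α, Vect A (g.deg α)) : Vect (g.adjoin A) 1 :=
  extend g.ghost Q +
    (∑ α, Vect.cast (sub_add_cancel 1 (g.deg α)) (Vect.leftMul (var_mem (A := A) (d := g.ghost) α) (extend g.ghost (V α))) +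
    ∑ γ, Vect.cast (by rw [ghost]; ring)
      (Vect.leftMul (g.quadratic_mem (A := g.adjoin A) (c := g.c A) var_mem γ) (partialVect A g.ghost γ)))

theorem gauge_apply (Q : Vect A 1) (V : ∀ α, Vect A (g.deg α)) (F : g.adjoin A) :
    g.gauge Q V F = extend g.ghost Q F + (∑ α, g.c A α * extend g.ghost (V α) F +
      ∑ γ, g.quadratic (g.c A) γ * partialVect A g.ghost γ F) := by
  change extend g.ghost Q F + ((∑ α, _ : Vect (g.adjoin A) 1) F + (∑ γ, _ : Vect (g.adjoin A) 1) F) = _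
  rw [Vect.sum_apply, Vect.sum_apply]
  rfl

theorem isGauging_gauge (Q : Vect A 1) (V : ∀ α, Vect A (g.deg α)) : g.IsGauging Q V (g.gauge Q V) := by
  refine ⟨fun a => ?_, fun γ => ?_⟩
  · rw [gauge_apply, extend_const]
    simp only [extend_const, partialVect_const, mul_zero, Finset.sum_const_zero, add_zero]
  · rw [gauge_apply, extend_var]
    simp only [extend_var, mul_zero, Finset.sum_const_zero, zero_add, partialVect_var, mul_ite, mul_one]
    rw [Finset.sum_ite_eq]
    simp

theorem isBackground_gauge (D : Vect A 1) : g.IsBackground D (g.gauge D fun _ => 0) := by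
  refine ⟨fun b => ?_, (g.isGauging_gauge D fun _ => 0).2⟩
  rw [(g.isGauging_gauge D fun _ => 0).1]
  have h : ∀ α, g.c A α * g.proj A ((0 : Vect A (g.deg α)) b) = 0 := fun α => by
    rw [show (0 : Vect A (g.deg α)) b = 0 from rfl, map_zero, mul_zero]
  rw [Finset.sum_congr rfl fun α _ => h α, Finset.sum_const_zero, add_zero]

variable {B : GrAlg.{v}}

theorem formalMap_id_apply {p : Hom A A} (hp : ∀ a, p a = a) {r : ℕ} (d : Fin r → ℤ) (F : formal A d) :
    p.formalMap d F = F :=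
  formal_ext fun K _ => by rw [coeff_formalMap, hp]

/-- The background `d_X + d_g⁰` is homological: its square is a derivation, as `D'` is odd, and vanishes on
generators. -/
theorem IsBackground.homological {D : Vect A 1} {D' : Vect (g.adjoin A) 1} (h : g.IsBackground D D')
    (hD : ∀ b, D (D b) = 0) (b : g.adjoin A) : D' (D' b) = 0 := by
  refine derivation_eq_zero (φ := ⟨AlgHom.id ℝ A, fun ha => ha⟩) 2 (D'.1 ∘ₗ D'.1) ?_ ?_ ?_ b
  · intro i F hF G
    rw [formalMap_id_apply fun _ => rfl, formalMap_id_apply fun _ => rfl]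
    change D' (D' (F * G)) = D' (D' F) * G + sgn (2 * i) • (F * D' (D' G))
    rw [Vect.leibniz D' hF, map_add, map_zsmul, Vect.leibniz D' (Vect.map_gr D' hF), Vect.leibniz D' hF,
      smul_add, smul_smul, ← sgn_add, sgn_even (m := 2 * i) (by grind), sgn_even (m := 1 * i + 1 * i) (by grind),
      one_smul, sgn_congr (m := 1 * (i + 1)) (n := 1 + 1 * i) (by grind), sgn_add, sgn_one, neg_one_mul, neg_smul]
    abel
  · intro a
    change D' (D' (g.proj A a)) = 0
    rw [h.1, h.1, hD, map_zero]
  · exact fun γ => (congrArg D' (h.2 γ)).trans (g.apply_quadratic var_mem h.2 γ)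

/-- The gauged vector field projects to the background. -/
theorem IsGauging.projects {π : Hom B A} {D : Vect B 1} {D' : Vect (g.adjoin B) 1} (hD : g.IsBackground D D')
    {Q : Vect A 1} {V : ∀ α, Vect A (g.deg α)} {Q' : Vect (g.adjoin A) 1} (hQ : g.IsGauging Q V Q')
    (h : ∀ b, Q (π b) = π (D b)) (hV : ∀ α, IsVertical π (V α)) (b : g.adjoin B) :
    Q' (π.formalMap g.ghost b) = π.formalMap g.ghost (D' b) := by
  refine sub_eq_zero.1 (derivation_eq_zero (φ := π) 1
    (Q'.1 ∘ₗ (π.formalMap g.ghost).lin - (π.formalMap g.ghost).lin ∘ₗ D'.1) ?_ ?_ ?_ b)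
  · intro i F hF G
    change Q' (π.formalMap g.ghost (F * G)) - π.formalMap g.ghost (D' (F * G)) =
      (Q' (π.formalMap g.ghost F) - π.formalMap g.ghost (D' F)) * π.formalMap g.ghost G +
      sgn (1 * i) • (π.formalMap g.ghost F * (Q' (π.formalMap g.ghost G) - π.formalMap g.ghost (D' G)))
    rw [map_mul, Vect.leibniz Q' ((π.formalMap g.ghost).map_gr hF), Vect.leibniz D' hF, map_add, map_zsmul,
      map_mul, map_mul, sub_mul, mul_sub, smul_sub]
    abel
  · intro a
    change Q' (π.formalMap g.ghost (const B g.ghost a)) - π.formalMap g.ghost (D' (g.proj B a)) = 0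
    rw [hD.1, formalMap_const, hQ.1, formalMap_const, h]
    simp only [hV _ _, map_zero, mul_zero, Finset.sum_const_zero, add_zero, sub_self]
  · intro γ
    change Q' (π.formalMap g.ghost (var B g.ghost γ)) - π.formalMap g.ghost (D' (g.c B γ)) = 0
    rw [hD.2, formalMap_var, hQ.2, map_quadratic]
    simp only [formalMap_var, sub_self]

end Gauge

end GradedLie

/-! ### Consequences of the closedness of the two-form -/

namespace GrAlg

variable {A : GrAlg.{u}} {B : GrAlg.{v}} {π : Hom B A}

theorem isVertical_bracket_of_projects {D : Vect B 1} {Q : Vect A 1} (hQ : ∀ b, Q (π b) = π (D b)) {r : ℤ}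
    {Z : Vect A r} (hZ : IsVertical π Z) : IsVertical π (bracket Q Z) := by
  intro b
  rw [bracket_apply, hZ, hQ, hZ, map_zero, smul_zero, sub_zero]

theorem bracket_self_apply (Q : Vect A 1) (a : A) : bracket Q Q a = (2 : ℤ) • Q (Q a) := by
  rw [bracket_apply, one_mul, sgn_one, neg_smul, one_smul, sub_neg_eq_add, two_smul]

theorem IsPremaster.isVertical_bracket_self {D : Vect B 1} {Q : Vect A 1} {om : Form A 2} {L : A} {n : ℤ}
    (h : IsPremaster π D Q om L n) : IsVertical π (bracket Q Q) := by
  intro b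
  rw [bracket_self_apply, h.projects, h.projects, h.homological, map_zero, smul_zero]

theorem contract2_eq_zero_of_kernel {om : Form A 2} {n k l : ℤ} {Z : Vect A k} {Y : Vect A l}
    (hZ : InVerticalKernel π om n Z) (hY : IsVertical π Y) : contract2 Y Z om = 0 :=
  ideal1_apply hZ.2 hY

/-- Elements of the kernel annihilate a current. -/
theorem kernel_apply_eq_zero {om : Form A 2} {n m : ℤ} (hom : om ∈ Omega2 A n) {k : ℤ} {V : Vect A k} {J : A}
    (hV : IsVertical π V) (hJ : contract V om + diff (p := 0) J ∈ Ideal1 π m) {l : ℤ} {Z : Vect A l}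
    (hZ : InVerticalKernel π om n Z) : Z J = 0 := by
  have h := contract2_of_hamiltonian hJ hZ.1
  rw [contract2_comm hom, contract2_eq_zero_of_kernel hZ hV, smul_zero] at h
  exact neg_eq_zero.1 h.symm

theorem contract3_of_closed {om : Form A 2} (h : diff om = 0) {k l r : ℤ} (X : Vect A k) (Y : Vect A l) (Z : Vect A r) :
    contract3 X Y Z (diff om) = 0 := by
  rw [h]
  rfl

/-- The obstruction `QJ` to the conservation of `J` is annihilated by the vertical vector fields `Z`: this is
`dom(V, Q, Z) = 0`, where `i_[V,Q] om` is in the ideal of the base. -/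
theorem IsPremaster.vertical_apply_apply {D : Vect B 1} {Q : Vect A 1} {om : Form A 2} {L : A} {n : ℤ}
    (h : IsPremaster π D Q om L n) {k : ℤ} {V : Vect A k} (hV : IsVertical π V)
    (hVQ : InVerticalKernel π om (n - 1) (bracket V Q)) {J : A} {m : ℤ}
    (hJ : contract V om + diff (p := 0) J ∈ Ideal1 π m) {r : ℤ} {Z : Vect A r} (hZ : IsVertical π Z) :
    Z (Q J) = 0 := by
  have h0 := contract3_of_closed h.om_closed V Q Z
  have e1 : contract2 Q V om = -V L := by
    rw [contract2_comm h.om_mem, contract2_of_hamiltonian h.hamiltonian hV, sgn_even (by grind), one_smul]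
  rw [diff_two_apply, contract2_eq_zero_of_kernel hVQ hZ, contract2_of_hamiltonian h.hamiltonian hZ,
    contract2_of_hamiltonian h.hamiltonian (hV.bracket hZ), contract2_of_hamiltonian hJ hZ,
    contract2_of_hamiltonian hJ (isVertical_bracket_of_projects h.projects hZ), e1, bracket_apply, bracket_apply] at h0
  simp only [map_neg, sub_zero, sub_neg_eq_add, smul_sub, smul_add, smul_neg, smul_smul] at h0
  have s1 : sgn (k * (1 + 1)) * (sgn (k * (r + 1)) * sgn (k * r)) = sgn k := by
    rw [← sgn_add, ← sgn_add]; exact sgn_congr (by grind)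
  have s2 : sgn k * (sgn (1 * (r + 1)) * sgn (1 * r)) = -sgn k := by
    rw [← neg_one_mul, ← sgn_one, ← sgn_add, ← sgn_add, ← sgn_add]; exact sgn_congr (by grind)
  have h1 : sgn k • Z (Q J) = 0 := by
    rw [s1, s2, sgn_one] at h0
    rw [← neg_eq_zero, ← h0]
    module
  have h2 := congrArg (fun a => sgn k • a) h1
  simpa only [smul_smul, sgn_mul_self, one_smul, smul_zero] using h2

/-- Up to a form in the ideal of the base, `i_[Q,Q] om` is twice the differential of the left hand side of the
master equation: this is `dom(Q, Q, Z) = 0` for vertical `Z`. -/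
theorem IsPremaster.contract2_bracket_self {D : Vect B 1} {Q : Vect A 1} {om : Form A 2} {L : A} {n : ℤ}
    (h : IsPremaster π D Q om L n) {r : ℤ} {Z : Vect A r} (hZ : IsVertical π Z) :
    contract2 Z (bracket Q Q) om = (2 : ℤ) • Z (master Q om L) := by
  have h0 := contract3_of_closed h.om_closed Q Q Z
  rw [diff_two_apply, contract2_of_hamiltonian h.hamiltonian hZ,
    contract2_of_hamiltonian h.hamiltonian (isVertical_bracket_of_projects h.projects hZ), bracket_apply] at h0
  rw [master, map_add, map_smul]
  simp only [map_neg, sub_neg_eq_add, smul_sub, smul_add, smul_neg, smul_smul] at h0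
  have s1 : sgn (1 * (1 + 1)) = 1 := sgn_even (by decide)
  have s2 : sgn (1 * (r + 1)) * sgn (1 * r) = -1 := by
    rw [← sgn_one, ← sgn_add]; exact sgn_congr (by grind)
  rw [s1, sgn_one] at h0
  simp only [one_mul] at h0 s2
  rw [s2] at h0
  rw [← sub_eq_zero, ← neg_eq_zero, ← h0]
  module

/-- Currents are annihilated by the square of `Q`: `[Q, Q] J` is `i_[Q,Q] i_V om` up to sign, which vanishes by the
master equation. -/
theorem IsPresymplecticGPDE.apply_apply_eq_zero {D : Vect B 1} {Q : Vect A 1} {om : Form A 2} {L : A} {n : ℤ}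
    (h : IsPresymplecticGPDE π D Q om L n) {k : ℤ} {V : Vect A k} (hV : IsVertical π V) {J : A} {m : ℤ}
    (hJ : contract V om + diff (p := 0) J ∈ Ideal1 π m) : Q (Q J) = 0 := by
  have h1 := contract2_of_hamiltonian hJ h.isVertical_bracket_self
  rw [contract2_comm h.om_mem, h.contract2_bracket_self hV, h.master_eq, map_zero, smul_zero, smul_zero,
    bracket_self_apply, ← Int.cast_smul_eq_zsmul ℝ] at h1
  exact (smul_eq_zero.1 (neg_eq_zero.1 h1.symm)).resolve_left (by norm_num)

/-- The left hand side of the master equation is annihilated by `Q`: this is `dom(Q, Q, Q) = 0`. -/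
theorem IsPremaster.apply_master {D : Vect B 1} {Q : Vect A 1} {om : Form A 2} {L : A} {n : ℤ}
    (h : IsPremaster π D Q om L n) : Q (master Q om L) = 0 := by
  have h0 := contract3_of_closed h.om_closed Q Q Q
  have h1 := contract2_of_hamiltonian h.hamiltonian h.isVertical_bracket_self
  rw [diff_two_apply, contract2_comm h.om_mem (bracket Q Q) Q, h1, bracket_self_apply] at h0
  rw [master, map_add, map_smul]
  have s1 : sgn (1 * (1 + 1)) = 1 := sgn_even (by decide)
  have s2 : sgn ((1 + 1 + 1) * (1 + 1)) = 1 := sgn_even (by decide)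
  rw [s1, s2, sgn_one] at h0
  have h2 : (6 : ℝ) • ((1 / 2 : ℝ) • Q (contract2 Q Q om) + Q (Q L)) = 0 := by
    rw [← h0]
    module
  exact (smul_eq_zero.1 h2).resolve_left (by norm_num)

/-- A one-form is linear in the vector field. -/
theorem contract1_of_eq_sum {m k : ℤ} {θ : Form A 1} (hθ : θ ∈ Omega1 A m) {s : ℕ} {deg : Fin s → ℤ}
    (V : ∀ γ, Vect A (deg γ)) (U : Fin s → ℝ) (hU : ∀ γ, U γ ≠ 0 → deg γ = k) (X : Vect A k)
    (hX : ∀ a, X a = ∑ γ, U γ • V γ a) : contract1 X θ = ∑ γ, U γ • contract1 (V γ) θ := by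
  refine eq_on_closure (f := fun θ => contract1 X θ) (fun _ _ => rfl)
    (f' := fun θ => ∑ γ, U γ • contract1 (V γ) θ) (fun a b => ?_) ?_ hθ
  · rw [← Finset.sum_add_distrib]
    exact Finset.sum_congr rfl fun γ _ => smul_add (U γ) (contract1 (V γ) a) (contract1 (V γ) b)
  · rintro _ ⟨i, j, a, -, b, -, -, rfl⟩
    change sgn ((k + 1) * i) • (a * X b) = ∑ γ, U γ • (sgn ((deg γ + 1) * i) • (a * V γ b))
    rw [hX, Finset.mul_sum, Finset.smul_sum]
    refine Finset.sum_congr rfl fun γ _ => ?_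
    by_cases h : U γ = 0
    · rw [h, zero_smul, zero_smul, mul_zero, smul_zero]
    · rw [mul_smul_comm, smul_comm, ← hU γ h]

theorem diff_sub (J K : A) : diff (p := 0) (J - K) = diff (p := 0) J - diff (p := 0) K := by
  funext k X
  exact map_sub X.1 J K

theorem diff_add (J K : A) : diff (p := 0) (J + K) = diff (p := 0) J + diff (p := 0) K := by
  funext k X
  exact map_add X.1 J K

theorem diff_pull_mem {m : ℤ} {b : B} (hb : b ∈ B.gr m) : diff (p := 0) (π b) ∈ Ideal1 π m := by
  rw [diff_eq_oneForm]
  exact AddSubgroup.subset_closure ⟨0, m, 1, A.one_mem, b, hb, zero_add m, rfl⟩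

/-- A symmetry of a closed two-form is hamiltonian if the relative cohomology vanishes. -/
theorem exists_hamiltonian {om : Form A 2} {n : ℤ} (hom : om ∈ Omega2 A n) (hd : diff om = 0)
    (H : RelativeH1Vanishes π) {k : ℤ} {V : Vect A k} (hV : lie V om ∈ Ideal2 π (n + k)) :
    ∃ J ∈ A.gr (n + k), contract V om + diff (p := 0) J ∈ Ideal1 π (n + k) := by
  have h1 : lie V om = sgn k • diff (contract V om) := by
    -- Cartan's formula for `i_V d om`
    have h2 : lie V om - sgn k • diff (om k V) = 0 := congrFun (congrFun hd k) V
    exact sub_eq_zero.1 h2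
  have h3 : diff (contract V om) = sgn k • lie V om := by
    rw [h1, smul_smul, sgn_mul_self, one_smul]
  obtain ⟨J, hJ, h⟩ := H _ _ (contract_mem_Omega1 hom V) (h3 ▸ zsmul_mem hV _)
  refine ⟨-J, neg_mem hJ, ?_⟩
  have e : diff (p := 0) (-J) = -diff (p := 0) J := by
    funext k X
    exact map_neg X.1 J
  rwa [e, ← sub_eq_add_neg]

end GrAlg

namespace GradedLie

open GrAlg

variable {s : ℕ} (g : GradedLie s) {A : GrAlg.{u}} {B : GrAlg.{v}} {π : Hom B A}

/-- The failure of the currents to represent the Lie algebra is annihilated by the vertical vector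
fields `Z`: this is the condition on `L_V om` for `V = V_α`, evaluated on `V_β` and `Z`. -/
theorem vertical_apply_defect {om : Form A 2} {m : ℤ} (hom : om ∈ Omega2 A m) {V : ∀ α, Vect A (g.deg α)}
    (hrep : g.IsRepresentation V) (hV : ∀ α, IsVertical π (V α))
    (hlie : ∀ α, lie (V α) om ∈ Ideal2 π (m + g.deg α)) {J : Fin s → A}
    (hJ : ∀ α, contract (V α) om + diff (p := 0) (J α) ∈ Ideal1 π (m + g.deg α)) (α β : Fin s) {r : ℤ}
    {Z : Vect A r} (hZ : IsVertical π Z) :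
    Z (sgn (g.deg α) • V α (J β) - ∑ γ, g.U α β γ • J γ) = 0 := by
  have h0 : sgn (g.deg α * (g.deg β + 1)) • (sgn (g.deg α * (r + 1)) •
      (V α (contract2 Z (V β) om) - contract2 (bracket (V α) Z) (V β) om) -
      contract2 Z (bracket (V α) (V β)) om) = 0 := ideal2_apply (hlie α) (hV β) hZ
  have h1 : contract2 Z (bracket (V α) (V β)) om = -∑ γ, g.U α β γ • Z (J γ) := by
    have h2 := contract1_of_eq_sum (contract_mem_Omega1 hom Z) V (g.U α β) (g.degree α β)
      (bracket (V α) (V β)) (hrep α β)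
    change contract2 _ _ _ = ∑ γ, g.U α β γ • contract2 _ _ _ at h2
    rw [contract2_comm hom, h2, ← Finset.sum_neg_distrib, Finset.smul_sum]
    refine Finset.sum_congr rfl fun γ _ => ?_
    by_cases h : g.U α β γ = 0
    · simp [h]
    · rw [contract2_comm hom, ← g.degree α β γ h, contract2_of_hamiltonian (hJ γ) hZ, smul_neg, smul_neg, smul_neg,
        smul_comm, smul_smul, ← sgn_add, sgn_even (by grind), one_smul]
  have h3 : sgn (g.deg α * (r + 1)) • (V α (contract2 Z (V β) om) - contract2 (bracket (V α) Z) (V β) om) -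
      contract2 Z (bracket (V α) (V β)) om = 0 := by
    have := congrArg (fun a => sgn (g.deg α * (g.deg β + 1)) • a) h0
    simpa only [smul_smul, sgn_mul_self, one_smul, smul_zero] using this
  rw [h1, contract2_of_hamiltonian (hJ β) hZ, contract2_of_hamiltonian (hJ β) ((hV α).bracket hZ), bracket_apply,
    map_neg, neg_sub_neg, sub_sub_cancel_left, smul_neg, smul_smul, ← sgn_add,
    sgn_congr (n := g.deg α) (by grind)] at h3
  rw [map_sub, map_zsmul, map_sum, ← neg_eq_zero, ← h3]
  simp only [map_smul]
  abel

theorem coupling_mem {c J : Fin s → A} {n : ℤ} (hc : ∀ α, c α ∈ A.gr (g.ghost α))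
    (hJ : ∀ α, J α ∈ A.gr (n - 1 + g.deg α)) : g.coupling c J ∈ A.gr n := by
  refine sum_mem fun α _ => zsmul_mem ?_ _
  have := A.mul_mem (hc α) (hJ α)
  rwa [show g.ghost α + (n - 1 + g.deg α) = n by rw [ghost]; ring] at this

theorem anomaly_mem {c : Fin s → A} {f : Fin s → Fin s → A} {n : ℤ} (hc : ∀ α, c α ∈ A.gr (g.ghost α))
    (hf : ∀ α β, f α β ∈ A.gr (n - 1 + g.deg α + g.deg β)) : g.anomaly c f ∈ A.gr (n + 1) := by
  refine Submodule.smul_mem _ _ (sum_mem fun α _ => sum_mem fun β _ => zsmul_mem ?_ _)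
  have := A.mul_mem (A.mul_mem (hc α) (hc β)) (hf α β)
  rwa [show g.ghost α + g.ghost β + (n - 1 + g.deg α + g.deg β) = n + 1 by rw [ghost, ghost]; ring] at this

end GradedLie

/-! ### Conserved currents and the gauged presymplectic gauge PDE -/

open GrAlg

section Currents

variable {n : ℕ} {X : Type v} [TopologicalSpace X] [T2Space X]
  [ChartedSpace (EuclideanSpace ℝ (Fin n)) X] [IsManifold (𝓡 n) ∞ X]
  {m : ℕ} {M : Type w} [TopologicalSpace M] [T2Space M]
  [ChartedSpace (EuclideanSpace ℝ (Fin m)) M] [IsManifold (𝓡 m) ∞ M]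
  {E : GradedBundle.{u} n X m M} {dX : Vect (functionsT1 n X) 1}
  {Q : Vect E.functions 1} {om : Form E.functions 2} {L : E.functions}

/-- Existence of conserved currents: a hamiltonian `J` is annihilated by the kernel, and `Q J` is the
pullback of a closed form on `X`, which is exact or vanishes for degree reasons; correcting `J` by a
primitive makes it conserved. -/
theorem exists_isCurrent (hX : DeRhamVanishes dX) (hE : IsPresymplecticGPDE E.pull dX Q om L n)
    (H : RelativeH1Vanishes E.pull) {k : ℤ} (hk : k ≠ -n) {V : Vect E.functions k}
    (hV : IsInternalSymmetry E.pull Q om n V) : ∃ J, IsCurrent E.pull Q om n V J := by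
  obtain ⟨J, hJ, hVJ⟩ := exists_hamiltonian hE.om_mem hE.om_closed H hV.lie_mem
  have hJQ : Q J ∈ E.functions.gr (n + k) := by
    have := Vect.map_gr Q hJ
    rwa [show (n : ℤ) - 1 + k + 1 = n + k by ring] at this
  obtain ⟨h, hh, hQJ⟩ := GradedBundle.exists_pull_eq_of_vertical hJQ
    fun l Z hZ => hE.vertical_apply_apply hV.vertical hV.bracket_mem hVJ hZ
  have hdh : dX h = 0 := by
    refine E.pull_injective ?_
    rw [← hE.projects, hQJ, hE.apply_apply_eq_zero hV.vertical hVJ, map_zero]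
  obtain ⟨b, hb, hdb⟩ : ∃ b ∈ (functionsT1 n X).gr (n - 1 + k), dX b = h := by
    -- in degree `n + k < 0` there are no forms, and in positive degree closed forms are exact
    rcases lt_or_gt_of_ne (show (n : ℤ) + k ≠ 0 by grind) with h1 | h1
    · exact ⟨0, zero_mem _, by rw [functionsT1_eq_zero (Or.inl h1) hh, map_zero]⟩
    · obtain ⟨b, hb, hdb⟩ := hX _ h1 h hh hdh
      exact ⟨b, by rwa [show (n : ℤ) - 1 + k = n + k - 1 by ring], hdb⟩
  refine ⟨J - E.pull b, sub_mem hJ (E.pull.map_gr hb), ?_, ?_, ?_⟩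
  · rw [diff_sub, ← add_sub_assoc]
    exact sub_mem hVJ (diff_pull_mem hb)
  · rw [map_sub, hE.projects, hdb, hQJ, sub_self]
  · intro l Z hZ
    rw [map_sub, hZ.1, kernel_apply_eq_zero hE.om_mem hV.vertical hVJ hZ, sub_zero]

variable {s : ℕ} {g : GradedLie s} {V : ∀ α, Vect E.functions (g.deg α)} {J : Fin s → E.functions}

/-- The failure of the currents to represent the Lie algebra is the pullback of a form on `X`. -/
theorem exists_defect (hE : IsPresymplecticGPDE E.pull dX Q om L n)
    (hV : ∀ α, IsInternalSymmetry E.pull Q om n (V α)) (hrep : g.IsRepresentation V)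
    (hJ : ∀ α, IsCurrent E.pull Q om n (V α) (J α)) (α β : Fin s) :
    ∃ f ∈ (functionsT1 n X).gr (n - 1 + g.deg α + g.deg β),
      E.pull f = sgn (g.deg α) • V α (J β) - ∑ γ, g.U α β γ • J γ := by
  refine GradedBundle.exists_pull_eq_of_vertical (sub_mem (zsmul_mem ?_ _) (sum_mem fun γ _ => ?_))
    fun l Z hZ => g.vertical_apply_defect hE.om_mem hrep (fun α => (hV α).vertical) (fun α => (hV α).lie_mem)
      (fun α => (hJ α).hamiltonian) α β hZ
  · have := Vect.map_gr (V α) (hJ β).mem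
    rwa [add_right_comm] at this
  · by_cases h : g.U α β γ = 0
    · rw [h, zero_smul]
      exact zero_mem _
    · have := (hJ γ).mem
      rw [g.degree α β γ h, ← add_assoc] at this
      exact Submodule.smul_mem _ _ this

end Currents

namespace GradedLie

section Algebra

variable {s : ℕ} (g : GradedLie s) {A : GrAlg.{u}} {B : GrAlg.{v}} {π : Hom B A} {D : Vect B 1}
  {Q : Vect A 1} {om : Form A 2} {L : A} {n : ℤ} {V : ∀ α, Vect A (g.deg α)} {J : Fin s → A}

/-- Gauging over the product with `g[1]`: all conditions on a presymplectic gauge PDE hold except for the master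
equation, which holds up to the anomaly. -/
theorem exists_gauging (hE : IsPresymplecticGPDE π D Q om L n)
    (hV : ∀ α, IsInternalSymmetry π Q om n (V α)) (hJ : ∀ α, IsCurrent π Q om n (V α) (J α))
    {D' : Vect (g.adjoin B) 1} (hD' : g.IsBackground D D') {Q' : Vect (g.adjoin A) 1} (hQ' : g.IsGauging Q V Q') :
    ∃ om', IsPullback (g.proj A) om om' ∧
      IsPremaster (π.formalMap g.ghost) D' Q' om'
        (g.proj A L - g.coupling (g.c A) (fun α => g.proj A (J α))) n ∧
      master Q' om' (g.proj A L - g.coupling (g.c A) (fun α => g.proj A (J α))) +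
        g.anomaly (g.c A) (fun α β => g.proj A (sgn (g.deg α) • V α (J β) - ∑ γ, g.U α β γ • J γ)) = 0 := by
  obtain ⟨q, hq, rfl⟩ := exists_pull2 (g.proj A) hE.om_mem
  refine ⟨toForm2 (g.proj A) q.2.1, isPullback_toForm2 hq, ?_, ?_⟩
  · refine ⟨hD'.homological g hE.homological, hQ'.projects g hD' hE.projects fun α => (hV α).vertical,
      toForm2_mem hq, diff_toForm2_const hq hE.om_closed, ?_, ?_⟩
    · exact sub_mem ((g.proj A).map_gr hE.L_mem) (g.coupling_mem var_mem fun α => (g.proj A).map_gr (hJ α).mem)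
    · exact g.hamiltonian_gauging isDense_const (fun b => (formalMap_const π b).symm) hq hE.L_mem hE.hamiltonian
        (fun α => (hJ α).mem) (fun α => (hJ α).hamiltonian) var_mem hQ'.1 var_mem fun α => (formalMap_var π α).symm
  · exact g.master_gauging hq hE.hamiltonian (fun α => (hJ α).hamiltonian) var_mem hQ'.1 hE.om_mem
      (fun α => (hV α).vertical) hE.master_eq (fun α => (hJ α).conserved) hQ'.2

/-- The pullback of the gauged system to a flat background field `c`, when the anomaly vanishes there. -/
theorem exists_twist (hE : IsPresymplecticGPDE π D Q om L n)
    (hV : ∀ α, IsInternalSymmetry π Q om n (V α)) (hJ : ∀ α, IsCurrent π Q om n (V α) (J α))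
    {f : Fin s → Fin s → B} (hf : ∀ α β, π (f α β) = sgn (g.deg α) • V α (J β) - ∑ γ, g.U α β γ • J γ)
    {c : Fin s → B} (hc : ∀ α, c α ∈ B.gr (g.ghost α)) (hflat : ∀ γ, D (c γ) = g.quadratic c γ)
    (han : g.anomaly c f = 0) :
    ∃ QS : Vect A 1, (∀ a, QS a = Q a + ∑ α, π (c α) * V α a) ∧
      IsPresymplecticGPDE π D QS om (L - g.coupling (fun α => π (c α)) J) n := by
  let QS : Vect A 1 := Q + ∑ α, Vect.cast (sub_add_cancel 1 (g.deg α)) (Vect.leftMul (π.map_gr (hc α)) (V α))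
  have hQS : ∀ a, QS a = Q a + ∑ α, π (c α) * V α a := fun a => by
    change Q a + (∑ α, _ : Vect A 1) a = _
    rw [Vect.sum_apply]
    rfl
  have hproj : ∀ b, QS (π b) = π (D b) := fun b => by
    rw [hQS, hE.projects]
    simp only [(hV _).vertical _, mul_zero, Finset.sum_const_zero, add_zero]
  let p : Hom A A := ⟨AlgHom.id ℝ A, fun ha => ha⟩
  have hp : ∀ a, p a = a := fun _ => rfl
  have hcA : ∀ α, π (c α) ∈ A.gr (g.ghost α) := fun α => π.map_gr (hc α)
  obtain ⟨q, hq, rfl⟩ := exists_pull2 p hE.om_mem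
  refine ⟨QS, hQS, ⟨⟨hE.homological, hproj, hE.om_mem, hE.om_closed,
    sub_mem hE.L_mem (g.coupling_mem hcA fun α => (hJ α).mem), ?_⟩, ?_⟩⟩
  · have h := g.hamiltonian_gauging (π' := π) (p₀ := ⟨AlgHom.id ℝ B, fun ha => ha⟩) (isDense_of_forall_eq hp)
      (fun b => rfl) hq hE.L_mem hE.hamiltonian
      (fun α => (hJ α).mem) (fun α => (hJ α).hamiltonian) hcA hQS hc fun α => rfl
    rwa [toForm2_of_forall_eq hp hq] at h
  · have h := g.master_gauging hq hE.hamiltonian (fun α => (hJ α).hamiltonian) hcA hQS hE.om_mem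
      (fun α => (hV α).vertical) hE.master_eq (fun α => (hJ α).conserved)
      (fun γ => by rw [hproj, hflat, map_quadratic])
    have h2 := congrArg π.toAlgHom han
    rw [map_anomaly, map_zero] at h2
    simp only [hf] at h2
    rw [toForm2_of_forall_eq hp hq] at h
    change _ + g.anomaly (fun α => π (c α)) (fun α β => sgn (g.deg α) • V α (J β) - ∑ γ, g.U α β γ • J γ) = 0 at h
    rwa [h2, add_zero] at h

/-- A primitive of the anomaly restores the master equation. -/
theorem isPresymplecticGPDE_add (h : IsPremaster π D Q om L n) {a : B} (ha : master Q om L + π a = 0) {b : B}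
    (hb : b ∈ B.gr n) (hDb : D b = a) : IsPresymplecticGPDE π D Q om (L + π b) n := by
  refine ⟨⟨h.homological, h.projects, h.om_mem, h.om_closed, add_mem h.L_mem (π.map_gr hb), ?_⟩, ?_⟩
  · rw [diff_add, ← add_assoc]
    exact add_mem h.hamiltonian (diff_pull_mem hb)
  · rw [← ha, master, master, map_add, h.projects, hDb, add_assoc]

end Algebra

end GradedLie

end

theorem mainTheorem1
    {n : ℕ} {X : Type v} [TopologicalSpace X] [T2Space X] [SecondCountableTopology X]
    [ChartedSpace (EuclideanSpace ℝ (Fin n)) X] [IsManifold (𝓡 n) ∞ X]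
    {m : ℕ} {M : Type w} [TopologicalSpace M] [T2Space M] [SecondCountableTopology M]
    [ChartedSpace (EuclideanSpace ℝ (Fin m)) M] [IsManifold (𝓡 m) ∞ M]
    (E : GradedBundle.{u} n X m M)
    (dX : GrAlg.Vect (functionsT1 n X) 1) (hdX : IsDeRham dX)
    (hX : DeRhamVanishes dX)
    (Q : GrAlg.Vect E.functions 1) (om : GrAlg.Form E.functions 2) (L : E.functions)
    (hE : GrAlg.IsPresymplecticGPDE E.pull dX Q om L n)
    {s : ℕ} (g : GradedLie s) (V : ∀ α, GrAlg.Vect E.functions (g.deg α))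
    (hV : ∀ α, GrAlg.IsInternalSymmetry E.pull Q om n (V α))
    (hrep : g.IsRepresentation V) :
    (GrAlg.RelativeH1Vanishes E.pull → (∀ α, g.deg α ≠ -n) →
      ∃ J : Fin s → E.functions, ∀ α, GrAlg.IsCurrent E.pull Q om n (V α) (J α)) ∧
    ∀ J : Fin s → E.functions, (∀ α, GrAlg.IsCurrent E.pull Q om n (V α) (J α)) →
      ∃ (f : Fin s → Fin s → functionsT1 n X) (D : GrAlg.Vect (g.adjoin (functionsT1 n X)) 1)
        (Q' : GrAlg.Vect (g.adjoin E.functions) 1) (om' : GrAlg.Form (g.adjoin E.functions) 2),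
        let L' : g.adjoin E.functions :=
          g.proj E.functions L - g.coupling (g.c E.functions) (fun α => g.proj E.functions (J α))
        let πB : GrAlg.Hom (g.adjoin (functionsT1 n X)) (g.adjoin E.functions) :=
          E.pull.formalMap g.ghost
        let an : g.adjoin (functionsT1 n X) :=
          g.anomaly (g.c (functionsT1 n X)) (fun α β => g.proj (functionsT1 n X) (f α β))
        (∀ α β, f α β ∈ (functionsT1 n X).gr (n - 1 + g.deg α + g.deg β) ∧
          E.pull (f α β) = sgn (g.deg α) • V α (J β) - ∑ γ, g.U α β γ • J γ) ∧
        g.IsBackground dX D ∧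
        g.IsGauging Q V Q' ∧
        GrAlg.IsPullback (g.proj E.functions) om om' ∧
        GrAlg.IsPremaster πB D Q' om' L' n ∧
        GrAlg.master Q' om' L' + πB an = 0 ∧
        D an = 0 ∧
        (∀ b ∈ (g.adjoin (functionsT1 n X)).gr n, D b = an →
          GrAlg.IsPresymplecticGPDE πB D Q' om' (L' + πB b) n) ∧
        (∀ S : GrAlg.Hom (g.adjoin (functionsT1 n X)) (functionsT1 n X),
          (∀ a, S (g.proj (functionsT1 n X) a) = a) → (∀ b, S (D b) = dX (S b)) → S an = 0) ∧
        ∀ c : Fin s → functionsT1 n X, (∀ α, c α ∈ (functionsT1 n X).gr (g.ghost α)) →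
          (∀ γ, dX (c γ) = g.quadratic c γ) →
          g.anomaly c f = 0 ∧
          ∃ QS : GrAlg.Vect E.functions 1, (∀ a, QS a = Q a + ∑ α, E.pull (c α) * V α a) ∧
            GrAlg.IsPresymplecticGPDE E.pull dX QS om
              (L - g.coupling (fun α => E.pull (c α)) J) n := by
  refine ⟨fun H hdeg => ?_, fun J hJ => ?_⟩
  · choose J hJ using fun α => exists_isCurrent hX hE H (hdeg α) (hV α)
    exact ⟨J, hJ⟩
  choose f hf hpull using exists_defect hE hV hrep hJ
  have hD := g.isBackground_gauge dX
  have hQ := g.isGauging_gauge Q V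
  obtain ⟨om', hom', hpre, hmaster⟩ := g.exists_gauging hE hV hJ hD hQ
  -- the anomaly is a pullback, as the defects of the currents are
  have han : E.pull.formalMap g.ghost (g.anomaly (g.c (functionsT1 n X))
      (fun α β => g.proj (functionsT1 n X) (f α β))) = g.anomaly (g.c E.functions)
      (fun α β => g.proj E.functions (sgn (g.deg α) • V α (J β) - ∑ γ, g.U α β γ • J γ)) := by
    rw [GradedLie.map_anomaly]
    simp only [GrAlg.formalMap_var, GrAlg.formalMap_const, hpull]
  rw [← han] at hmaster
  refine ⟨f, g.gauge dX fun _ => 0, g.gauge Q V, om', fun α β => ⟨hf α β, hpull α β⟩, hD, hQ, hom', hpre,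
    hmaster, ?_, fun b hb hb' => GradedLie.isPresymplecticGPDE_add hpre hmaster hb hb', fun S hS _ => ?_, fun c hc hflat => ?_⟩
  -- the anomaly is closed, as its pullback is minus the left hand side of the master equation
  · refine GrAlg.formalMap_injective E.pull_injective ?_
    rw [← hpre.projects, eq_neg_of_add_eq_zero_right hmaster, map_neg, hpre.apply_master, neg_zero, map_zero]
  -- on a background solution the anomaly is a form of degree `n + 1` on `X`
  · refine functionsT1_eq_zero (k := n + 1) (Or.inr (lt_add_one _)) (S.map_gr ?_)
    exact g.anomaly_mem GrAlg.var_mem fun α β => (g.proj _).map_gr (hf α β)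
  · have h0 : g.anomaly c f = 0 :=
      functionsT1_eq_zero (k := n + 1) (Or.inr (lt_add_one _)) (g.anomaly_mem hc hf)
    exact ⟨h0, g.exists_twist hE hV hJ hpull hc hflat h0⟩
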